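/- **Setting.** Let $G$ be the dense $\ast$-Hopf algebra of a compact matrix quantum group $\mathcal G$, with coproduct $\phi$, antipode $\kappa$, and a bicovariant first order differential $\ast$-calculus $\Gamma$ with left-invariant forms ${}_{\rm inv}\Gamma$, quantum germs map $\pi: G\to{}_{\rm inv}\Gamma$, adjoint corepresentation $\mathrm{ad}$ on ${}_{\rm inv}\Gamma$ (assumed finite-dimensional and unitarizable), and universal differential envelope $\Gamma^\wedge$. Let $\zeta=(GM,M,\Phi)$ be a quantum principal $\mathcal G$-bundle with a differential calculus $\Omega^\bullet(GM)$ (a graded differential $\ast$-algebra generated in degree $0$) and $\Psi:\Omega^\bullet(GM)\to\Omega^\bullet(GM)\otimes\Gamma^\wedge$ extending $\Phi$. Put $\mathrm{Hor}=\{\varphi:\Psi(\varphi)\in\Omega^\bullet(GM)\otimes G\}$, with coaction ${}_{\rm H}\Phi(\varphi)=\varphi^{(0)}\otimes\varphi^{(1)}$, and $\Omega^\bullet(M)=\{\mu:\Psi(\mu)=\mu\otimes 1\}$. The base $M$ is a $\ast$-subalgebra of a $C^\ast$-algebra, and $\Omega^\bullet(M)$ carries a left quantum Riemannian metric $\langle-,-\rangle_{\rm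 L}$ (with $\langle\mu,\nu\rangle_{\rm R}=\langle\mu^\ast,\nu^\ast\rangle_{\rm L}$), a Riemannian volume form $\mathrm{dvol}$ of top degree $n$, a quantum integral $\int_M p\,\mathrm{dvol}=s(p)$ given by a state $s$, without boundary ($\int_M d\mu=0$) and making $\int_M\langle-,-\rangle_{\rm L}\,\mathrm{dvol}$ positive definite, and a left quantum Hodge operator, i.e. an antilinear bijection $\star_{\rm L}:\Omega^k(M)\to\Omega^{n-k}(M)$ with $\hat\mu(\star_{\rm L}\mu)=\langle\hat\mu,\mu\rangle_{\rm L}\,\mathrm{dvol}$; put $\star_{\rm R}=\ast\circ\star_{\rm L}\circ\ast$. A quantum principal connection is a linear map $\omega:{}_{\rm inv}\Gamma\to\Omega^1(GM)$ with $\Psi(\omega(\theta))=(\omega\otimes\mathrm{id})\mathrm{ad}(\theta)+1\otimes\theta$; a displacement is a linear map $\lambda:{}_{\rm inv}\Gamma\to\mathrm{Hor}^1$ with ${}_{\rm H}\Phi\circ\lambda=(\lambda\otimes\mathrm{id})\circ\mathrm{ad}$. For maps $\tau$ on ${}_{\rm inv}\Gamma$ and operators $X$ on forms write $\widehat\tau=\ast\circ\tau\circ\ast$,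 $\widehat X=\ast\circ X\circ\ast$. For $\varphi\in\mathrm{Hor}^k$ put $K^\lambda(\varphi)=-(-1)^k\varphi^{(0)}\lambda(\pi(\varphi^{(1)}))$ and $D^\omega(\varphi)=d\varphi-(-1)^k\varphi^{(0)}\omega(\pi(\varphi^{(1)}))$. Fix an embedded differential $\delta:{}_{\rm inv}\Gamma\to{}_{\rm inv}\Gamma\otimes{}_{\rm inv}\Gamma$ ($\mathrm{ad}$-covariant, with $d\theta=\sum\theta_1\theta_2$ if $\delta(\theta)=\sum\theta_1\otimes\theta_2$), and put $\langle\sigma,\tau\rangle=m(\sigma\otimes\tau)\delta$, $[\sigma,\tau]=m(\sigma\otimes\tau)(\mathrm{id}\otimes\pi)\mathrm{ad}$, $R^\omega=d\omega-\langle\omega,\omega\rangle$, and $S^\omega(\tau)=\langle\omega,\tau\rangle-(-1)^k\langle\tau,\omega\rangle-(-1)^k[\tau,\omega]$ for $\tau$ with values in degree $k$. For a finite-dimensional corepresentation $\beta$ on $V^\beta$, the sections are $\Gamma^{\rm L}(M,V^\beta M)=\Gamma^{\rm R}(M,V^\beta M)=\mathrm{Mor}(\beta,\Phi)$. The bundle-valued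 forms are $\Omega^\bullet(M)\otimes_M\Gamma^{\rm L}$ and $\Gamma^{\rm R}\otimes_M\Omega^\bullet(M)$, and $\Upsilon_\beta,\widetilde\Upsilon_\beta$ are the inverses of the isomorphisms $\mu\otimes T\mapsto\mu T$, $T\otimes\mu\mapsto T\mu$ onto $\mathrm{Mor}(\beta,{}_{\rm H}\Phi)$. The hermitian structures are $\langle T,T'\rangle_{\rm L}=\sum_k T(e_k)T'(e_k)^\ast$ and $\langle T,T'\rangle_{\rm R}=\sum_k T(e_k)^\ast T'(e_k)$, where $(e_k)$ is a basis that is orthonormal for an inner product making $\beta$ (for the right structure: the conjugate of $\beta$) unitary; on forms $\langle\mu_1\otimes T_1,\mu_2\otimes T_2\rangle_{\rm L}=\langle\mu_1\langle T_1,T_2\rangle_{\rm L},\mu_2\rangle_{\rm L}$ and $\langle T_1\otimes\mu_1,T_2\otimes\mu_2\rangle_{\rm R}=\langle\mu_1,\langle T_1,T_2\rangle_{\rm R}\,\mu_2\rangle_{\rm R}$; and $\langle-|-\rangle=\int_M\langle-,-\rangle\,\mathrm{dvol}$. For $\beta\in\{\alpha,\mathrm{ad}\}$ finitely many sections $T_k$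 with $\sum_k T_k(e_i)^\ast T_k(e_j)=\delta_{ij}1$ are assumed to exist, where $\alpha$ is a fixed finite-dimensional unitary representation on $V^\alpha$; its complex conjugate $\overline\alpha$ on $\overline{V^\alpha}$ is used with the conjugate basis. Put $\nabla^\omega_\beta T=\Upsilon_\beta(D^\omega\circ T)$, $\widehat\nabla^\omega_\beta T=\widetilde\Upsilon_\beta(\widehat{D^\omega}\circ T)$, $d^{\nabla^\omega_\beta}=\Upsilon_\beta\circ D^\omega\circ\Upsilon_\beta^{-1}$, $d^{\widehat\nabla^\omega_\beta}=\widetilde\Upsilon_\beta\circ\widehat{D^\omega}\circ\widetilde\Upsilon_\beta^{-1}$. Their adjoint operators on forms of degree $k+1$ are $$d^{\nabla^\omega_\beta\star_{\rm L}}=(-1)^{k+1}\bigl((\star_{\rm L}^{-1}\circ\ast)\otimes_M\mathrm{id}\bigr)\circ d^{\nabla^{\widehat\omega}_\beta}\circ\bigl((\ast\circ\star_{\rm L})\otimes_M\mathrm{id}\bigr),$$ $$d^{\widehat\nabla^\omega_\beta\star_{\rm R}}=(-1)^{k+1}\bigl(\mathrm{id}\otimes_M(\star_{\rm R}^{-1}\circ\ast)\bigr)\circ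 d^{\widehat\nabla^{\widehat\omega}_\beta}\circ\bigl(\mathrm{id}\otimes_M(\ast\circ\star_{\rm R})\bigr),$$ written $\nabla^{\omega\star_{\rm L}}_\beta,\widehat\nabla^{\omega\star_{\rm R}}_\beta$ on one-forms. The operators $\Upsilon_{\rm ad}S^\omega\Upsilon_{\rm ad}^{-1}$ and $\widetilde\Upsilon_{\rm ad}\widehat{S}^\omega\widetilde\Upsilon_{\rm ad}^{-1}$, where $\widehat{S}^\omega(\tau)=\widehat{S^\omega(\widehat\tau)}$, are assumed adjointable for every $\omega$, with adjoints $d^{S^\omega\star_{\rm L}}$ and $d^{\widehat S^\omega\star_{\rm R}}$. Finally let $V:M\to M$ be a Fréchet differentiable potential with derivative $V':M\to M$, in the sense that $\int_M DV_p(h)\,\mathrm{dvol}=\int_M V'(p)\,h\,\mathrm{dvol}$ for self-adjoint $p,h\in M$. Write $V_{\rm L}(T_1)=V(\langle T_1,T_1\rangle_{\rm L})$, $V_{\rm R}(T_2)=V(\langle T_2,T_2\rangle_{\rm R})$, $V'_{\rm L}(T_1)=V'(\langle T_1,T_1\rangle_{\rm L})$, $V'_{\rm R}(T_2)=V'(\langle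 T_2,T_2\rangle_{\rm R})$. The action is $\mathscr S(\omega,T_1,T_2)=\int_M\mathscr L\,\mathrm{dvol}$ with $$\mathscr L=-\tfrac14\bigl(\langle R^\omega,R^\omega\rangle_{\rm L}+\langle\widehat R^\omega,\widehat R^\omega\rangle_{\rm R}\bigr)+\tfrac14\bigl(\langle\nabla^\omega_\alpha T_1,\nabla^\omega_\alpha T_1\rangle_{\rm L}-V_{\rm L}(T_1)-\langle\widehat\nabla^\omega_{\overline\alpha}T_2,\widehat\nabla^\omega_{\overline\alpha}T_2\rangle_{\rm R}+V_{\rm R}(T_2)\bigr),$$ where $R^\omega$ and $\widehat R^\omega$ are read as bundle-valued forms through $\Upsilon_{\rm ad}$ and $\widetilde\Upsilon_{\rm ad}$. With $\partial/\partial z$ the Wirtinger derivative (existence of the real derivative included), $(\omega,T_1,T_2)$ is a *stationary point* if for all displacements $\lambda$ and all $U_1\in\Gamma^{\rm L}(M,V^\alpha M)$, $U_2\in\Gamma^{\rm R}(M,\overline{V^\alpha}M)$ $$\left.\tfrac{\partial}{\partial z}\right|_{z=0}\mathscr S(\omega+z\lambda,T_1,T_2)=\left.\tfrac{\partial}{\partial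 z}\right|_{z=0}\mathscr S(\omega,T_1+zU_1,T_2+zU_2)=0 .$$ **Theorem.** Let $\omega$ be a quantum principal connection, $T_1\in\Gamma^{\rm L}(M,V^\alpha M)$ and $T_2\in\Gamma^{\rm R}(M,\overline{V^\alpha}M)$. Assume that for all $U_1$, $U_2$ $$\left.\tfrac{\partial}{\partial z}\right|_{z=0}\int_M V_{\rm L}(T_1+zU_1)\,\mathrm{dvol}=\int_M\left.\tfrac{\partial}{\partial z}\right|_{z=0}V_{\rm L}(T_1+zU_1)\,\mathrm{dvol},\qquad \langle V'_{\rm L}(T_1)U_1\,|\,T_1\rangle_{\rm L}=\langle U_1\,|\,V'_{\rm L}(T_1)^\ast T_1\rangle_{\rm L},$$ $$\left.\tfrac{\partial}{\partial z}\right|_{z=0}\int_M V_{\rm R}(T_2+zU_2)\,\mathrm{dvol}=\int_M\left.\tfrac{\partial}{\partial z}\right|_{z=0}V_{\rm R}(T_2+zU_2)\,\mathrm{dvol},\qquad \langle T_2\,|\,U_2V'_{\rm R}(T_2)\rangle_{\rm R}=\langle T_2V'_{\rm R}(T_2)^\ast\,|\,U_2\rangle_{\rm R}.$$ Then $(\omega,T_1,T_2)$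 is a stationary point of $\mathscr S$ if and only if for every displacement $\lambda$ $$\langle\Upsilon_\alpha\circ K^\lambda(T_1)\,|\,\nabla^\omega_\alpha T_1\rangle_{\rm L}-\langle\widetilde\Upsilon_{\overline\alpha}\circ\widehat K^\lambda(T_2)\,|\,\widehat\nabla^\omega_{\overline\alpha}T_2\rangle_{\rm R}=\langle\Upsilon_{\rm ad}\circ\lambda\,|\,(d^{\nabla^\omega_{\rm ad}\star_{\rm L}}-d^{S^\omega\star_{\rm L}})R^\omega\rangle_{\rm L}+\langle\widetilde\Upsilon_{\rm ad}\circ\widehat\lambda\,|\,(d^{\widehat\nabla^\omega_{\rm ad}\star_{\rm R}}-d^{\widehat S^\omega\star_{\rm R}})\widehat R^\omega\rangle_{\rm R}$$ and $$\nabla^{\omega\star_{\rm L}}_\alpha(\nabla^\omega_\alpha T_1)-V'_{\rm L}(T_1)^\ast T_1=0,\qquad \widehat\nabla^{\omega\star_{\rm R}}_{\overline\alpha}(\widehat\nabla^\omega_{\overline\alpha}T_2)-T_2V'_{\rm R}(T_2)^\ast=0 .$$ -/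

import Mathlib

open scoped TensorProduct ComplexOrder

set_option linter.unusedSectionVars false

universe u

namespace QYM

noncomputable section

/-! ### Graded differential star-algebras -/

section Graded

variable {A : Type*} [Ring A] [Algebra ℂ A] (𝒜 : ℕ → Submodule ℂ A) [GradedAlgebra 𝒜]

/-- The grading involution `a ↦ (-1)^k a` for `a` of degree `k`. -/
def gradeInv : A →ₗ[ℂ] A :=
  DirectSum.toModule ℂ ℕ A (fun k => ((-1 : ℂ) ^ k) • (𝒜 k).subtype) ∘ₗ
    (DirectSum.decomposeLinearEquiv 𝒜).toLinearMap

/-- The structure of a graded differential star-algebra, generated as such by its elements of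
degree zero, on a graded complex algebra. The involution is antilinear, graded antimultiplicative
and commutes with the differential. -/
structure StarDGA where
  d : A →ₗ[ℂ] A
  d_mem : ∀ {k : ℕ} {a : A}, a ∈ 𝒜 k → d a ∈ 𝒜 (k + 1)
  d_d : ∀ a, d (d a) = 0
  leibniz : ∀ {k : ℕ} {a : A}, a ∈ 𝒜 k → ∀ b, d (a * b) = d a * b + (-1 : ℂ) ^ k • (a * d b)
  st : A →ₛₗ[starRingEnd ℂ] A
  st_st : ∀ a, st (st a) = a
  st_mem : ∀ {k : ℕ} {a : A}, a ∈ 𝒜 k → st a ∈ 𝒜 k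
  st_mul : ∀ {k l : ℕ} {a b : A}, a ∈ 𝒜 k → b ∈ 𝒜 l →
    st (a * b) = (-1 : ℂ) ^ (k * l) • (st b * st a)
  st_d : ∀ a, st (d a) = d (st a)
  gen : Algebra.adjoin ℂ ({a : A | a ∈ 𝒜 0} ∪ d '' {a : A | a ∈ 𝒜 0}) = ⊤

variable {𝒜}

theorem StarDGA.st_mul_zero_right (D : StarDGA 𝒜) (a : A) {b : A} (hb : b ∈ 𝒜 0) :
    D.st (a * b) = D.st b * D.st a := by
  induction a using DirectSum.Decomposition.inductionOn 𝒜 with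
  | zero => simp
  | homogeneous a => simpa using D.st_mul a.2 hb
  | add x y hx hy => simp only [add_mul, mul_add, map_add, hx, hy]

theorem StarDGA.st_mul_zero_left (D : StarDGA 𝒜) {a : A} (b : A) (ha : a ∈ 𝒜 0) :
    D.st (a * b) = D.st b * D.st a := by
  induction b using DirectSum.Decomposition.inductionOn 𝒜 with
  | zero => simp
  | homogeneous b => simpa using D.st_mul ha b.2
  | add x y hx hy => simp only [add_mul, mul_add, map_add, hx, hy]

theorem StarDGA.st_one (D : StarDGA 𝒜) : D.st 1 = 1 := by
  have h := D.st_mul_zero_right (D.st 1) (SetLike.GradedOne.one_mem (A := 𝒜))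
  rw [mul_one, D.st_st, mul_one] at h
  exact h.symm

end Graded

/-! ### Compact matrix quantum groups -/

section QuantumGroup

variable (G : Type u) [Ring G] [HopfAlgebra ℂ G] [StarRing G] [StarModule ℂ G]

/-- `G` is the dense star-Hopf algebra of a compact matrix quantum group: a star-Hopf algebra which
is generated as a star-algebra by the entries of one finite-dimensional unitary corepresentation. -/
structure IsCompactMatrixQuantumGroup : Prop where
  comul_star : ∀ g : G, Coalgebra.comul (R := ℂ) (star g) = star (Coalgebra.comul (R := ℂ) g)
  fundamental : ∃ (n : ℕ) (x : Matrix (Fin n) (Fin n) G),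
    (∀ i j, Coalgebra.comul (R := ℂ) (x i j) = ∑ k, x i k ⊗ₜ[ℂ] x k j) ∧
    (∀ i j, Coalgebra.counit (R := ℂ) (x i j) = if i = j then 1 else 0) ∧
    x ∈ unitary (Matrix (Fin n) (Fin n) G) ∧
    Algebra.adjoin ℂ ({g | ∃ i j, x i j = g} ∪ {g | ∃ i j, star (x i j) = g}) = ⊤

/-- The right adjoint coaction `g ↦ g₂ ⊗ κ(g₁) g₃`. -/
def Ad : G →ₗ[ℂ] G ⊗[ℂ] G :=
  (LinearMap.mul' ℂ G ∘ₗ (HopfAlgebra.antipode ℂ).rTensor G).lTensor G ∘ₗ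
    (TensorProduct.leftComm ℂ G G G).toLinearMap ∘ₗ
    (Coalgebra.comul (R := ℂ)).lTensor G ∘ₗ Coalgebra.comul (R := ℂ)

/-- A bicovariant first order differential star-calculus on `G`, given by its canonical right ideal:
a right ideal of `G` inside the kernel of the counit, stable under the adjoint coaction
and under `g ↦ κ(g)*`. -/
structure BicovariantCalculus where
  ideal : Submodule ℂ G
  counit_eq_zero : ∀ r ∈ ideal, Coalgebra.counit (R := ℂ) r = 0
  mul_mem : ∀ r ∈ ideal, ∀ g : G, r * g ∈ ideal
  ad_mem : ∀ r ∈ ideal, Ad G r ∈ LinearMap.range (ideal.subtype.rTensor G)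
  star_mem : ∀ r ∈ ideal, star (HopfAlgebra.antipode ℂ r) ∈ ideal

variable {G}

/-- The kernel of the quantum germs map: the canonical ideal together with the constants. -/
abbrev BicovariantCalculus.kerGerm (R : BicovariantCalculus G) : Submodule ℂ G :=
  R.ideal ⊔ Submodule.span ℂ {1}

/-- The space of left-invariant one-forms. Since `G = ker ε ⊕ ℂ 1`, it is `ker ε` modulo the
canonical ideal. -/
abbrev BicovariantCalculus.Inv (R : BicovariantCalculus G) : Type u := G ⧸ R.kerGerm

namespace BicovariantCalculus

variable (R : BicovariantCalculus G)

/-- The quantum germs map `π`. -/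
def germ : G →ₗ[ℂ] R.Inv := R.kerGerm.mkQ

theorem germ_eq_zero {g : G} (hg : g ∈ R.kerGerm) : R.germ g = 0 :=
  (Submodule.Quotient.mk_eq_zero _).2 hg

/-- The adjoint corepresentation on left-invariant forms, `ad ∘ π = (π ⊗ id) ∘ Ad`. -/
def ad : R.Inv →ₗ[ℂ] R.Inv ⊗[ℂ] G :=
  R.kerGerm.liftQ (R.germ.rTensor G ∘ₗ Ad G) <| by
    refine sup_le ?_ ?_
    · intro r hr
      obtain ⟨t, ht⟩ := R.ad_mem r hr
      have h0 : R.germ ∘ₗ R.ideal.subtype = 0 := by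
        ext x
        exact R.germ_eq_zero (Submodule.mem_sup_left x.2)
      rw [LinearMap.mem_ker, LinearMap.comp_apply, ← ht, ← LinearMap.comp_apply,
        ← LinearMap.rTensor_comp, h0, LinearMap.rTensor_zero, LinearMap.zero_apply]
    · rw [Submodule.span_singleton_le_iff_mem, LinearMap.mem_ker]
      have h1 : R.germ 1 = 0 :=
        R.germ_eq_zero (Submodule.mem_sup_right (Submodule.mem_span_singleton_self 1))
      simp [Ad, Bialgebra.comul_one, Algebra.TensorProduct.one_def, h1]

/-- The involution on left-invariant forms, `π(g)* = -π(κ(g)*)`. -/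
def starInv : R.Inv →ₛₗ[starRingEnd ℂ] R.Inv :=
  R.kerGerm.mapQ R.kerGerm
    (-((starLinearEquiv ℂ (A := G)).toLinearMap.comp (HopfAlgebra.antipode ℂ))) <| by
    refine sup_le ?_ ?_
    · intro r hr
      rw [Submodule.mem_comap]
      exact Submodule.neg_mem _ (Submodule.mem_sup_left (R.star_mem r hr))
    · rw [Submodule.span_singleton_le_iff_mem, Submodule.mem_comap]
      refine Submodule.neg_mem _ (Submodule.mem_sup_right ?_)
      simp [HopfAlgebra.antipode_one]

/-- The transposed commutator `cᵀ = (id ⊗ π) ∘ ad`. -/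
def transposedCommutator : R.Inv →ₗ[ℂ] R.Inv ⊗[ℂ] R.Inv := R.germ.lTensor R.Inv ∘ₗ R.ad

/-- `g ⊗ h ↦ g h₁ ⊗ π(h₂)`, the expression of the one-form `g dh` in `G ⊗ Inv`. -/
def oneForm : G ⊗[ℂ] G →ₗ[ℂ] G ⊗[ℂ] R.Inv :=
  TensorProduct.map (LinearMap.mul' ℂ G) R.germ ∘ₗ (TensorProduct.assoc ℂ G G G).symm.toLinearMap ∘ₗ
    (Coalgebra.comul (R := ℂ)).lTensor G

end BicovariantCalculus

/-- `g ⊗ h ↦ f₀(g) f₁(h)`. -/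
def mulMap {A : Type*} [Ring A] [Algebra ℂ A] (f₀ f₁ : G →ₗ[ℂ] A) : G ⊗[ℂ] G →ₗ[ℂ] A :=
  LinearMap.mul' ℂ A ∘ₗ TensorProduct.map f₀ f₁

/-- A graded differential star-algebra is the universal differential envelope star-calculus
of a bicovariant first order calculus `Γ`: its part of degree zero is `G`, in degree one
`∑ gᵢ dhᵢ = 0` holds exactly if it holds in `Γ = G ⊗ Inv`, and it is the quotient of the tensor
algebra `⊗_G Γ` by the two-sided ideal generated by the elements `∑ dgᵢ ⊗ dhᵢ` with
`∑ gᵢ dhᵢ = 0`, which is expressed by the universal property of this quotient. -/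
structure Envelope (R : BicovariantCalculus G) {W : Type u} [Ring W] [Algebra ℂ W]
    (ℬ : ℕ → Submodule ℂ W) [GradedAlgebra ℬ] extends StarDGA ℬ where
  incl : G →ₐ[ℂ] W
  incl_injective : Function.Injective incl
  mem_zero_iff : ∀ x : W, x ∈ ℬ 0 ↔ ∃ g, incl g = x
  st_incl : ∀ g, st (incl g) = incl (star g)
  first_order : ∀ t : G ⊗[ℂ] G,
    mulMap incl.toLinearMap (d ∘ₗ incl.toLinearMap) t = 0 ↔ R.oneForm t = 0
  universal : ∀ (X : Type u) [Ring X] [Algebra ℂ X] (f₀ : G →ₐ[ℂ] X) (f₁ : G →ₗ[ℂ] X),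
    (∀ g h, f₁ (g * h) = f₁ g * f₀ h + f₀ g * f₁ h) →
    (∀ t, R.oneForm t = 0 → mulMap f₀.toLinearMap f₁ t = 0 ∧ mulMap f₁ f₁ t = 0) →
    ∃! F : W →ₐ[ℂ] X, ∀ g, F (incl g) = f₀ g ∧ F (d (incl g)) = f₁ g

namespace Envelope

variable {R : BicovariantCalculus G} {W : Type u} [Ring W] [Algebra ℂ W]
  {ℬ : ℕ → Submodule ℂ W} [GradedAlgebra ℬ] (E : Envelope R ℬ)

theorem incl_mem (g : G) : E.incl g ∈ ℬ 0 := (E.mem_zero_iff _).2 ⟨g, rfl⟩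

/-- `g ↦ κ(g₁) dg₂`. -/
def germForm : G →ₗ[ℂ] W :=
  mulMap E.incl.toLinearMap (E.d ∘ₗ E.incl.toLinearMap) ∘ₗ (HopfAlgebra.antipode ℂ).rTensor G ∘ₗ
    Coalgebra.comul (R := ℂ)

theorem oneForm_antipode (g : G) :
    R.oneForm ((HopfAlgebra.antipode ℂ).rTensor G (Coalgebra.comul (R := ℂ) g)) =
      1 ⊗ₜ[ℂ] R.germ g := by
  have h1 : ∀ t : G ⊗[ℂ] G, R.oneForm ((HopfAlgebra.antipode ℂ).rTensor G t) =
      TensorProduct.map (LinearMap.mul' ℂ G ∘ₗ (HopfAlgebra.antipode ℂ).rTensor G) R.germ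
        ((TensorProduct.assoc ℂ G G G).symm ((Coalgebra.comul (R := ℂ)).lTensor G t)) := by
    intro t
    induction t with
    | zero => simp
    | add x y hx hy => simp only [map_add, hx, hy]
    | tmul x y =>
      simp only [BicovariantCalculus.oneForm, LinearMap.comp_apply, LinearMap.rTensor_tmul,
        LinearMap.lTensor_tmul, LinearEquiv.coe_coe]
      generalize Coalgebra.comul (R := ℂ) y = z
      induction z with
      | zero => simp
      | add x y hx hy => simp only [map_add, TensorProduct.tmul_add, hx, hy]
      | tmul a b => simp
  rw [h1, Coalgebra.coassoc_symm_apply]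
  have h2 : ∀ t : G ⊗[ℂ] G,
      TensorProduct.map (LinearMap.mul' ℂ G ∘ₗ (HopfAlgebra.antipode ℂ).rTensor G) R.germ
        ((Coalgebra.comul (R := ℂ)).rTensor G t) =
      1 ⊗ₜ[ℂ] R.germ (TensorProduct.lid ℂ G ((Coalgebra.counit (R := ℂ)).rTensor G t)) := by
    intro t
    induction t with
    | zero => simp
    | add x y hx hy => simp only [map_add, TensorProduct.tmul_add, hx, hy]
    | tmul x y =>
      simp [HopfAlgebra.mul_antipode_rTensor_comul_apply, Algebra.algebraMap_eq_smul_one,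
        TensorProduct.smul_tmul]
  rw [h2, Coalgebra.rTensor_counit_comul]
  simp

/-- The embedding of the left-invariant one-forms, `π(g) ↦ κ(g₁) dg₂`. -/
def invIncl : R.Inv →ₗ[ℂ] W :=
  R.kerGerm.liftQ E.germForm <| by
    intro g hg
    rw [LinearMap.mem_ker]
    refine (E.first_order _).2 ?_
    rw [LinearMap.comp_apply, oneForm_antipode, R.germ_eq_zero hg, TensorProduct.tmul_zero]

/-- The projection onto the part of degree zero, which is `G`. -/
def toG : W →ₗ[ℂ] G :=
  (LinearEquiv.ofInjective E.incl.toLinearMap E.incl_injective).symm.toLinearMap ∘ₗ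
    (GradedAlgebra.proj ℬ 0).codRestrict (LinearMap.range E.incl.toLinearMap) (fun x => by
      obtain ⟨g, hg⟩ := (E.mem_zero_iff _).1 (DirectSum.decompose ℬ x 0).2
      exact ⟨g, by simpa [GradedAlgebra.proj_apply] using hg⟩)

/-- An embedded differential: an ad-covariant map `δ : Inv → Inv ⊗ Inv` which lifts the differential
of the envelope, i.e. `dθ = ∑ θ₁ θ₂` if `δ(θ) = ∑ θ₁ ⊗ θ₂`. -/
structure EmbeddedDifferential where
  δ : R.Inv →ₗ[ℂ] R.Inv ⊗[ℂ] R.Inv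
  covariant : δ.rTensor G ∘ₗ R.ad =
    (LinearMap.mul' ℂ G).lTensor (R.Inv ⊗[ℂ] R.Inv) ∘ₗ
      (TensorProduct.tensorTensorTensorComm ℂ R.Inv G R.Inv G).toLinearMap ∘ₗ
      TensorProduct.map R.ad R.ad ∘ₗ δ
  lift_d : ∀ θ, E.d (E.invIncl θ) =
    LinearMap.mul' ℂ W (TensorProduct.map E.invIncl E.invIncl (δ θ))

end Envelope

/-! ### Corepresentations -/

section Corep

variable {V : Type*} [AddCommGroup V] [Module ℂ V]

/-- `α : V → V ⊗ G` is a right corepresentation. -/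
structure IsCorep (α : V →ₗ[ℂ] V ⊗[ℂ] G) : Prop where
  counit : ∀ v, TensorProduct.rid ℂ V ((Coalgebra.counit (R := ℂ)).lTensor V (α v)) = v
  coassoc : ∀ v, TensorProduct.assoc ℂ V G G (α.rTensor G (α v)) =
    (Coalgebra.comul (R := ℂ)).lTensor V (α v)

/-- A basis `e` of `V` in which the matrix of `α`, `α(eᵢ) = ∑ eⱼ ⊗ gⱼᵢ`, is unitary, i.e. an
orthonormal basis for an inner product on `V` for which `α` is unitary. -/
structure UnitaryBasis (α : V →ₗ[ℂ] V ⊗[ℂ] G) (κ : Type*) [Fintype κ] [DecidableEq κ] where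
  e : Module.Basis κ ℂ V
  mat : Matrix κ κ G
  coact : ∀ i, α (e i) = ∑ j, e j ⊗ₜ[ℂ] mat j i
  unitary : mat ∈ unitary (Matrix κ κ G)

/-- A basis `e` of `V` in which the matrix of `α` has a unitary entrywise conjugate, i.e. an
orthonormal basis for an inner product on `V` for which the complex conjugate corepresentation
of `α` is unitary. -/
structure ConjUnitaryBasis (α : V →ₗ[ℂ] V ⊗[ℂ] G) (κ : Type*) [Fintype κ] [DecidableEq κ] where
  e : Module.Basis κ ℂ V
  mat : Matrix κ κ G
  coact : ∀ i, α (e i) = ∑ j, e j ⊗ₜ[ℂ] mat j i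
  unitary : mat.map star ∈ unitary (Matrix κ κ G)

/-- The complex conjugate vector space. -/
def Conj (V : Type*) : Type _ := V

instance : AddCommGroup (Conj V) := inferInstanceAs (AddCommGroup V)

instance : Module ℂ (Conj V) := Module.compHom V (starRingEnd ℂ)

/-- The identity map, as an antilinear map to the conjugate space. -/
def toConj : V →ₛₗ[starRingEnd ℂ] Conj V where
  toFun v := v
  map_add' _ _ := rfl
  map_smul' c v := by
    change c • v = (starRingEnd ℂ (starRingEnd ℂ c)) • v
    rw [Complex.conj_conj]

/-- The identity map, as an antilinear map from the conjugate space. -/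
def ofConj : Conj V →ₛₗ[starRingEnd ℂ] V where
  toFun v := v
  map_add' _ _ := rfl
  map_smul' _ _ := rfl

/-- The complex conjugate corepresentation: `v ↦ ∑ v₀ ⊗ v₁*` if `α(v) = ∑ v₀ ⊗ v₁`. -/
def conjCorep (α : V →ₗ[ℂ] V ⊗[ℂ] G) : Conj V →ₗ[ℂ] Conj V ⊗[ℂ] G :=
  (TensorProduct.map (toConj (V := V)) (starLinearEquiv ℂ (A := G)).toLinearMap).comp (α.comp ofConj)

/-- A basis of `V`, as a basis of the conjugate space. -/
def conjBasis {κ : Type*} [Fintype κ] (b : Module.Basis κ ℂ V) : Module.Basis κ ℂ (Conj V) :=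
  Module.Basis.ofEquivFun
    { toFun := fun v i => starRingEnd ℂ (b.equivFun (ofConj v) i)
      invFun := fun f => toConj (b.equivFun.symm fun i => starRingEnd ℂ (f i))
      map_add' := fun v w => by ext i; simp
      map_smul' := fun c v => by ext i; simp
      left_inv := fun v => by
        simp only [Complex.conj_conj, LinearEquiv.symm_apply_apply]
        rfl
      right_inv := fun f => by
        ext i
        change starRingEnd ℂ (b.equivFun (b.equivFun.symm fun i => starRingEnd ℂ (f i)) i) = f i
        rw [LinearEquiv.apply_symm_apply, Complex.conj_conj] }

theorem conjBasis_apply {κ : Type*} [Fintype κ] (b : Module.Basis κ ℂ V) (i : κ) :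
    conjBasis b i = toConj (b i) := by
  classical
  apply (conjBasis b).equivFun.injective
  ext j
  rw [Module.Basis.equivFun_self]
  change _ = starRingEnd ℂ (b.equivFun (b i) j)
  rw [Module.Basis.equivFun_self]
  split_ifs <;> simp

/-- An orthonormal basis of `V`, as a basis of the conjugate space. -/
def UnitaryBasis.conj {α : V →ₗ[ℂ] V ⊗[ℂ] G} {κ : Type*} [Fintype κ] [DecidableEq κ]
    (b : UnitaryBasis α κ) : ConjUnitaryBasis (conjCorep α) κ where
  e := conjBasis b.e
  mat := b.mat.map star
  coact i := by
    rw [conjBasis_apply]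
    change TensorProduct.map (toConj (V := V)) (starLinearEquiv ℂ (A := G)).toLinearMap
      (α (b.e i)) = _
    rw [b.coact, map_sum]
    refine Finset.sum_congr rfl fun j _ => ?_
    rw [conjBasis_apply]
    rfl
  unitary := by
    have : (b.mat.map star).map star = b.mat := by ext; simp
    rw [this]
    exact b.unitary

end Corep

/-! ### Quantum principal bundles -/

section Bundle

variable {R : BicovariantCalculus G} {W : Type u} [Ring W] [Algebra ℂ W]
  {ℬ : ℕ → Submodule ℂ W} [GradedAlgebra ℬ]
  {A : Type*} [Ring A] [Algebra ℂ A]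

/-- A quantum principal bundle with a differential calculus: the forms on the total space are a
graded differential star-algebra with total space `𝒜 0`, on which `Φ` is a coaction such that
`x ⊗ y ↦ x Φ(y)` is onto, and `Φ` extends to a morphism `Ψ` of graded differential star-algebras.
(That `Φ` respects the involution is the case of degree zero of `Ψ_st`, and `Ψ` respects degrees
because the forms are generated in degree zero.) -/
structure QuantumPrincipalBundle (E : Envelope R ℬ) (𝒜 : ℕ → Submodule ℂ A) [GradedAlgebra 𝒜]
    extends StarDGA 𝒜 where
  Φ : 𝒜 0 →ₐ[ℂ] 𝒜 0 ⊗[ℂ] G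
  Φ_corep : IsCorep Φ.toLinearMap
  galois : Submodule.span ℂ {t : 𝒜 0 ⊗[ℂ] G | ∃ x y : 𝒜 0, (x ⊗ₜ[ℂ] (1 : G)) * Φ y = t} = ⊤
  Ψ : A →ₐ[ℂ] 𝒜 ᵍ⊗[ℂ] ℬ
  Ψ_Φ : ∀ x : 𝒜 0, (GradedTensorProduct.of ℂ 𝒜 ℬ).symm (Ψ x) =
    TensorProduct.map (𝒜 0).subtype E.incl.toLinearMap (Φ x)
  Ψ_d : ∀ a, (GradedTensorProduct.of ℂ 𝒜 ℬ).symm (Ψ (d a)) =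
    (d.rTensor W + TensorProduct.map (gradeInv 𝒜) E.d)
      ((GradedTensorProduct.of ℂ 𝒜 ℬ).symm (Ψ a))
  Ψ_st : ∀ a, (GradedTensorProduct.of ℂ 𝒜 ℬ).symm (Ψ (st a)) =
    TensorProduct.map st E.st ((GradedTensorProduct.of ℂ 𝒜 ℬ).symm (Ψ a))

namespace QuantumPrincipalBundle

variable {E : Envelope R ℬ} {𝒜 : ℕ → Submodule ℂ A} [GradedAlgebra 𝒜]
  (P : QuantumPrincipalBundle E 𝒜)

/-- `Ψ` as a linear map into the tensor product. -/
def psi : A →ₗ[ℂ] A ⊗[ℂ] W :=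
  (GradedTensorProduct.of ℂ 𝒜 ℬ).symm.toLinearMap ∘ₗ P.Ψ.toLinearMap

/-- Forms on the base: the forms with `Ψ(μ) = μ ⊗ 1`. -/
def baseForms : Subalgebra ℂ A :=
  AlgHom.equalizer P.Ψ (GradedTensorProduct.includeLeft 𝒜 ℬ)

theorem mem_baseForms {a : A} : a ∈ P.baseForms ↔ P.psi a = a ⊗ₜ[ℂ] 1 := by
  change P.Ψ a = GradedTensorProduct.of ℂ 𝒜 ℬ (a ⊗ₜ[ℂ] 1) ↔ _
  rw [← LinearEquiv.symm_apply_eq]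
  rfl

theorem st_mem_baseForms {a : A} (ha : a ∈ P.baseForms) : P.st a ∈ P.baseForms := by
  rw [mem_baseForms] at ha ⊢
  have h := P.Ψ_st a
  change P.psi (P.st a) = TensorProduct.map P.st E.st (P.psi a) at h
  rw [h, ha, TensorProduct.map_tmul, E.toStarDGA.st_one]

/-- The involution on the forms on the base. -/
def stBase : P.baseForms →ₛₗ[starRingEnd ℂ] P.baseForms where
  toFun μ := ⟨P.st μ, P.st_mem_baseForms μ.2⟩
  map_add' _ _ := by ext; simp
  map_smul' _ _ := by ext; simp

/-- Right multiplication of `A ⊗ W` by elements whose second leg lies in degree zero carries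
no sign. -/
theorem gmul_incl (x y : A) (g : G) (w : W) :
    GradedTensorProduct.of ℂ 𝒜 ℬ (x ⊗ₜ[ℂ] E.incl g) * GradedTensorProduct.of ℂ 𝒜 ℬ (y ⊗ₜ[ℂ] w) =
      GradedTensorProduct.of ℂ 𝒜 ℬ ((x * y) ⊗ₜ[ℂ] (E.incl g * w)) := by
  induction y using DirectSum.Decomposition.inductionOn 𝒜 with
  | zero => simp
  | homogeneous y =>
    exact GradedTensorProduct.tmul_zero_coe_mul_coe_tmul 𝒜 ℬ x ⟨E.incl g, E.incl_mem g⟩ y w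
  | add y z hy hz => simp only [TensorProduct.add_tmul, map_add, mul_add, hy, hz]

theorem psi_mul (a b : A) : P.psi (a * b) = (GradedTensorProduct.of ℂ 𝒜 ℬ).symm
    (GradedTensorProduct.of ℂ 𝒜 ℬ (P.psi a) * GradedTensorProduct.of ℂ 𝒜 ℬ (P.psi b)) := by
  change (GradedTensorProduct.of ℂ 𝒜 ℬ).symm (P.Ψ (a * b)) = _
  rw [map_mul]
  rfl

section Sections

variable {V : Type*} [AddCommGroup V] [Module ℂ V] (α : V →ₗ[ℂ] V ⊗[ℂ] G)

/-- The morphisms from `α` to the corepresentation on horizontal forms. (A linear map `τ` with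
`Ψ ∘ τ = (τ ⊗ id) ∘ α` automatically takes horizontal values.) -/
def horMor : Submodule ℂ (V →ₗ[ℂ] A) where
  carrier := {τ | ∀ v, P.psi (τ v) = TensorProduct.map τ E.incl.toLinearMap (α v)}
  zero_mem' v := by simp
  add_mem' {σ τ} hσ hτ v := by
    simp only [LinearMap.add_apply, map_add, TensorProduct.map_add_left, hσ v, hτ v]
  smul_mem' c τ hτ v := by
    simp only [LinearMap.smul_apply, map_smul, TensorProduct.map_smul_left, hτ v]

/-- The sections of the associated bundle: the morphisms from `α` to the coaction on the
total space. -/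
def sections : Submodule ℂ (V →ₗ[ℂ] A) where
  carrier := {T | T ∈ P.horMor α ∧ ∀ v, T v ∈ 𝒜 0}
  zero_mem' := ⟨Submodule.zero_mem _, fun _ => Submodule.zero_mem _⟩
  add_mem' hS hT := ⟨Submodule.add_mem _ hS.1 hT.1, fun v => Submodule.add_mem _ (hS.2 v) (hT.2 v)⟩
  smul_mem' c _ hT := ⟨Submodule.smul_mem _ c hT.1, fun v => Submodule.smul_mem _ c (hT.2 v)⟩

variable {α}

theorem mul_mem_horMor {μ : A} (hμ : μ ∈ P.baseForms) {τ : V →ₗ[ℂ] A} (hτ : τ ∈ P.horMor α) :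
    LinearMap.mulLeft ℂ μ ∘ₗ τ ∈ P.horMor α := by
  intro v
  rw [mem_baseForms] at hμ
  simp only [LinearMap.comp_apply, LinearMap.mulLeft_apply]
  rw [psi_mul, hτ v, hμ]
  generalize α v = t
  induction t with
  | zero => simp
  | add x y hx hy => simp only [map_add, mul_add, hx, hy]
  | tmul x g =>
    have h := gmul_incl (E := E) (𝒜 := 𝒜) μ (τ x) 1 (E.incl g)
    simp only [map_one, one_mul] at h
    simp only [TensorProduct.map_tmul, AlgHom.toLinearMap_apply, LinearMap.comp_apply,
      LinearMap.mulLeft_apply, h, LinearEquiv.symm_apply_apply]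

theorem mem_horMor_mul {μ : A} (hμ : μ ∈ P.baseForms) {τ : V →ₗ[ℂ] A} (hτ : τ ∈ P.horMor α) :
    LinearMap.mulRight ℂ μ ∘ₗ τ ∈ P.horMor α := by
  intro v
  rw [mem_baseForms] at hμ
  simp only [LinearMap.comp_apply, LinearMap.mulRight_apply]
  rw [psi_mul, hτ v, hμ]
  generalize α v = t
  induction t with
  | zero => simp
  | add x y hx hy => simp only [map_add, add_mul, hx, hy]
  | tmul x g =>
    have h := gmul_incl (E := E) (𝒜 := 𝒜) (τ x) μ g 1
    simp only [mul_one] at h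
    simp only [TensorProduct.map_tmul, AlgHom.toLinearMap_apply, LinearMap.comp_apply,
      LinearMap.mulRight_apply, h, LinearEquiv.symm_apply_apply]

theorem psi_st (a : A) : P.psi (P.st a) = TensorProduct.map P.st E.st (P.psi a) := P.Ψ_st a

theorem mem_zero_mul {a b : A} (ha : a ∈ 𝒜 0) (hb : b ∈ 𝒜 0) : a * b ∈ 𝒜 0 := by
  simpa using SetLike.GradedMul.mul_mem ha hb

section Hermitian

variable {κ : Type*} [Fintype κ] [DecidableEq κ]

theorem hermitianL_mem (b : UnitaryBasis α κ) {S T : V →ₗ[ℂ] A} (hS : S ∈ P.sections α)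
    (hT : T ∈ P.sections α) : ∑ k, S (b.e k) * P.st (T (b.e k)) ∈ P.baseForms := by
  have key : ∀ k, P.psi (S (b.e k) * P.st (T (b.e k))) = ∑ i, ∑ j,
      (S (b.e i) * P.st (T (b.e j))) ⊗ₜ[ℂ] E.incl (b.mat i k * star (b.mat j k)) := by
    intro k
    rw [psi_mul, psi_st, hS.1 (b.e k), hT.1 (b.e k), b.coact]
    simp only [map_sum, TensorProduct.map_tmul, AlgHom.toLinearMap_apply, E.st_incl,
      Finset.sum_mul_sum, gmul_incl, ← map_mul, LinearEquiv.symm_apply_apply]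
  rw [mem_baseForms, map_sum]
  simp only [key]
  rw [Finset.sum_comm]
  simp only [TensorProduct.sum_tmul]
  refine Finset.sum_congr rfl fun i _ => ?_
  rw [Finset.sum_comm]
  have h1 : ∀ j, ∑ k, (S (b.e i) * P.st (T (b.e j))) ⊗ₜ[ℂ] E.incl (b.mat i k * star (b.mat j k)) =
      (S (b.e i) * P.st (T (b.e j))) ⊗ₜ[ℂ] E.incl ((1 : Matrix κ κ G) i j) := by
    intro j
    rw [← TensorProduct.tmul_sum, ← map_sum, ← Unitary.mul_star_self_of_mem b.unitary]
    simp [Matrix.mul_apply, Matrix.star_apply]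
  simp only [h1, Matrix.one_apply]
  rw [Finset.sum_eq_single i]
  · simp
  · intro j _ hj
    simp [hj.symm]
  · simp

theorem hermitianR_mem (b : ConjUnitaryBasis α κ) {S T : V →ₗ[ℂ] A} (hS : S ∈ P.sections α)
    (hT : T ∈ P.sections α) : ∑ k, P.st (S (b.e k)) * T (b.e k) ∈ P.baseForms := by
  have key : ∀ k, P.psi (P.st (S (b.e k)) * T (b.e k)) = ∑ i, ∑ j,
      (P.st (S (b.e i)) * T (b.e j)) ⊗ₜ[ℂ] E.incl (star (b.mat i k) * b.mat j k) := by
    intro k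
    rw [psi_mul, psi_st, hS.1 (b.e k), hT.1 (b.e k), b.coact]
    simp only [map_sum, TensorProduct.map_tmul, AlgHom.toLinearMap_apply, E.st_incl,
      Finset.sum_mul_sum, gmul_incl, ← map_mul, LinearEquiv.symm_apply_apply]
  rw [mem_baseForms, map_sum]
  simp only [key]
  rw [Finset.sum_comm]
  simp only [TensorProduct.sum_tmul]
  refine Finset.sum_congr rfl fun i _ => ?_
  rw [Finset.sum_comm]
  have h1 : ∀ j, ∑ k, (P.st (S (b.e i)) * T (b.e j)) ⊗ₜ[ℂ] E.incl (star (b.mat i k) * b.mat j k) =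
      (P.st (S (b.e i)) * T (b.e j)) ⊗ₜ[ℂ] E.incl ((1 : Matrix κ κ G) i j) := by
    intro j
    rw [← TensorProduct.tmul_sum, ← map_sum, ← Unitary.mul_star_self_of_mem b.unitary]
    simp [Matrix.mul_apply, Matrix.star_apply]
  simp only [h1, Matrix.one_apply]
  rw [Finset.sum_eq_single i]
  · simp
  · intro j _ hj
    simp [hj.symm]
  · simp

/-- The canonical hermitian structure of the left bundle, `⟨S, T⟩ = ∑ S(e_k) T(e_k)*`. -/
def hermitianL (b : UnitaryBasis α κ) :
    P.sections α →ₗ[ℂ] P.sections α →ₛₗ[starRingEnd ℂ] P.baseForms :=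
  LinearMap.mk₂'ₛₗ (RingHom.id ℂ) (starRingEnd ℂ)
    (fun S T => ⟨∑ k, S.1 (b.e k) * P.st (T.1 (b.e k)), P.hermitianL_mem b S.2 T.2⟩)
    (fun S S' T => by ext; simp [add_mul, Finset.sum_add_distrib])
    (fun c S T => by ext; simp [Finset.smul_sum])
    (fun S T T' => by ext; simp [mul_add, Finset.sum_add_distrib])
    (fun c S T => by ext; simp [Finset.smul_sum])

/-- The canonical hermitian structure of the right bundle, `⟨S, T⟩ = ∑ S(e_k)* T(e_k)`. -/
def hermitianR (b : ConjUnitaryBasis α κ) :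
    P.sections α →ₛₗ[starRingEnd ℂ] P.sections α →ₗ[ℂ] P.baseForms :=
  LinearMap.mk₂'ₛₗ (starRingEnd ℂ) (RingHom.id ℂ)
    (fun S T => ⟨∑ k, P.st (S.1 (b.e k)) * T.1 (b.e k), P.hermitianR_mem b S.2 T.2⟩)
    (fun S S' T => by ext; simp [add_mul, Finset.sum_add_distrib])
    (fun c S T => by ext; simp [Finset.smul_sum])
    (fun S T T' => by ext; simp [mul_add, Finset.sum_add_distrib])
    (fun c S T => by ext; simp [Finset.smul_sum])

/-- Existence of finitely many sections `T_k` with `∑ T_k(eᵢ)* T_k(eⱼ) = δᵢⱼ`, where the `eᵢ` form an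
orthonormal basis. -/
def HasFrame (b : UnitaryBasis α κ) : Prop :=
  ∃ (m : ℕ) (T : Fin m → P.sections α), ∀ i j,
    ∑ k, P.st ((T k).1 (b.e i)) * (T k).1 (b.e j) = if i = j then 1 else 0

end Hermitian

end Sections

end QuantumPrincipalBundle

end Bundle

/-! ### Riemannian geometry of the base -/

section Geometry

variable {R : BicovariantCalculus G} {W : Type u} [Ring W] [Algebra ℂ W]
  {ℬ : ℕ → Submodule ℂ W} [GradedAlgebra ℬ] {E : Envelope R ℬ}
  {A : Type*} [Ring A] [Algebra ℂ A] {𝒜 : ℕ → Submodule ℂ A} [GradedAlgebra 𝒜]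
  {B : Type*} [CStarAlgebra B] [PartialOrder B] [StarOrderedRing B]

/-- The base of a quantum principal bundle is identified with a star-subalgebra `M` of a
C*-algebra, and carries: a volume form of top degree `n`, a left quantum Riemannian metric on the
forms on the base (forms of different degrees being orthogonal) for which the volume form is
a Riemannian volume form, a state whose quantum integral `p dvol ↦ s(p)` is closed (no boundary) and
gives inner products, and a left quantum Hodge star operator. -/
structure BaseGeometry (P : QuantumPrincipalBundle E 𝒜) (M : StarSubalgebra ℂ B) where
  inc : M →ₐ[ℂ] P.baseForms
  inc_injective : Function.Injective inc
  mem_zero_iff : ∀ x : P.baseForms, (x : A) ∈ 𝒜 0 ↔ ∃ p, inc p = x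
  st_inc : ∀ p, P.stBase (inc p) = inc (star p)
  n : ℕ
  dvol : P.baseForms
  dvol_mem : (dvol : A) ∈ 𝒜 n
  dvol_ne_zero : dvol ≠ 0
  top_form : ∀ x : P.baseForms, (x : A) ∈ 𝒜 n → ∃ p, x = inc p * dvol
  mul_dvol_eq_zero : ∀ p, inc p * dvol = 0 ↔ p = 0
  eq_zero_of_lt : ∀ (k : ℕ) (x : P.baseForms), n < k → (x : A) ∈ 𝒜 k → x = 0
  metric : P.baseForms →ₗ[ℂ] P.baseForms →ₛₗ[starRingEnd ℂ] M
  metric_mul_left : ∀ p μ ν, metric (inc p * μ) ν = p * metric μ ν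
  metric_symm : ∀ μ ν, star (metric μ ν) = metric ν μ
  metric_nonneg : ∀ μ, 0 ≤ (metric μ μ : B)
  metric_self_eq_zero : ∀ μ, metric μ μ = 0 → μ = 0
  metric_mul_right : ∀ μ p ν, metric (μ * inc p) ν = metric μ (ν * inc (star p))
  metric_orthogonal : ∀ (k l : ℕ) (μ ν : P.baseForms), k ≠ l → (μ : A) ∈ 𝒜 k → (ν : A) ∈ 𝒜 l →
    metric μ ν = 0
  metric_zero : ∀ p q, metric (inc p) (inc q) = p * star q
  metric_dvol : ∀ p q, metric (inc p * dvol) (inc q * dvol) = p * star q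
  state : M →ₗ[ℂ] ℂ
  state_one : state 1 = 1
  state_nonneg : ∀ p, 0 ≤ state (p * star p)
  inner_pos : ∀ μ, μ ≠ 0 → 0 < state (metric μ μ)
  stokes : ∀ (μ : P.baseForms) (p : M), P.d μ = (inc p * dvol : P.baseForms) → state p = 0
  hodge : P.baseForms ≃ₛₗ[starRingEnd ℂ] P.baseForms
  hodge_mem : ∀ (k : ℕ) (μ : P.baseForms), k ≤ n → (μ : A) ∈ 𝒜 k → (hodge μ : A) ∈ 𝒜 (n - k)
  hodge_spec : ∀ μ ν, GradedAlgebra.proj 𝒜 n (μ * hodge ν : P.baseForms) =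
    (inc (metric μ ν) * dvol : P.baseForms)

namespace BaseGeometry

variable {P : QuantumPrincipalBundle E 𝒜} {M : StarSubalgebra ℂ B} (Γ : BaseGeometry P M)

theorem inc_mem (p : M) : (Γ.inc p : A) ∈ 𝒜 0 := (Γ.mem_zero_iff _).2 ⟨p, rfl⟩

theorem st_mul_inc (μ : P.baseForms) (p : M) :
    P.stBase (μ * Γ.inc p) = Γ.inc (star p) * P.stBase μ := by
  rw [← Γ.st_inc]
  exact Subtype.ext (P.st_mul_zero_right (μ : A) (Γ.inc_mem p))

theorem st_inc_mul (μ : P.baseForms) (p : M) :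
    P.stBase (Γ.inc p * μ) = P.stBase μ * Γ.inc (star p) := by
  rw [← Γ.st_inc]
  exact Subtype.ext (P.st_mul_zero_left (μ : A) (Γ.inc_mem p))

theorem hodge_mul_inc (μ : P.baseForms) (p : M) :
    Γ.hodge (μ * Γ.inc p) = Γ.inc (star p) * Γ.hodge μ := by
  obtain ⟨ξ, hξ⟩ := Γ.hodge.surjective (Γ.hodge (μ * Γ.inc p) - Γ.inc (star p) * Γ.hodge μ)
  have h := Γ.hodge_spec ξ ξ
  have h1 : (Γ.inc (Γ.metric ξ (μ * Γ.inc p)) * Γ.dvol : P.baseForms) =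
      Γ.inc (Γ.metric (ξ * Γ.inc (star p)) μ) * Γ.dvol := by
    rw [Γ.metric_mul_right, star_star]
  have h2 := Γ.hodge_spec ξ (μ * Γ.inc p)
  have h3 := Γ.hodge_spec (ξ * Γ.inc (star p)) μ
  rw [h1, ← h3] at h2
  rw [hξ, mul_sub, Subalgebra.coe_sub, map_sub, h2, mul_assoc, sub_self] at h
  have h4 : Γ.inc (Γ.metric ξ ξ) * Γ.dvol = 0 := Subtype.ext h.symm
  have h5 : ξ = 0 := Γ.metric_self_eq_zero _ ((Γ.mul_dvol_eq_zero _).1 h4)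
  rw [h5, map_zero] at hξ
  exact sub_eq_zero.1 hξ.symm

theorem hodge_symm_inc_mul (μ : P.baseForms) (p : M) :
    Γ.hodge.symm (Γ.inc p * μ) = Γ.hodge.symm μ * Γ.inc (star p) := by
  apply Γ.hodge.injective
  rw [hodge_mul_inc, star_star, LinearEquiv.apply_symm_apply, LinearEquiv.apply_symm_apply]

/-- The right quantum Riemannian metric `⟨μ, ν⟩_R = ⟨μ*, ν*⟩_L`. -/
def metricR : P.baseForms →ₛₗ[starRingEnd ℂ] P.baseForms →ₗ[ℂ] M :=
  LinearMap.mk₂'ₛₗ (starRingEnd ℂ) (RingHom.id ℂ)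
    (fun μ ν => Γ.metric (P.stBase μ) (P.stBase ν))
    (fun μ μ' ν => by simp) (fun c μ ν => by simp) (fun μ ν ν' => by simp) (fun c μ ν => by simp)

/-- The element of `M` given by a form of degree zero on the base. -/
def toBase (x : P.baseForms) : M := Function.invFun Γ.inc x

section Forms

variable {V : Type*} [AddCommGroup V] [Module ℂ V] {α : V →ₗ[ℂ] V ⊗[ℂ] G}

/-- Left multiplication of sections by elements of the base. -/
def smulL (p : M) (T : P.sections α) : P.sections α :=
  ⟨LinearMap.mulLeft ℂ (Γ.inc p : A) ∘ₗ T.1, P.mul_mem_horMor (Γ.inc p).2 T.2.1,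
    fun v => QuantumPrincipalBundle.mem_zero_mul (Γ.inc_mem p) (T.2.2 v)⟩

/-- Right multiplication of sections by elements of the base. -/
def smulR (T : P.sections α) (p : M) : P.sections α :=
  ⟨LinearMap.mulRight ℂ (Γ.inc p : A) ∘ₗ T.1, P.mem_horMor_mul (Γ.inc p).2 T.2.1,
    fun v => QuantumPrincipalBundle.mem_zero_mul (T.2.2 v) (Γ.inc_mem p)⟩

variable (α)

/-- The relations `μ p ⊗ T = μ ⊗ p T`. -/
def relL : Submodule ℂ (P.baseForms ⊗[ℂ] P.sections α) :=
  Submodule.span ℂ {x | ∃ (μ : P.baseForms) (p : M) (T : P.sections α),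
    (μ * Γ.inc p) ⊗ₜ[ℂ] T - μ ⊗ₜ[ℂ] Γ.smulL p T = x}

/-- A shortcut instance. -/
instance addCommGroupTensor : AddCommGroup (P.sections α ⊗[ℂ] P.baseForms) :=
  TensorProduct.addCommGroup (M := P.sections α) (N := P.baseForms)

/-- The relations `T p ⊗ μ = T ⊗ p μ`. -/
def relR : Submodule ℂ (P.sections α ⊗[ℂ] P.baseForms) :=
  Submodule.span ℂ {x | ∃ (T : P.sections α) (p : M) (μ : P.baseForms),
    Γ.smulR T p ⊗ₜ[ℂ] μ - T ⊗ₜ[ℂ] (Γ.inc p * μ) = x}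

/-- Left bundle-valued forms, the tensor product over `M` of the forms on the base and
the sections. -/
abbrev FormsL : Type _ := (P.baseForms ⊗[ℂ] P.sections α) ⧸ Γ.relL α

/-- Right bundle-valued forms, the tensor product over `M` of the sections and the forms
on the base. -/
abbrev FormsR : Type _ := (P.sections α ⊗[ℂ] P.baseForms) ⧸ Γ.relR α

variable {α}

/-- `T ↦ 1 ⊗ T`, the identification of sections with forms of degree zero. -/
def ofSectionL (T : P.sections α) : Γ.FormsL α := (Γ.relL α).mkQ (1 ⊗ₜ[ℂ] T)

/-- `T ↦ T ⊗ 1`, the identification of sections with forms of degree zero. -/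
def ofSectionR (T : P.sections α) : Γ.FormsR α := (Γ.relR α).mkQ (T ⊗ₜ[ℂ] 1)

/-- The map `μ ⊗ T ↦ μ T` (its codomain consists of all linear maps). -/
def mulFormL : Γ.FormsL α →ₗ[ℂ] V →ₗ[ℂ] A :=
  (Γ.relL α).liftQ (TensorProduct.lift (LinearMap.mk₂ ℂ
    (fun (μ : P.baseForms) (T : P.sections α) => LinearMap.mulLeft ℂ (μ : A) ∘ₗ T.1)
    (fun μ μ' T => by ext; simp [add_mul]) (fun c μ T => by ext; simp)
    (fun μ T T' => by ext; simp [mul_add]) (fun c μ T => by ext; simp))) <| by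
    refine Submodule.span_le.2 ?_
    rintro _ ⟨μ, p, T, rfl⟩
    rw [SetLike.mem_coe, LinearMap.mem_ker, map_sub, sub_eq_zero]
    ext v
    simp [smulL]

/-- The map `T ⊗ μ ↦ T μ` (its codomain consists of all linear maps). -/
def mulFormR : Γ.FormsR α →ₗ[ℂ] V →ₗ[ℂ] A :=
  (Γ.relR α).liftQ (TensorProduct.lift (LinearMap.mk₂ ℂ
    (fun (T : P.sections α) (μ : P.baseForms) => LinearMap.mulRight ℂ (μ : A) ∘ₗ T.1)
    (fun T T' μ => by ext; simp [add_mul]) (fun c T μ => by ext; simp)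
    (fun T μ μ' => by ext; simp [mul_add]) (fun c T μ => by ext; simp))) <| by
    refine Submodule.span_le.2 ?_
    rintro _ ⟨T, p, μ, rfl⟩
    rw [SetLike.mem_coe, LinearMap.mem_ker, map_sub, sub_eq_zero]
    ext v
    simp [smulR, mul_assoc]

/-- The inverse `Υ` of the bijection `μ ⊗ T ↦ μ T` from left bundle-valued forms to the morphisms
from `α` to the horizontal forms. -/
def upsilonL (τ : V →ₗ[ℂ] A) : Γ.FormsL α := Function.invFun Γ.mulFormL τ

/-- The inverse of the bijection `T ⊗ μ ↦ T μ` from right bundle-valued forms to the morphisms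
from `α` to the horizontal forms. -/
def upsilonR (τ : V →ₗ[ℂ] A) : Γ.FormsR α := Function.invFun Γ.mulFormR τ

/-- `ρ ⊗ id` for a right `M`-linear map `ρ`. -/
def mapL (ρ : P.baseForms →ₗ[ℂ] P.baseForms) (hρ : ∀ μ p, ρ (μ * Γ.inc p) = ρ μ * Γ.inc p) :
    Γ.FormsL α →ₗ[ℂ] Γ.FormsL α :=
  (Γ.relL α).mapQ (Γ.relL α) (ρ.rTensor (P.sections α)) <| by
    refine Submodule.span_le.2 ?_
    rintro _ ⟨μ, p, T, rfl⟩
    refine Submodule.subset_span ⟨ρ μ, p, T, ?_⟩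
    simp [hρ]

/-- `id ⊗ ρ` for a left `M`-linear map `ρ`. -/
def mapR (ρ : P.baseForms →ₗ[ℂ] P.baseForms) (hρ : ∀ μ p, ρ (Γ.inc p * μ) = Γ.inc p * ρ μ) :
    Γ.FormsR α →ₗ[ℂ] Γ.FormsR α :=
  (Γ.relR α).mapQ (Γ.relR α) (ρ.lTensor (P.sections α)) <| by
    refine Submodule.span_le.2 ?_
    rintro _ ⟨T, p, μ, rfl⟩
    refine Submodule.subset_span ⟨T, p, ρ μ, ?_⟩
    simp [hρ]

/-- `(∗ ∘ ⋆_L) ⊗ id`. -/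
def starHodgeL : Γ.FormsL α →ₗ[ℂ] Γ.FormsL α :=
  Γ.mapL (P.stBase.comp Γ.hodge.toLinearMap) fun μ p => by
    simp [hodge_mul_inc, st_inc_mul]

/-- `(⋆_L⁻¹ ∘ ∗) ⊗ id`. -/
def hodgeInvStarL : Γ.FormsL α →ₗ[ℂ] Γ.FormsL α :=
  Γ.mapL (Γ.hodge.symm.toLinearMap.comp P.stBase) fun μ p => by
    simp [st_mul_inc, hodge_symm_inc_mul]

/-- `id ⊗ (∗ ∘ ⋆_R)`, where `⋆_R = ∗ ∘ ⋆_L ∘ ∗`, so that `∗ ∘ ⋆_R = ⋆_L ∘ ∗`. -/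
def starHodgeR : Γ.FormsR α →ₗ[ℂ] Γ.FormsR α :=
  Γ.mapR (Γ.hodge.toLinearMap.comp P.stBase) fun μ p => by
    simp [st_inc_mul, hodge_mul_inc]

/-- `id ⊗ (⋆_R⁻¹ ∘ ∗)`, where `⋆_R = ∗ ∘ ⋆_L ∘ ∗`, so that `⋆_R⁻¹ ∘ ∗ = ∗ ∘ ⋆_L⁻¹`. -/
def hodgeInvStarR : Γ.FormsR α →ₗ[ℂ] Γ.FormsR α :=
  Γ.mapR (P.stBase.comp Γ.hodge.symm.toLinearMap) fun μ p => by
    simp [hodge_symm_inc_mul, st_mul_inc]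

section Hermitian

variable {κ : Type*} [Fintype κ] [DecidableEq κ]

theorem hermitianL_smul_left (b : UnitaryBasis α κ) (p : M) (S T : P.sections α) :
    P.hermitianL b (Γ.smulL p S) T = Γ.inc p * P.hermitianL b S T := by
  ext
  simp [QuantumPrincipalBundle.hermitianL, smulL, Finset.mul_sum, mul_assoc]

theorem hermitianL_smul_right (b : UnitaryBasis α κ) (p : M) (S T : P.sections α) :
    P.hermitianL b S (Γ.smulL p T) = P.hermitianL b S T * Γ.inc (star p) := by
  ext
  have h : (Γ.inc (star p) : A) = P.st (Γ.inc p) := by rw [← Γ.st_inc]; rfl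
  simp [QuantumPrincipalBundle.hermitianL, smulL, Finset.sum_mul, h,
    P.st_mul_zero_left _ (Γ.inc_mem p), mul_assoc]

theorem hermitianR_smul_left (b : ConjUnitaryBasis α κ) (p : M) (S T : P.sections α) :
    P.hermitianR b (Γ.smulR S p) T = Γ.inc (star p) * P.hermitianR b S T := by
  ext
  have h : (Γ.inc (star p) : A) = P.st (Γ.inc p) := by rw [← Γ.st_inc]; rfl
  simp [QuantumPrincipalBundle.hermitianR, smulR, Finset.mul_sum, h,
    P.st_mul_zero_right _ (Γ.inc_mem p), mul_assoc]

theorem hermitianR_smul_right (b : ConjUnitaryBasis α κ) (p : M) (S T : P.sections α) :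
    P.hermitianR b S (Γ.smulR T p) = P.hermitianR b S T * Γ.inc p := by
  ext
  simp [QuantumPrincipalBundle.hermitianR, smulR, Finset.sum_mul, mul_assoc]

/-- `⟨μ₁ ⊗ T₁, μ₂ ⊗ T₂⟩ = ⟨μ₁ ⟨T₁, T₂⟩, μ₂⟩` on the tensor product over `ℂ`. -/
def preHermitianFormL (b : UnitaryBasis α κ) : P.baseForms ⊗[ℂ] P.sections α →ₗ[ℂ]
    P.baseForms ⊗[ℂ] P.sections α →ₛₗ[starRingEnd ℂ] M :=
  TensorProduct.lift (LinearMap.mk₂ ℂ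
    (fun μ₁ T₁ => TensorProduct.lift (LinearMap.mk₂'ₛₗ (starRingEnd ℂ) (starRingEnd ℂ)
      (fun μ₂ T₂ => Γ.metric (μ₁ * P.hermitianL b T₁ T₂) μ₂)
      (fun μ₂ μ₂' T₂ => by simp) (fun c μ₂ T₂ => by simp)
      (fun μ₂ T₂ T₂' => by simp [mul_add]) (fun c μ₂ T₂ => by simp)))
    (fun μ₁ μ₁' T₁ => TensorProduct.ext' fun x y => by simp [add_mul])
    (fun c μ₁ T₁ => TensorProduct.ext' fun x y => by simp)
    (fun μ₁ T₁ T₁' => TensorProduct.ext' fun x y => by simp [mul_add])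
    (fun c μ₁ T₁ => TensorProduct.ext' fun x y => by simp))

theorem preHermitianFormL_tmul (b : UnitaryBasis α κ) (μ₁ μ₂ : P.baseForms)
    (T₁ T₂ : P.sections α) : Γ.preHermitianFormL b (μ₁ ⊗ₜ[ℂ] T₁) (μ₂ ⊗ₜ[ℂ] T₂) =
      Γ.metric (μ₁ * P.hermitianL b T₁ T₂) μ₂ := by
  simp [preHermitianFormL]

/-- `⟨T₁ ⊗ μ₁, T₂ ⊗ μ₂⟩ = ⟨μ₁, ⟨T₁, T₂⟩ μ₂⟩` on the tensor product over `ℂ`. -/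
def preHermitianFormR (b : ConjUnitaryBasis α κ) : P.sections α ⊗[ℂ] P.baseForms →ₛₗ[starRingEnd ℂ]
    P.sections α ⊗[ℂ] P.baseForms →ₗ[ℂ] M :=
  TensorProduct.lift (LinearMap.mk₂'ₛₗ (starRingEnd ℂ) (starRingEnd ℂ)
    (fun T₁ μ₁ => TensorProduct.lift (LinearMap.mk₂ ℂ
      (fun T₂ μ₂ => Γ.metricR μ₁ (P.hermitianR b T₁ T₂ * μ₂))
      (fun T₂ T₂' μ₂ => by simp [add_mul]) (fun c T₂ μ₂ => by simp)
      (fun T₂ μ₂ μ₂' => by simp [mul_add]) (fun c T₂ μ₂ => by simp)))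
    (fun T₁ T₁' μ₁ => TensorProduct.ext' fun x y => by simp [add_mul])
    (fun c T₁ μ₁ => TensorProduct.ext' fun x y => by simp)
    (fun T₁ μ₁ μ₁' => TensorProduct.ext' fun x y => by simp)
    (fun c T₁ μ₁ => TensorProduct.ext' fun x y => by simp))

theorem preHermitianFormR_tmul (b : ConjUnitaryBasis α κ) (μ₁ μ₂ : P.baseForms)
    (T₁ T₂ : P.sections α) : Γ.preHermitianFormR b (T₁ ⊗ₜ[ℂ] μ₁) (T₂ ⊗ₜ[ℂ] μ₂) =
      Γ.metricR μ₁ (P.hermitianR b T₁ T₂ * μ₂) := by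
  simp [preHermitianFormR]

theorem metricR_inc_mul (μ ν : P.baseForms) (p : M) :
    Γ.metricR μ (Γ.inc (star p) * ν) = Γ.metricR (Γ.inc p * μ) ν := by
  simp [metricR, st_inc_mul, metric_mul_right]

theorem relL_le_ker (b : UnitaryBasis α κ) (x : P.baseForms ⊗[ℂ] P.sections α) :
    Γ.relL α ≤ LinearMap.ker (Γ.preHermitianFormL b x) := by
  refine Submodule.span_le.2 ?_
  rintro _ ⟨μ, p, T, rfl⟩
  rw [SetLike.mem_coe, LinearMap.mem_ker, map_sub, sub_eq_zero]
  induction x with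
  | zero => simp
  | add x y hx hy => simp only [map_add, LinearMap.add_apply, hx, hy]
  | tmul ν S =>
    rw [preHermitianFormL_tmul, preHermitianFormL_tmul, hermitianL_smul_right, ← mul_assoc,
      metric_mul_right, star_star]

theorem relR_le_ker (b : ConjUnitaryBasis α κ) (x : P.sections α ⊗[ℂ] P.baseForms) :
    Γ.relR α ≤ LinearMap.ker (Γ.preHermitianFormR b x) := by
  refine Submodule.span_le.2 ?_
  rintro _ ⟨T, p, μ, rfl⟩
  rw [SetLike.mem_coe, LinearMap.mem_ker, map_sub, sub_eq_zero]
  induction x with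
  | zero => simp
  | add x y hx hy => simp only [map_add, LinearMap.add_apply, hx, hy]
  | tmul S ν =>
    rw [preHermitianFormR_tmul, preHermitianFormR_tmul, hermitianR_smul_right, mul_assoc]

/-- The hermitian structure on left bundle-valued forms,
`⟨μ₁ ⊗ T₁, μ₂ ⊗ T₂⟩ = ⟨μ₁ ⟨T₁, T₂⟩, μ₂⟩`. -/
def hermitianFormL (b : UnitaryBasis α κ) :
    Γ.FormsL α →ₗ[ℂ] Γ.FormsL α →ₛₗ[starRingEnd ℂ] M :=
  (Γ.relL α).liftQ
    { toFun := fun x => (Γ.relL α).liftQ (Γ.preHermitianFormL b x) (Γ.relL_le_ker b x)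
      map_add' := fun x y => by ext; simp
      map_smul' := fun c x => by ext; simp } <| by
    refine Submodule.span_le.2 ?_
    rintro _ ⟨μ, p, T, rfl⟩
    rw [SetLike.mem_coe, LinearMap.mem_ker]
    refine Submodule.linearMap_qext _ (TensorProduct.ext' fun ν S => ?_)
    change Γ.preHermitianFormL b ((μ * Γ.inc p) ⊗ₜ[ℂ] T - μ ⊗ₜ[ℂ] Γ.smulL p T) (ν ⊗ₜ[ℂ] S) = 0
    rw [map_sub, LinearMap.sub_apply, preHermitianFormL_tmul, preHermitianFormL_tmul,
      hermitianL_smul_left, mul_assoc, sub_self]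

/-- The hermitian structure on right bundle-valued forms,
`⟨T₁ ⊗ μ₁, T₂ ⊗ μ₂⟩ = ⟨μ₁, ⟨T₁, T₂⟩ μ₂⟩`. -/
def hermitianFormR (b : ConjUnitaryBasis α κ) :
    Γ.FormsR α →ₛₗ[starRingEnd ℂ] Γ.FormsR α →ₗ[ℂ] M :=
  (Γ.relR α).liftQ
    { toFun := fun x => (Γ.relR α).liftQ (Γ.preHermitianFormR b x) (Γ.relR_le_ker b x)
      map_add' := fun x y => by ext; simp
      map_smul' := fun c x => by ext; simp } <| by
    refine Submodule.span_le.2 ?_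
    rintro _ ⟨T, p, μ, rfl⟩
    rw [SetLike.mem_coe, LinearMap.mem_ker]
    refine Submodule.linearMap_qext _ (TensorProduct.ext' fun S ν => ?_)
    change Γ.preHermitianFormR b (Γ.smulR T p ⊗ₜ[ℂ] μ - T ⊗ₜ[ℂ] (Γ.inc p * μ)) (S ⊗ₜ[ℂ] ν) = 0
    rw [map_sub, LinearMap.sub_apply, preHermitianFormR_tmul, preHermitianFormR_tmul,
      hermitianR_smul_left, mul_assoc, metricR_inc_mul, sub_self]

/-- The inner product `⟨x | y⟩ = ∫ ⟨x, y⟩ dvol` of left bundle-valued forms. -/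
def innerL (b : UnitaryBasis α κ) (x y : Γ.FormsL α) : ℂ := Γ.state (Γ.hermitianFormL b x y)

/-- The inner product `⟨x | y⟩ = ∫ ⟨x, y⟩ dvol` of right bundle-valued forms. -/
def innerR (b : ConjUnitaryBasis α κ) (x y : Γ.FormsR α) : ℂ := Γ.state (Γ.hermitianFormR b x y)

/-- `B` is an adjoint operator of `A`. -/
def IsAdjointL (b : UnitaryBasis α κ) (A B : Γ.FormsL α → Γ.FormsL α) : Prop :=
  ∀ x y, Γ.innerL b (A x) y = Γ.innerL b x (B y)

/-- `B` is an adjoint operator of `A`. -/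
def IsAdjointR (b : ConjUnitaryBasis α κ) (A B : Γ.FormsR α → Γ.FormsR α) : Prop :=
  ∀ x y, Γ.innerR b (A x) y = Γ.innerR b x (B y)

/-- The adjoint operator of an adjointable operator. -/
def adjointL (b : UnitaryBasis α κ) (A : Γ.FormsL α → Γ.FormsL α) : Γ.FormsL α → Γ.FormsL α :=
  Classical.epsilon (Γ.IsAdjointL b A)

/-- The adjoint operator of an adjointable operator. -/
def adjointR (b : ConjUnitaryBasis α κ) (A : Γ.FormsR α → Γ.FormsR α) : Γ.FormsR α → Γ.FormsR α :=
  Classical.epsilon (Γ.IsAdjointR b A)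

end Hermitian

end Forms

end BaseGeometry

end Geometry

/-! ### Quantum principal connections -/

section Connections

variable {R : BicovariantCalculus G} {W : Type u} [Ring W] [Algebra ℂ W]
  {ℬ : ℕ → Submodule ℂ W} [GradedAlgebra ℬ] {E : Envelope R ℬ}
  {A : Type*} [Ring A] [Algebra ℂ A] {𝒜 : ℕ → Submodule ℂ A} [GradedAlgebra 𝒜]

namespace QuantumPrincipalBundle

variable (P : QuantumPrincipalBundle E 𝒜)

/-- Quantum principal connections: linear maps to the one-forms on the total space with
`Ψ(ω(θ)) = (ω ⊗ id) ad(θ) + 1 ⊗ θ`. -/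
def IsConnection (ω : R.Inv →ₗ[ℂ] A) : Prop :=
  ∀ θ, ω θ ∈ 𝒜 1 ∧
    P.psi (ω θ) = TensorProduct.map ω E.incl.toLinearMap (R.ad θ) + 1 ⊗ₜ[ℂ] E.invIncl θ

/-- Quantum connection displacements: morphisms from `ad` to the horizontal one-forms. -/
def IsDisplacement (lam : R.Inv →ₗ[ℂ] A) : Prop :=
  (∀ θ, lam θ ∈ 𝒜 1) ∧ lam ∈ P.horMor R.ad

/-- `f̂ = ∗ ∘ f ∘ ∗`, for linear maps on left-invariant forms. -/
def dual (f : R.Inv →ₗ[ℂ] A) : R.Inv →ₗ[ℂ] A := P.st.comp (f.comp R.starInv)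

/-- `∗ ∘ X ∘ ∗`, for operators on the forms on the total space. -/
def dualOp (X : A →ₗ[ℂ] A) : A →ₗ[ℂ] A := P.st.comp (X.comp P.st)

/-- The coaction `φ ↦ φ₀ ⊗ φ₁` on horizontal forms (defined on all forms by projection of
`Ψ` to `A ⊗ G`). -/
def horCoact : A →ₗ[ℂ] A ⊗[ℂ] G := E.toG.lTensor A ∘ₗ P.psi

/-- `K^λ(φ) = -(-1)^k φ₀ λ(π(φ₁))` for `φ` horizontal of degree `k`. -/
def covK (lam : R.Inv →ₗ[ℂ] A) : A →ₗ[ℂ] A :=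
  -(LinearMap.mul' ℂ A ∘ₗ TensorProduct.map (gradeInv 𝒜) (lam ∘ₗ R.germ) ∘ₗ P.horCoact)

/-- The covariant derivative `D^ω(φ) = dφ - (-1)^k φ₀ ω(π(φ₁))` for `φ` horizontal of
degree `k`. -/
def covD (ω : R.Inv →ₗ[ℂ] A) : A →ₗ[ℂ] A := P.d + P.covK ω

/-- `⟨σ, τ⟩ = m ∘ (σ ⊗ τ) ∘ δ`. -/
def bracket (Δ : E.EmbeddedDifferential) (σ τ : R.Inv →ₗ[ℂ] A) : R.Inv →ₗ[ℂ] A :=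
  LinearMap.mul' ℂ A ∘ₗ TensorProduct.map σ τ ∘ₗ Δ.δ

/-- `[σ, τ] = m ∘ (σ ⊗ τ) ∘ cᵀ`. -/
def commBracket (σ τ : R.Inv →ₗ[ℂ] A) : R.Inv →ₗ[ℂ] A :=
  LinearMap.mul' ℂ A ∘ₗ TensorProduct.map σ τ ∘ₗ R.transposedCommutator

/-- The curvature `R^ω = d ∘ ω - ⟨ω, ω⟩`. -/
def curvature (Δ : E.EmbeddedDifferential) (ω : R.Inv →ₗ[ℂ] A) : R.Inv →ₗ[ℂ] A :=
  P.d ∘ₗ ω - bracket Δ ω ω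

variable (𝒜) in
/-- `S^ω(τ) = ⟨ω, τ⟩ - (-1)^k ⟨τ, ω⟩ - (-1)^k [τ, ω]` if `τ` has values in degree `k`. -/
def opS (Δ : E.EmbeddedDifferential) (ω τ : R.Inv →ₗ[ℂ] A) : R.Inv →ₗ[ℂ] A :=
  bracket Δ ω τ - bracket Δ (gradeInv 𝒜 ∘ₗ τ) ω - commBracket (gradeInv 𝒜 ∘ₗ τ) ω

end QuantumPrincipalBundle

end Connections

/-! ### Covariant derivatives on bundle-valued forms -/

section Covariant

variable {R : BicovariantCalculus G} {W : Type u} [Ring W] [Algebra ℂ W]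
  {ℬ : ℕ → Submodule ℂ W} [GradedAlgebra ℬ] {E : Envelope R ℬ}
  {A : Type*} [Ring A] [Algebra ℂ A] {𝒜 : ℕ → Submodule ℂ A} [GradedAlgebra 𝒜]
  {B : Type*} [CStarAlgebra B] [PartialOrder B] [StarOrderedRing B]

namespace BaseGeometry

variable {P : QuantumPrincipalBundle E 𝒜} {M : StarSubalgebra ℂ B} (Γ : BaseGeometry P M)
  {V : Type*} [AddCommGroup V] [Module ℂ V] {α : V →ₗ[ℂ] V ⊗[ℂ] G}

/-- The induced linear connection `∇^ω T = Υ(D^ω ∘ T)`. -/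
def nablaL (ω : R.Inv →ₗ[ℂ] A) (T : P.sections α) : Γ.FormsL α := Γ.upsilonL (P.covD ω ∘ₗ T.1)

/-- The induced linear connection `∇̂^ω T = Υ̃((∗ ∘ D^ω ∘ ∗) ∘ T)`. -/
def nablaR (ω : R.Inv →ₗ[ℂ] A) (T : P.sections α) : Γ.FormsR α :=
  Γ.upsilonR (P.dualOp (P.covD ω) ∘ₗ T.1)

/-- The exterior covariant derivative of `∇^ω`. -/
def dNablaL (ω : R.Inv →ₗ[ℂ] A) (x : Γ.FormsL α) : Γ.FormsL α :=
  Γ.upsilonL (P.covD ω ∘ₗ Γ.mulFormL x)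

/-- The exterior covariant derivative of `∇̂^ω`. -/
def dNablaR (ω : R.Inv →ₗ[ℂ] A) (x : Γ.FormsR α) : Γ.FormsR α :=
  Γ.upsilonR (P.dualOp (P.covD ω) ∘ₗ Γ.mulFormR x)

/-- The codifferential on forms of degree `m`, the adjoint of the exterior covariant derivative
of `∇^ω`. It is given by the Hodge formula with the dual connection `ω̂`
(with `ω` itself if `ω` is real). -/
def codiffL (m : ℕ) (ω : R.Inv →ₗ[ℂ] A) (x : Γ.FormsL α) : Γ.FormsL α :=
  (-1 : ℂ) ^ m • Γ.hodgeInvStarL (Γ.dNablaL (P.dual ω) (Γ.starHodgeL x))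

/-- The codifferential on forms of degree `m`, the adjoint of the exterior covariant derivative
of `∇̂^ω`. -/
def codiffR (m : ℕ) (ω : R.Inv →ₗ[ℂ] A) (x : Γ.FormsR α) : Γ.FormsR α :=
  (-1 : ℂ) ^ m • Γ.hodgeInvStarR (Γ.dNablaR (P.dual ω) (Γ.starHodgeR x))

/-- `Υ ∘ S^ω ∘ Υ⁻¹`. -/
def dSL (Δ : E.EmbeddedDifferential) (ω : R.Inv →ₗ[ℂ] A) (x : Γ.FormsL R.ad) : Γ.FormsL R.ad :=
  Γ.upsilonL (QuantumPrincipalBundle.opS 𝒜 Δ ω (Γ.mulFormL x))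

/-- `Υ̃ ∘ Ŝ^ω ∘ Υ̃⁻¹`, where `Ŝ^ω = ∗ ∘ S^ω ∘ ∗`. -/
def dSR (Δ : E.EmbeddedDifferential) (ω : R.Inv →ₗ[ℂ] A) (x : Γ.FormsR R.ad) : Γ.FormsR R.ad :=
  Γ.upsilonR (P.dual (QuantumPrincipalBundle.opS 𝒜 Δ ω (P.dual (Γ.mulFormR x))))

end BaseGeometry

end Covariant

/-! ### Yang-Mills-Scalar-Matter models -/

/-- The Wirtinger derivative `∂f/∂z = (∂f/∂x - i ∂f/∂y) / 2`. -/
def wirtingerDeriv {F : Type*} [NormedAddCommGroup F] [NormedSpace ℂ F] (f : ℂ → F) (z : ℂ) : F :=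
  (1 / 2 : ℂ) • (fderiv ℝ f z 1 - Complex.I • fderiv ℝ f z Complex.I)

/-- `f` is real differentiable at `z`, and `∂f/∂z = a` there. -/
def HasWirtingerDerivAt {F : Type*} [NormedAddCommGroup F] [NormedSpace ℂ F]
    (f : ℂ → F) (a : F) (z : ℂ) : Prop :=
  DifferentiableAt ℝ f z ∧ wirtingerDeriv f z = a

section Model

variable {R : BicovariantCalculus G} {W : Type u} [Ring W] [Algebra ℂ W]
  {ℬ : ℕ → Submodule ℂ W} [GradedAlgebra ℬ] {E : Envelope R ℬ}
  {A : Type*} [Ring A] [Algebra ℂ A] {𝒜 : ℕ → Submodule ℂ A} [GradedAlgebra 𝒜]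
  {B : Type*} [CStarAlgebra B] [PartialOrder B] [StarOrderedRing B]
  {P : QuantumPrincipalBundle E 𝒜} {M : StarSubalgebra ℂ B}
  {V : Type*} [AddCommGroup V] [Module ℂ V]

/-- A Yang-Mills-Scalar-Matter model on a quantum principal bundle with Riemannian geometry on the
base: an embedded differential, a finite-dimensional representation `α` and orthonormal bases,
frames for `α` and `ad`, adjointability of the operators given by `S^ω` and `Ŝ^ω`, and
a Fréchet differentiable potential with its `M`-valued derivative, for which
`∫ DV_p(h) dvol = ∫ V'(p) h dvol`. The conjugate space of `V` carries the conjugate of the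
orthonormal basis of `V`. -/
structure YMSMModel (Γ : BaseGeometry P M) (α : V →ₗ[ℂ] V ⊗[ℂ] G) (κ κ₁ κ₂ : Type*)
    [Fintype κ] [DecidableEq κ] [Fintype κ₁] [DecidableEq κ₁] [Fintype κ₂] [DecidableEq κ₂] where
  Δ : E.EmbeddedDifferential
  corep : IsCorep α
  basis : UnitaryBasis α κ
  adBasisL : UnitaryBasis R.ad κ₁
  adBasisR : ConjUnitaryBasis R.ad κ₂
  frame : P.HasFrame basis
  adFrame : P.HasFrame adBasisL
  adjointable_L : ∀ ω, P.IsConnection ω → ∃ X, Γ.IsAdjointL adBasisL (Γ.dSL Δ ω) X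
  adjointable_R : ∀ ω, P.IsConnection ω → ∃ X, Γ.IsAdjointR adBasisR (Γ.dSR Δ ω) X
  pot : M → M
  pot_differentiable : Differentiable ℝ pot
  potDeriv : M → M
  potDeriv_spec : ∀ p h : M, IsSelfAdjoint p → IsSelfAdjoint h →
    Γ.state (fderiv ℝ pot p h) = Γ.state (potDeriv p * h)

namespace YMSMModel

variable {Γ : BaseGeometry P M} {α : V →ₗ[ℂ] V ⊗[ℂ] G} {κ κ₁ κ₂ : Type*}
  [Fintype κ] [DecidableEq κ] [Fintype κ₁] [DecidableEq κ₁] [Fintype κ₂] [DecidableEq κ₂]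
  (𝔐 : YMSMModel Γ α κ κ₁ κ₂)

/-- `⟨T₁, T₁⟩_L`, as an element of `M`. -/
def normL (T₁ : P.sections α) : M := Γ.toBase (P.hermitianL 𝔐.basis T₁ T₁)

/-- `⟨T₂, T₂⟩_R`, as an element of `M`. -/
def normR (T₂ : P.sections (conjCorep α)) : M := Γ.toBase (P.hermitianR 𝔐.basis.conj T₂ T₂)

/-- `V_L(T₁) = V(⟨T₁, T₁⟩_L)`. -/
def potL (T₁ : P.sections α) : M := 𝔐.pot (𝔐.normL T₁)

/-- `V_R(T₂) = V(⟨T₂, T₂⟩_R)`. -/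
def potR (T₂ : P.sections (conjCorep α)) : M := 𝔐.pot (𝔐.normR T₂)

/-- `V'_L(T₁) = V'(⟨T₁, T₁⟩_L)`. -/
def potDerivL (T₁ : P.sections α) : M := 𝔐.potDeriv (𝔐.normL T₁)

/-- `V'_R(T₂) = V'(⟨T₂, T₂⟩_R)`. -/
def potDerivR (T₂ : P.sections (conjCorep α)) : M := 𝔐.potDeriv (𝔐.normR T₂)

/-- `R^ω` as a left bundle-valued form. -/
def curvL (ω : R.Inv →ₗ[ℂ] A) : Γ.FormsL R.ad := Γ.upsilonL (P.curvature 𝔐.Δ ω)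

/-- `R̂^ω = ∗ ∘ R^ω ∘ ∗` as a right bundle-valued form. -/
def curvR (ω : R.Inv →ₗ[ℂ] A) : Γ.FormsR R.ad := Γ.upsilonR (P.dual (P.curvature 𝔐.Δ ω))

/-- The Yang-Mills Lagrangian. -/
def lagrangianYM (ω : R.Inv →ₗ[ℂ] A) : M :=
  (-1 / 4 : ℂ) • (Γ.hermitianFormL 𝔐.adBasisL (𝔐.curvL ω) (𝔐.curvL ω) +
    Γ.hermitianFormR 𝔐.adBasisR (𝔐.curvR ω) (𝔐.curvR ω))

/-- The generalized space-time scalar matter Lagrangian. -/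
def lagrangianGSM (ω : R.Inv →ₗ[ℂ] A) (T₁ : P.sections α) (T₂ : P.sections (conjCorep α)) : M :=
  (1 / 4 : ℂ) • (Γ.hermitianFormL 𝔐.basis (Γ.nablaL ω T₁) (Γ.nablaL ω T₁) - 𝔐.potL T₁ -
    Γ.hermitianFormR 𝔐.basis.conj (Γ.nablaR ω T₂) (Γ.nablaR ω T₂) + 𝔐.potR T₂)

/-- The Yang-Mills-Scalar-Matter action. -/
def action (ω : R.Inv →ₗ[ℂ] A) (T₁ : P.sections α) (T₂ : P.sections (conjCorep α)) : ℂ :=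
  Γ.state (𝔐.lagrangianYM ω + 𝔐.lagrangianGSM ω T₁ T₂)

/-- Stationary points of the action. -/
def IsStationary (ω : R.Inv →ₗ[ℂ] A) (T₁ : P.sections α) (T₂ : P.sections (conjCorep α)) : Prop :=
  ∀ (lam : R.Inv →ₗ[ℂ] A) (U₁ : P.sections α) (U₂ : P.sections (conjCorep α)),
    P.IsDisplacement lam →
      HasWirtingerDerivAt (fun z : ℂ => 𝔐.action (ω + z • lam) T₁ T₂) 0 0 ∧
      HasWirtingerDerivAt (fun z : ℂ => 𝔐.action ω (T₁ + z • U₁) (T₂ + z • U₂)) 0 0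

/-- The derivative `∂/∂z` at `z = 0` commutes with the quantum integral, for the potential along
all variations of `T₁` and `T₂`. -/
def Interchange (T₁ : P.sections α) (T₂ : P.sections (conjCorep α)) : Prop :=
  (∀ U₁, HasWirtingerDerivAt (fun z : ℂ => Γ.state (𝔐.potL (T₁ + z • U₁)))
    (Γ.state (wirtingerDeriv (fun z : ℂ => 𝔐.potL (T₁ + z • U₁)) 0)) 0) ∧
  (∀ U₂, HasWirtingerDerivAt (fun z : ℂ => Γ.state (𝔐.potR (T₂ + z • U₂)))
    (Γ.state (wirtingerDeriv (fun z : ℂ => 𝔐.potR (T₂ + z • U₂)) 0)) 0)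

/-- `⟨V'_L(T₁) U₁ | T₁⟩ = ⟨U₁ | V'_L(T₁)* T₁⟩` for all `U₁`, and the analogue on the right,
`⟨T₂ | U₂ V'_R(T₂)⟩ = ⟨T₂ V'_R(T₂)* | U₂⟩` for all `U₂`. -/
def Symmetric (T₁ : P.sections α) (T₂ : P.sections (conjCorep α)) : Prop :=
  (∀ U₁, Γ.innerL 𝔐.basis (Γ.ofSectionL (Γ.smulL (𝔐.potDerivL T₁) U₁)) (Γ.ofSectionL T₁) =
    Γ.innerL 𝔐.basis (Γ.ofSectionL U₁) (Γ.ofSectionL (Γ.smulL (star (𝔐.potDerivL T₁)) T₁))) ∧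
  (∀ U₂, Γ.innerR 𝔐.basis.conj (Γ.ofSectionR T₂) (Γ.ofSectionR (Γ.smulR U₂ (𝔐.potDerivR T₂))) =
    Γ.innerR 𝔐.basis.conj (Γ.ofSectionR (Γ.smulR T₂ (star (𝔐.potDerivR T₂)))) (Γ.ofSectionR U₂))

/-- `(d^{∇⋆} - d^{S⋆}) R^ω`. -/
def ymCurrentL (ω : R.Inv →ₗ[ℂ] A) : Γ.FormsL R.ad :=
  Γ.codiffL 2 ω (𝔐.curvL ω) - Γ.adjointL 𝔐.adBasisL (Γ.dSL 𝔐.Δ ω) (𝔐.curvL ω)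

/-- `(d^{∇̂⋆} - d^{Ŝ⋆}) R̂^ω`. -/
def ymCurrentR (ω : R.Inv →ₗ[ℂ] A) : Γ.FormsR R.ad :=
  Γ.codiffR 2 ω (𝔐.curvR ω) - Γ.adjointR 𝔐.adBasisR (Γ.dSR 𝔐.Δ ω) (𝔐.curvR ω)

end YMSMModel

end Model

end QuantumGroup

end

end QYM

/-!
The action is a sum of squares `⟨x(z), x(z)⟩` of inner products of bundle-valued forms and of two
potential terms, and the proof computes its Wirtinger derivative in all directions.

Along `ω + z λ` the curvature is `R^ω + z (D^ω λ - S^ω λ) - z² ⟨λ, λ⟩`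
(`curvature_add_smul`, `IsDisplacement.covD_comp_sub_opS`), and `∇^ω T₁` changes by
`z Υ(K^λ(T₁))`. A left inner product is antilinear in its second slot, and the right bundle involves
`∗`, so the right quantities are curves in `z̄` for inner products antilinear in the first slot.
Hence `∂/∂z` keeps in every square only the term with the variation in the first slot
(`hasWirtingerDerivAt_sesquilinear`, `hasWirtingerDerivAt_sesquilinear_conj`). Variations of `T₂`
enter linearly in `z`, and there the term with the variation in the second slot survives.

These derivatives are put in the required form by the adjointness of the codifferential and the
exterior covariant derivative (`BaseGeometry.innerL_dNablaL`, `BaseGeometry.innerR_dNablaR`). This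
is Stokes' theorem for the base form `∑ x(e_k) ((∗ ∘ ⋆) y)(e_k)*`, whose top degree part computes
the hermitian structure. In the Leibniz rule for this form the connection terms of `D^ω` and of the
dual connection cancel, because the antipode of a unitary matrix corepresentation is its adjoint
(`IsCovariant.d_sum_mul_st`).

All of this needs that the operators involved stay among the morphisms to horizontal forms, on which
frames make `Υ` a two-sided inverse. For the covariant derivatives this is a computation with
the matrix entries of corepresentations, which span `G`. For the curvature it rests on the component
of bidegree `(1, 1)` of the coproduct of `dθ = ∑ θ₁ θ₂`, and thus on the extension of the coproduct
to the universal envelope (`Envelope.exists_comul`,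
`Envelope.EmbeddedDifferential.sum_coeff_commutator`).

The derivative of the action is thus `1/4` of the difference of the two sides of the Yang-Mills
equation in the direction `λ`, and `1/4` of the difference of the pairings of `U₁` and `U₂` with the
left sides of the two matter equations. The latter are sections, since `⋆⁻¹` maps top degree forms
to functions, and the pairing of sections is nondegenerate by the existence of frames
(`BaseGeometry.eq_zero_of_innerL_ofSectionL`), so that the pairings vanish only if the sections do.
-/

namespace QYM

noncomputable section

/-! ### Matrix corepresentations -/

section MatrixCorep

variable {G : Type u} [Ring G] [HopfAlgebra ℂ G]

/-- A square matrix over `G` that is a matrix corepresentation: `φ(uᵢⱼ) = ∑ uᵢₖ ⊗ uₖⱼ` and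
`ε(uᵢⱼ) = δᵢⱼ`. -/
structure IsMatrixCorep {ι : Type*} [Fintype ι] [DecidableEq ι] (u : Matrix ι ι G) : Prop where
  comul : ∀ i j, Coalgebra.comul (R := ℂ) (u i j) = ∑ k, u i k ⊗ₜ[ℂ] u k j
  counit : ∀ i j, Coalgebra.counit (R := ℂ) (u i j) = if i = j then 1 else 0

namespace IsMatrixCorep

variable {ι : Type*} [Fintype ι] [DecidableEq ι] {u : Matrix ι ι G}

theorem antipode_mul (hu : IsMatrixCorep u) : u.map (HopfAlgebra.antipode ℂ) * u = 1 := by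
  ext i j
  have h := HopfAlgebra.mul_antipode_rTensor_comul_apply (R := ℂ) (u i j)
  rw [hu.comul, hu.counit] at h
  simp only [map_sum, LinearMap.rTensor_tmul, LinearMap.mul'_apply] at h
  simp only [Matrix.mul_apply, Matrix.map_apply, h, Matrix.one_apply]
  split_ifs <;> simp

theorem mul_antipode (hu : IsMatrixCorep u) : u * u.map (HopfAlgebra.antipode ℂ) = 1 := by
  ext i j
  have h := HopfAlgebra.mul_antipode_lTensor_comul_apply (R := ℂ) (u i j)
  rw [hu.comul, hu.counit] at h
  simp only [map_sum, LinearMap.lTensor_tmul, LinearMap.mul'_apply] at h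
  simp only [Matrix.mul_apply, Matrix.map_apply, h, Matrix.one_apply]
  split_ifs <;> simp

theorem sum_antipode_mul (hu : IsMatrixCorep u) (i j : ι) :
    ∑ k, HopfAlgebra.antipode ℂ (u i k) * u k j = if i = j then 1 else 0 := by
  have h := congrFun (congrFun hu.antipode_mul i) j
  simpa [Matrix.mul_apply, Matrix.one_apply] using h

theorem sum_mul_antipode (hu : IsMatrixCorep u) (i j : ι) :
    ∑ k, u i k * HopfAlgebra.antipode ℂ (u k j) = if i = j then 1 else 0 := by
  have h := congrFun (congrFun hu.mul_antipode i) j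
  simpa [Matrix.mul_apply, Matrix.one_apply] using h

/-- The antipode is anticomultiplicative. Both sides are entries of the inverse of the matrix with
entries `φ(uᵢⱼ)`. -/
theorem comul_antipode (hu : IsMatrixCorep u) (i j : ι) :
    Coalgebra.comul (R := ℂ) (HopfAlgebra.antipode ℂ (u i j)) =
      ∑ k, HopfAlgebra.antipode ℂ (u k j) ⊗ₜ[ℂ] HopfAlgebra.antipode ℂ (u i k) := by
  let c : G →+* G ⊗[ℂ] G := (Bialgebra.comulAlgHom ℂ G).toRingHom
  let l : G →+* G ⊗[ℂ] G := (Algebra.TensorProduct.includeLeft : G →ₐ[ℂ] G ⊗[ℂ] G).toRingHom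
  let r : G →+* G ⊗[ℂ] G := (Algebra.TensorProduct.includeRight : G →ₐ[ℂ] G ⊗[ℂ] G).toRingHom
  let s := u.map (HopfAlgebra.antipode ℂ)
  have h1 : c.mapMatrix u = l.mapMatrix u * r.mapMatrix u := by
    ext i j
    simpa [c, l, r, Matrix.mul_apply] using hu.comul i j
  have h2 : c.mapMatrix s * c.mapMatrix u = 1 := by
    rw [← map_mul, hu.antipode_mul, map_one]
  have h3 : c.mapMatrix u * (r.mapMatrix s * l.mapMatrix s) = 1 := by
    rw [h1, mul_assoc, ← mul_assoc (r.mapMatrix u), ← map_mul, hu.mul_antipode, map_one, one_mul,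
      ← map_mul, hu.mul_antipode, map_one]
  have h4 : c.mapMatrix s = r.mapMatrix s * l.mapMatrix s := left_inv_eq_right_inv h2 h3
  have h4 := congrFun (congrFun h4 i) j
  simpa [c, l, r, s, Matrix.mul_apply] using h4

theorem one : IsMatrixCorep (1 : Matrix Unit Unit G) where
  comul i j := by simp [Bialgebra.comul_one, Algebra.TensorProduct.one_def]
  counit i j := by simp

theorem kronecker (hu : IsMatrixCorep u) {κ : Type*} [Fintype κ] [DecidableEq κ]
    {v : Matrix κ κ G} (hv : IsMatrixCorep v) :
    IsMatrixCorep (Matrix.of fun (p q : ι × κ) => u p.1 q.1 * v p.2 q.2) where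
  comul i j := by
    simp only [Matrix.of_apply, Bialgebra.comul_mul, hu.comul, hv.comul, Finset.sum_mul_sum,
      Algebra.TensorProduct.tmul_mul_tmul, Fintype.sum_prod_type]
  counit i j := by
    simp only [Matrix.of_apply, Bialgebra.counit_mul, hu.counit, hv.counit, Prod.ext_iff]
    split_ifs <;> simp_all

end IsMatrixCorep

section Star

variable [StarRing G] [StarModule ℂ G]

theorem counit_star
    (hs : ∀ g : G, Coalgebra.comul (R := ℂ) (star g) = star (Coalgebra.comul (R := ℂ) g)) (g : G) :
    Coalgebra.counit (R := ℂ) (star g) = star (Coalgebra.counit (R := ℂ) g) := by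
  -- `ε' : g ↦ conj ε(g*)` is a left counit, so that `ε'(g) = ε'(g₁) ε(g₂) = ε(g)`.
  have key : ∀ t : G ⊗[ℂ] G,
      star (Coalgebra.counit (R := ℂ)
        (star (TensorProduct.rid ℂ G ((Coalgebra.counit (R := ℂ)).lTensor G t)))) =
      Coalgebra.counit (R := ℂ)
        (star (TensorProduct.lid ℂ G ((Coalgebra.counit (R := ℂ)).rTensor G (star t)))) := by
    intro t
    induction t with
    | zero => simp
    | add x y hx hy => simp only [map_add, star_add, hx, hy]
    | tmul x y => simp [star_smul, mul_comm]
  have h := key (Coalgebra.comul (R := ℂ) g)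
  rw [← hs, Coalgebra.rTensor_counit_comul, Coalgebra.lTensor_counit_comul] at h
  simp only [TensorProduct.lid_tmul, TensorProduct.rid_tmul, one_smul, star_star] at h
  rw [← h, star_star]

namespace IsMatrixCorep

variable {ι : Type*} [Fintype ι] [DecidableEq ι] {u : Matrix ι ι G}

theorem map_star
    (hs : ∀ g : G, Coalgebra.comul (R := ℂ) (star g) = star (Coalgebra.comul (R := ℂ) g))
    (hu : IsMatrixCorep u) : IsMatrixCorep (u.map star) where
  comul i j := by
    simp only [Matrix.map_apply, hs, hu.comul, star_sum, TensorProduct.star_tmul]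
  counit i j := by
    rw [Matrix.map_apply, counit_star hs, hu.counit]
    split_ifs <;> simp

theorem antipode_of_unitary (hu : IsMatrixCorep u) (h : u ∈ unitary (Matrix ι ι G)) (i j : ι) :
    HopfAlgebra.antipode ℂ (u i j) = star (u j i) := by
  have h1 : u.map (HopfAlgebra.antipode ℂ) = star u :=
    left_inv_eq_right_inv hu.antipode_mul (Unitary.mul_star_self_of_mem h)
  exact congrFun (congrFun h1 i) j

theorem map_star_antipode
    (hs : ∀ g : G, Coalgebra.comul (R := ℂ) (star g) = star (Coalgebra.comul (R := ℂ) g))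
    (hu : IsMatrixCorep u) :
    IsMatrixCorep (Matrix.of fun i j => star (HopfAlgebra.antipode ℂ (u j i))) where
  comul i j := by
    simp only [Matrix.of_apply, hs, hu.comul_antipode, star_sum, TensorProduct.star_tmul]
  counit i j := by
    rw [Matrix.of_apply, counit_star hs, HopfAlgebra.counit_antipode, hu.counit]
    simp only [eq_comm]
    split_ifs <;> simp

/-- `κ(κ(g)*) = g*` for matrix entries: `(κ(uⱼᵢ)*)ᵢⱼ` is a matrix corepresentation whose inverse
matrix is `(uⱼᵢ*)ᵢⱼ`. -/
theorem antipode_star_antipode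
    (hs : ∀ g : G, Coalgebra.comul (R := ℂ) (star g) = star (Coalgebra.comul (R := ℂ) g))
    (hu : IsMatrixCorep u) (i j : ι) :
    HopfAlgebra.antipode ℂ (star (HopfAlgebra.antipode ℂ (u i j))) = star (u i j) := by
  have hv := hu.map_star_antipode hs
  have h : (Matrix.of fun i j => star (HopfAlgebra.antipode ℂ (u j i))) *
      (Matrix.of fun i j => star (u j i)) = 1 := by
    ext a b
    have h := congrArg star (hu.sum_mul_antipode b a)
    simp only [star_sum, star_mul] at h
    simp only [Matrix.mul_apply, Matrix.of_apply, h, Matrix.one_apply, eq_comm]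
    split_ifs <;> simp
  have h2 := left_inv_eq_right_inv hv.antipode_mul h
  exact congrFun (congrFun h2 j) i

end IsMatrixCorep

namespace IsCompactMatrixQuantumGroup

/-- The entries of matrix corepresentations span `G`: they are closed under products, as tensor
products of matrix corepresentations show, and contain the generators and their adjoints. -/
theorem span_matrix_entries (hG : IsCompactMatrixQuantumGroup G) :
    Submodule.span ℂ {g : G | ∃ (ι : Type) (_ : Fintype ι) (_ : DecidableEq ι) (u : Matrix ι ι G),
      IsMatrixCorep u ∧ ∃ i j, u i j = g} = ⊤ := by
  obtain ⟨n, x, hx1, hx2, -, hx4⟩ := hG.fundamental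
  have hx : IsMatrixCorep x := ⟨hx1, hx2⟩
  let S : Submonoid G :=
    { carrier := {g : G | ∃ (ι : Type) (_ : Fintype ι) (_ : DecidableEq ι) (u : Matrix ι ι G),
        IsMatrixCorep u ∧ ∃ i j, u i j = g}
      one_mem' := ⟨Unit, inferInstance, inferInstance, 1, IsMatrixCorep.one, (), (), by simp⟩
      mul_mem' := by
        rintro _ _ ⟨ι, _, _, u, hu, i, j, rfl⟩ ⟨κ, _, _, v, hv, k, l, rfl⟩
        exact ⟨ι × κ, inferInstance, inferInstance, _, hu.kronecker hv, (i, k), (j, l), rfl⟩ }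
  change Submodule.span ℂ (S : Set G) = ⊤
  rw [eq_top_iff, ← Algebra.top_toSubmodule, ← hx4, Algebra.adjoin_eq_span]
  refine Submodule.span_mono (Submonoid.closure_le.2 ?_)
  rintro _ (⟨i, j, rfl⟩ | ⟨i, j, rfl⟩)
  · exact ⟨Fin n, inferInstance, inferInstance, x, hx, i, j, rfl⟩
  · exact ⟨Fin n, inferInstance, inferInstance, _, hx.map_star hG.comul_star, i, j, rfl⟩

theorem linearMap_ext (hG : IsCompactMatrixQuantumGroup G) {N : Type*} [AddCommGroup N]
    [Module ℂ N] {σ : ℂ →+* ℂ} {f g : G →ₛₗ[σ] N}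
    (h : ∀ (ι : Type) [Fintype ι] [DecidableEq ι] (u : Matrix ι ι G), IsMatrixCorep u →
      ∀ i j, f (u i j) = g (u i j)) : f = g := by
  refine LinearMap.ext_on hG.span_matrix_entries ?_
  rintro _ ⟨ι, _, _, u, hu, i, j, rfl⟩
  exact h ι u hu i j

theorem antipode_star_antipode (hG : IsCompactMatrixQuantumGroup G) (g : G) :
    HopfAlgebra.antipode ℂ (star (HopfAlgebra.antipode ℂ g)) = star g := by
  have h : (HopfAlgebra.antipode ℂ (A := G)).comp
      ((starLinearEquiv ℂ (A := G)).toLinearMap.comp (HopfAlgebra.antipode ℂ)) =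
      (starLinearEquiv ℂ (A := G)).toLinearMap :=
    hG.linearMap_ext fun ι _ _ u hu i j => hu.antipode_star_antipode hG.comul_star i j
  exact LinearMap.congr_fun h g

end IsCompactMatrixQuantumGroup

end Star

end MatrixCorep

/-! ### The adjoint corepresentation and the involution on left-invariant forms -/

section Adjoint

variable {G : Type u} [Ring G] [HopfAlgebra ℂ G]

theorem IsMatrixCorep.Ad_apply {ι : Type*} [Fintype ι] [DecidableEq ι] {u : Matrix ι ι G}
    (hu : IsMatrixCorep u) (i j : ι) :
    Ad G (u i j) = ∑ a, ∑ b, u a b ⊗ₜ[ℂ] (HopfAlgebra.antipode ℂ (u i a) * u b j) := by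
  simp only [Ad, LinearMap.comp_apply, hu.comul, map_sum, LinearMap.lTensor_tmul,
    TensorProduct.tmul_sum, LinearEquiv.coe_coe, TensorProduct.leftComm_tmul,
    LinearMap.rTensor_tmul, LinearMap.mul'_apply]

variable [StarRing G] [StarModule ℂ G]

namespace BicovariantCalculus

variable (R : BicovariantCalculus G)

theorem germ_surjective : Function.Surjective R.germ := R.kerGerm.mkQ_surjective

theorem ad_germ (g : G) : R.ad (R.germ g) = R.germ.rTensor G (Ad G g) := rfl

theorem starInv_germ (g : G) : R.starInv (R.germ g) = -R.germ (star (HopfAlgebra.antipode ℂ g)) :=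
  rfl

/-- Linear maps on left-invariant forms are determined by the germs of entries of matrix
corepresentations. -/
theorem inv_linearMap_ext (hG : IsCompactMatrixQuantumGroup G) {N : Type*} [AddCommGroup N]
    [Module ℂ N] {σ : ℂ →+* ℂ} {f g : R.Inv →ₛₗ[σ] N}
    (h : ∀ (ι : Type) [Fintype ι] [DecidableEq ι] (u : Matrix ι ι G), IsMatrixCorep u →
      ∀ i j, f (R.germ (u i j)) = g (R.germ (u i j))) : f = g := by
  have h1 : f.comp R.germ = g.comp R.germ := hG.linearMap_ext fun ι _ _ u hu i j => h ι u hu i j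
  refine LinearMap.ext fun θ => ?_
  obtain ⟨x, rfl⟩ := R.germ_surjective θ
  exact LinearMap.congr_fun h1 x

variable {R}

theorem ad_germ_entry {ι : Type*} [Fintype ι] [DecidableEq ι] {u : Matrix ι ι G}
    (hu : IsMatrixCorep u) (i j : ι) :
    R.ad (R.germ (u i j)) =
      ∑ a, ∑ b, R.germ (u a b) ⊗ₜ[ℂ] (HopfAlgebra.antipode ℂ (u i a) * u b j) := by
  simp only [ad_germ, hu.Ad_apply, map_sum, LinearMap.rTensor_tmul]

theorem isCorep_ad (hG : IsCompactMatrixQuantumGroup G) : IsCorep R.ad where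
  counit := by
    have h : (TensorProduct.rid ℂ R.Inv).toLinearMap ∘ₗ
        (Coalgebra.counit (R := ℂ) (A := G)).lTensor R.Inv ∘ₗ R.ad = LinearMap.id := by
      refine R.inv_linearMap_ext hG fun ι _ _ u hu i j => ?_
      simp only [LinearMap.comp_apply, ad_germ_entry hu, map_sum, LinearMap.lTensor_tmul,
        Bialgebra.counit_mul, HopfAlgebra.counit_antipode, hu.counit, LinearEquiv.coe_coe,
        TensorProduct.rid_tmul, LinearMap.id_apply, ite_mul, one_mul, zero_mul, ite_smul, one_smul,
        zero_smul]
      rw [Finset.sum_comm]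
      simp
    exact fun v => LinearMap.congr_fun h v
  coassoc := by
    have h : (TensorProduct.assoc ℂ R.Inv G G).toLinearMap ∘ₗ R.ad.rTensor G ∘ₗ R.ad =
        (Coalgebra.comul (R := ℂ)).lTensor R.Inv ∘ₗ R.ad := by
      refine R.inv_linearMap_ext hG fun ι _ _ u hu i j => ?_
      simp only [LinearMap.comp_apply, ad_germ_entry hu, map_sum, LinearMap.lTensor_tmul,
        LinearMap.rTensor_tmul, TensorProduct.sum_tmul, LinearEquiv.coe_coe,
        TensorProduct.assoc_tmul, Bialgebra.comul_mul, hu.comul_antipode, hu.comul,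
        Finset.sum_mul_sum, Algebra.TensorProduct.tmul_mul_tmul, TensorProduct.tmul_sum]
      -- Both sides are sums over four indices, which appear in different orders.
      have e : ∀ f : ι → ι → ι → ι → R.Inv ⊗[ℂ] (G ⊗[ℂ] G),
          ∑ a, ∑ b, ∑ c, ∑ d, f a b c d = ∑ c, ∑ d, ∑ a, ∑ b, f a b c d := by
        intro f
        calc ∑ a, ∑ b, ∑ c, ∑ d, f a b c d
            = ∑ a, ∑ c, ∑ d, ∑ b, f a b c d := by
              refine Finset.sum_congr rfl fun a _ => ?_
              rw [Finset.sum_comm]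
              exact Finset.sum_congr rfl fun c _ => Finset.sum_comm
          _ = ∑ c, ∑ d, ∑ a, ∑ b, f a b c d := by
              rw [Finset.sum_comm]
              exact Finset.sum_congr rfl fun c _ => Finset.sum_comm
      rw [e]
    exact fun v => LinearMap.congr_fun h v

theorem starInv_starInv (hG : IsCompactMatrixQuantumGroup G) (θ : R.Inv) :
    R.starInv (R.starInv θ) = θ := by
  obtain ⟨g, rfl⟩ := R.germ_surjective θ
  rw [starInv_germ, map_neg, starInv_germ, hG.antipode_star_antipode, star_star, neg_neg]

theorem ad_starInv (hG : IsCompactMatrixQuantumGroup G) (θ : R.Inv) :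
    R.ad (R.starInv θ) =
      TensorProduct.map R.starInv (starLinearEquiv ℂ (A := G)).toLinearMap (R.ad θ) := by
  have h : R.ad.comp R.starInv =
      (TensorProduct.map R.starInv (starLinearEquiv ℂ (A := G)).toLinearMap).comp R.ad := by
    refine R.inv_linearMap_ext hG fun ι _ _ u hu i j => ?_
    have h1 := ad_germ_entry (R := R) (hu.map_star_antipode hG.comul_star) j i
    simp only [Matrix.of_apply] at h1
    simp only [LinearMap.comp_apply, starInv_germ, map_neg, h1, ad_germ_entry hu, map_sum,
      TensorProduct.map_tmul, TensorProduct.neg_tmul, Finset.sum_neg_distrib, neg_inj,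
      LinearEquiv.coe_coe, starLinearEquiv_apply, star_mul, hu.antipode_star_antipode hG.comul_star]
    exact Finset.sum_comm
  exact LinearMap.congr_fun h θ

end BicovariantCalculus

end Adjoint

/-! ### The graded tensor product of graded differential algebras -/

section GradedTensor

variable {A : Type*} [Ring A] [Algebra ℂ A] {𝒜 : ℕ → Submodule ℂ A} [GradedAlgebra 𝒜]
  {W : Type*} [Ring W] [Algebra ℂ W] {ℬ : ℕ → Submodule ℂ W} [GradedAlgebra ℬ]

theorem gradeInv_of_mem {k : ℕ} {a : A} (ha : a ∈ 𝒜 k) :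
    gradeInv 𝒜 a = (-1 : ℂ) ^ k • a := by
  lift a to 𝒜 k using ha
  simp [gradeInv]

theorem gradeInv_mul_of_mem {k : ℕ} {a : A} (ha : a ∈ 𝒜 k) (b : A) :
    gradeInv 𝒜 (a * b) = (-1 : ℂ) ^ k • (a * gradeInv 𝒜 b) := by
  induction b using DirectSum.Decomposition.inductionOn 𝒜 with
  | zero => simp
  | homogeneous b =>
    rw [gradeInv_of_mem (SetLike.GradedMul.mul_mem ha b.2), gradeInv_of_mem b.2, pow_add, mul_smul,
      mul_smul_comm]
  | add x y hx hy => simp only [mul_add, map_add, hx, hy, smul_add]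

theorem StarDGA.d_gradeInv (D : StarDGA 𝒜) (a : A) :
    D.d (gradeInv 𝒜 a) = -gradeInv 𝒜 (D.d a) := by
  induction a using DirectSum.Decomposition.inductionOn 𝒜 with
  | zero => simp
  | homogeneous a =>
    rw [gradeInv_of_mem a.2, gradeInv_of_mem (D.d_mem a.2), map_smul, pow_succ, mul_neg_one,
      neg_smul, neg_neg]
  | add x y hx hy => simp only [map_add, hx, hy, neg_add]

theorem StarDGA.d_one (D : StarDGA 𝒜) : D.d 1 = 0 := by
  have h := D.leibniz (SetLike.GradedOne.one_mem (A := 𝒜)) 1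
  simpa using h

variable (𝒜 ℬ) in
/-- The multiplication `(a ⊗ w)(a' ⊗ w') = (-1)^{|w||a'|} a a' ⊗ w w'` of the graded tensor product,
as a bilinear map on the tensor product. -/
def gmul : A ⊗[ℂ] W →ₗ[ℂ] A ⊗[ℂ] W →ₗ[ℂ] A ⊗[ℂ] W :=
  ((LinearMap.mul ℂ (𝒜 ᵍ⊗[ℂ] ℬ)).compl₁₂ (GradedTensorProduct.of ℂ 𝒜 ℬ).toLinearMap
    (GradedTensorProduct.of ℂ 𝒜 ℬ).toLinearMap).compr₂
    (GradedTensorProduct.of ℂ 𝒜 ℬ).symm.toLinearMap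

theorem gmul_apply (x y : A ⊗[ℂ] W) : gmul 𝒜 ℬ x y = (GradedTensorProduct.of ℂ 𝒜 ℬ).symm
    (GradedTensorProduct.of ℂ 𝒜 ℬ x * GradedTensorProduct.of ℂ 𝒜 ℬ y) := rfl

theorem gmul_tmul {k l : ℕ} (a : A) {w : W} (hw : w ∈ ℬ k) {a' : A} (ha' : a' ∈ 𝒜 l) (w' : W) :
    gmul 𝒜 ℬ (a ⊗ₜ w) (a' ⊗ₜ w') = (-1 : ℂ) ^ (k * l) • ((a * a') ⊗ₜ (w * w')) := by
  have h := GradedTensorProduct.tmul_coe_mul_coe_tmul (R := ℂ) 𝒜 ℬ a ⟨w, hw⟩ ⟨a', ha'⟩ w'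
  rw [gmul_apply]
  change (GradedTensorProduct.of ℂ 𝒜 ℬ).symm (GradedTensorProduct.tmul ℂ a w *
    GradedTensorProduct.tmul ℂ a' w') = _
  rw [h]
  rcases Nat.even_or_odd (k * l) with he | ho
  · rw [he.neg_one_pow, he.neg_one_pow, one_smul, one_smul]
    rfl
  · rw [ho.neg_one_pow, ho.neg_one_pow, neg_one_smul, Units.neg_smul, one_smul, map_neg]
    rfl

theorem gmul_tmul_of_mem_zero_left (a : A) {w : W} (hw : w ∈ ℬ 0) (a' : A) (w' : W) :
    gmul 𝒜 ℬ (a ⊗ₜ w) (a' ⊗ₜ w') = (a * a') ⊗ₜ (w * w') := by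
  induction a' using DirectSum.Decomposition.inductionOn 𝒜 with
  | zero => simp
  | homogeneous a' => rw [gmul_tmul a hw a'.2, zero_mul, pow_zero, one_smul]
  | add x y hx hy => simp only [TensorProduct.add_tmul, map_add, hx, hy, mul_add]

theorem gmul_tmul_of_mem_zero_right (a : A) (w : W) {a' : A} (ha' : a' ∈ 𝒜 0) (w' : W) :
    gmul 𝒜 ℬ (a ⊗ₜ w) (a' ⊗ₜ w') = (a * a') ⊗ₜ (w * w') := by
  induction w using DirectSum.Decomposition.inductionOn ℬ with
  | zero => simp
  | homogeneous w => rw [gmul_tmul a w.2 ha', mul_zero, pow_zero, one_smul]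
  | add x y hx hy =>
    simp only [TensorProduct.tmul_add, map_add, hx, hy, add_mul, LinearMap.add_apply]

/-- The differential `d ⊗ 1 + (-1)^k ⊗ d` of the graded tensor product. -/
def tensorD (D : StarDGA 𝒜) (D' : StarDGA ℬ) : A ⊗[ℂ] W →ₗ[ℂ] A ⊗[ℂ] W :=
  D.d.rTensor W + TensorProduct.map (gradeInv 𝒜) D'.d

theorem tensorD_tmul (D : StarDGA 𝒜) (D' : StarDGA ℬ) (a : A) (w : W) :
    tensorD D D' (a ⊗ₜ w) = D.d a ⊗ₜ w + gradeInv 𝒜 a ⊗ₜ D'.d w := rfl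

theorem tensorD_tensorD (D : StarDGA 𝒜) (D' : StarDGA ℬ) (x : A ⊗[ℂ] W) :
    tensorD D D' (tensorD D D' x) = 0 := by
  induction x with
  | zero => simp
  | add x y hx hy => simp only [map_add, hx, hy, add_zero]
  | tmul a w =>
    simp [tensorD_tmul, D.d_d, D'.d_d, D.d_gradeInv, TensorProduct.neg_tmul]

/-- The Leibniz rule, for a left factor of bidegree zero. -/
theorem tensorD_gmul (D : StarDGA 𝒜) (D' : StarDGA ℬ) {a : A} (ha : a ∈ 𝒜 0) {w : W}
    (hw : w ∈ ℬ 0) (y : A ⊗[ℂ] W) :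
    tensorD D D' (gmul 𝒜 ℬ (a ⊗ₜ w) y) =
      gmul 𝒜 ℬ (tensorD D D' (a ⊗ₜ w)) y + gmul 𝒜 ℬ (a ⊗ₜ w) (tensorD D D' y) := by
  induction y with
  | zero => simp
  | add x y hx hy =>
    simp only [map_add, hx, hy]
    abel
  | tmul a' w' =>
    induction a' using DirectSum.Decomposition.inductionOn 𝒜 with
    | zero => simp
    | add x y hx hy =>
      simp only [TensorProduct.add_tmul, map_add, hx, hy]
      abel
    | @homogeneous k a' =>
      have hdw : D'.d w ∈ ℬ 1 := D'.d_mem hw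
      simp only [tensorD_tmul, gmul_tmul_of_mem_zero_left _ hw, map_add, LinearMap.add_apply,
        gradeInv_of_mem ha, gradeInv_of_mem a'.2, pow_zero, one_smul, gmul_tmul _ hdw a'.2,
        one_mul, D.leibniz ha, D'.leibniz hw,
        gradeInv_mul_of_mem ha, TensorProduct.add_tmul, TensorProduct.tmul_add,
        mul_smul_comm, TensorProduct.smul_tmul']
      abel

/-- The product of two elements of the form `∑ a_c ⊗ m_c + 1 ⊗ θ`, where the `a_c` and `θ` have
degree one. -/
theorem gmul_sum_add {ι : Type*} [Fintype ι] {a : ι → A} (ha : ∀ c, a c ∈ 𝒜 1) {m m' : ι → W}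
    (hm : ∀ c, m c ∈ ℬ 0) {θ : W} (hθ : θ ∈ ℬ 1) (θ' : W) :
    gmul 𝒜 ℬ (∑ c, a c ⊗ₜ m c + 1 ⊗ₜ θ) (∑ c, a c ⊗ₜ m' c + 1 ⊗ₜ θ') =
      (∑ c, ∑ e, (a c * a e) ⊗ₜ (m c * m' e)) +
        ∑ c, a c ⊗ₜ[ℂ] (m c * θ' - θ * m' c) + 1 ⊗ₜ (θ * θ') := by
  have h1 : (1 : A) ∈ 𝒜 0 := SetLike.GradedOne.one_mem
  simp only [map_add, map_sum, LinearMap.add_apply, LinearMap.sum_apply,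
    gmul_tmul_of_mem_zero_left _ (hm _), gmul_tmul _ hθ (ha _),
    gmul_tmul_of_mem_zero_right _ _ h1, mul_one, one_mul, pow_one, neg_one_smul,
    TensorProduct.tmul_sub, Finset.sum_sub_distrib]
  simp only [Finset.sum_add_distrib, Finset.sum_neg_distrib]
  rw [Finset.sum_comm]
  abel

end GradedTensor

/-! ### Left-invariant forms in the universal differential envelope -/

section EnvelopeForms

variable {G : Type u} [Ring G] [HopfAlgebra ℂ G] [StarRing G] [StarModule ℂ G]
  {R : BicovariantCalculus G} {W : Type u} [Ring W] [Algebra ℂ W]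
  {ℬ : ℕ → Submodule ℂ W} [GradedAlgebra ℬ] (E : Envelope R ℬ)

namespace Envelope

theorem toG_incl (g : G) : E.toG (E.incl g) = g := by
  apply (LinearEquiv.ofInjective E.incl.toLinearMap E.incl_injective).injective
  rw [toG, LinearMap.comp_apply, LinearEquiv.coe_coe, LinearEquiv.apply_symm_apply]
  exact Subtype.ext (DirectSum.decompose_of_mem_same ℬ (E.incl_mem g))

theorem invIncl_germ (g : G) : E.invIncl (R.germ g) = E.germForm g := rfl

theorem invIncl_germ_entry {ι : Type*} [Fintype ι] [DecidableEq ι] {u : Matrix ι ι G}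
    (hu : IsMatrixCorep u) (i j : ι) : E.invIncl (R.germ (u i j)) =
      ∑ k, E.incl (HopfAlgebra.antipode ℂ (u i k)) * E.d (E.incl (u k j)) := by
  simp only [invIncl_germ, germForm, mulMap, LinearMap.comp_apply, hu.comul, map_sum,
    LinearMap.rTensor_tmul, TensorProduct.map_tmul, LinearMap.mul'_apply,
    AlgHom.toLinearMap_apply]

theorem d_incl_mem (g : G) : E.d (E.incl g) ∈ ℬ 1 := E.d_mem (E.incl_mem g)

theorem germForm_mem (g : G) : E.germForm g ∈ ℬ 1 := by
  have h : ∀ t : G ⊗[ℂ] G, mulMap E.incl.toLinearMap (E.d ∘ₗ E.incl.toLinearMap) t ∈ ℬ 1 := by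
    intro t
    induction t with
    | zero => simp
    | add x y hx hy => simpa only [map_add] using Submodule.add_mem _ hx hy
    | tmul x y =>
      have := SetLike.GradedMul.mul_mem (E.incl_mem x) (E.d_incl_mem y)
      simpa [mulMap] using this
  exact h _

theorem invIncl_mem (θ : R.Inv) : E.invIncl θ ∈ ℬ 1 := by
  obtain ⟨g, rfl⟩ := R.germ_surjective θ
  exact E.germForm_mem g

theorem d_incl_entry {ι : Type*} [Fintype ι] [DecidableEq ι] {u : Matrix ι ι G}
    (hu : IsMatrixCorep u) (i j : ι) :
    E.d (E.incl (u i j)) = ∑ k, E.incl (u i k) * E.invIncl (R.germ (u k j)) := by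
  simp only [E.invIncl_germ_entry hu, Finset.mul_sum, ← mul_assoc, ← map_mul]
  rw [Finset.sum_comm]
  simp only [← Finset.sum_mul, ← map_sum, hu.sum_mul_antipode]
  simp

/-- The involution of `Γ^` restricts to `θ ↦ θ*` on left-invariant forms. This comes from applying
`d ∘ ∗` to `∑ κ(uᵢₖ) uₖⱼ = δᵢⱼ`. -/
theorem st_invIncl (hG : IsCompactMatrixQuantumGroup G) (θ : R.Inv) :
    E.st (E.invIncl θ) = E.invIncl (R.starInv θ) := by
  have h : E.st.comp E.invIncl = E.invIncl.comp R.starInv := by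
    refine R.inv_linearMap_ext hG fun ι _ _ u hu i j => ?_
    have h0 : E.d (E.incl (star (∑ k, HopfAlgebra.antipode ℂ (u i k) * u k j))) = 0 := by
      rw [hu.sum_antipode_mul]
      split_ifs <;> simp [E.toStarDGA.d_one]
    have h1 := E.invIncl_germ_entry (hu.map_star_antipode hG.comul_star) j i
    simp only [Matrix.of_apply, hu.antipode_star_antipode hG.comul_star] at h1
    simp only [star_sum, star_mul, map_sum, map_mul, E.leibniz (E.incl_mem _), pow_zero, one_smul,
      Finset.sum_add_distrib] at h0
    simp only [LinearMap.comp_apply, R.starInv_germ, map_neg, h1, E.invIncl_germ_entry hu, map_sum,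
      E.toStarDGA.st_mul_zero_left _ (E.incl_mem _), E.st_d, E.st_incl]
    exact eq_neg_of_add_eq_zero_left h0
  exact LinearMap.congr_fun h θ

theorem invIncl_injective : Function.Injective E.invIncl := by
  rw [← LinearMap.ker_eq_bot, LinearMap.ker_eq_bot']
  intro θ hθ
  obtain ⟨g, rfl⟩ := R.germ_surjective θ
  have h := (E.first_order _).1 hθ
  rw [LinearMap.comp_apply, oneForm_antipode] at h
  have h2 := congrArg (TensorProduct.lid ℂ R.Inv ∘
    (Coalgebra.counit (R := ℂ) (A := G)).rTensor R.Inv) h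
  simpa using h2

/-! ### The coproduct of the envelope -/

/-- The coproduct of `G`, with values in the graded tensor square of the envelope. -/
def comulZero : G →ₐ[ℂ] ℬ ᵍ⊗[ℂ] ℬ :=
  AlgHom.ofLinearMap ((GradedTensorProduct.of ℂ ℬ ℬ).toLinearMap ∘ₗ
    TensorProduct.map E.incl.toLinearMap E.incl.toLinearMap ∘ₗ Coalgebra.comul (R := ℂ))
    (by
      simp [Bialgebra.comul_one, Algebra.TensorProduct.one_def]
      rfl)
    (fun g h => by
      simp only [LinearMap.comp_apply, Bialgebra.comul_mul]
      generalize Coalgebra.comul (R := ℂ) g = s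
      generalize Coalgebra.comul (R := ℂ) h = t
      induction s with
      | zero => simp
      | add x y hx hy => simp only [add_mul, map_add, hx, hy]
      | tmul a b =>
        induction t with
        | zero => simp
        | add x y hx hy => simp only [mul_add, map_add, hx, hy]
        | tmul c e =>
          have h := gmul_tmul_of_mem_zero_left (𝒜 := ℬ) (E.incl a) (E.incl_mem b) (E.incl c)
            (E.incl e)
          rw [gmul_apply, LinearEquiv.symm_apply_eq] at h
          simpa using h.symm)

theorem comulZero_entry {ι : Type*} [Fintype ι] [DecidableEq ι] {u : Matrix ι ι G}
    (hu : IsMatrixCorep u) (i j : ι) : (GradedTensorProduct.of ℂ ℬ ℬ).symm (E.comulZero (u i j)) =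
      ∑ k, E.incl (u i k) ⊗ₜ[ℂ] E.incl (u k j) := by
  change TensorProduct.map E.incl.toLinearMap E.incl.toLinearMap
    (Coalgebra.comul (R := ℂ) (u i j)) = _
  simp [hu.comul]

/-- The differential on the graded tensor square. -/
def squareD : (ℬ ᵍ⊗[ℂ] ℬ) →ₗ[ℂ] (ℬ ᵍ⊗[ℂ] ℬ) :=
  (GradedTensorProduct.of ℂ ℬ ℬ).toLinearMap ∘ₗ tensorD E.toStarDGA E.toStarDGA ∘ₗ
    (GradedTensorProduct.of ℂ ℬ ℬ).symm.toLinearMap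

theorem squareD_squareD (x : ℬ ᵍ⊗[ℂ] ℬ) : E.squareD (E.squareD x) = 0 :=
  tensorD_tensorD E.toStarDGA E.toStarDGA ((GradedTensorProduct.of ℂ ℬ ℬ).symm x)

theorem squareD_comulZero_mul (g : G) (y : ℬ ᵍ⊗[ℂ] ℬ) :
    E.squareD (E.comulZero g * y) = E.squareD (E.comulZero g) * y +
      E.comulZero g * E.squareD y := by
  change E.squareD (GradedTensorProduct.of ℂ ℬ ℬ (TensorProduct.map E.incl.toLinearMap
    E.incl.toLinearMap (Coalgebra.comul (R := ℂ) g)) * y) = E.squareD (GradedTensorProduct.of ℂ ℬ ℬ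
      (TensorProduct.map E.incl.toLinearMap E.incl.toLinearMap (Coalgebra.comul (R := ℂ) g))) * y +
    GradedTensorProduct.of ℂ ℬ ℬ (TensorProduct.map E.incl.toLinearMap
      E.incl.toLinearMap (Coalgebra.comul (R := ℂ) g)) * E.squareD y
  generalize Coalgebra.comul (R := ℂ) g = s
  induction s with
  | zero => simp
  | add x z hx hz =>
    simp only [map_add, add_mul, hx, hz]
    abel
  | tmul a b =>
    exact tensorD_gmul E.toStarDGA E.toStarDGA (E.incl_mem a) (E.incl_mem b)
      ((GradedTensorProduct.of ℂ ℬ ℬ).symm y)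

/-- The map `θ ↦ ad(θ) + 1 ⊗ θ`, the restriction of the coproduct of the envelope to left-invariant
one-forms. -/
def comulInv : R.Inv →ₗ[ℂ] ℬ ᵍ⊗[ℂ] ℬ :=
  (GradedTensorProduct.of ℂ ℬ ℬ).toLinearMap ∘ₗ
    (TensorProduct.map E.invIncl E.incl.toLinearMap ∘ₗ R.ad + TensorProduct.mk ℂ W W 1 ∘ₗ E.invIncl)

theorem squareD_comulZero_entry {ι : Type*} [Fintype ι] [DecidableEq ι] {u : Matrix ι ι G}
    (hu : IsMatrixCorep u) (i j : ι) : E.squareD (E.comulZero (u i j)) =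
      ∑ k, E.comulZero (u i k) * E.comulInv (R.germ (u k j)) := by
  apply (GradedTensorProduct.of ℂ ℬ ℬ).symm.injective
  have h1 : ∀ k, (GradedTensorProduct.of ℂ ℬ ℬ).symm
      (E.comulZero (u i k) * E.comulInv (R.germ (u k j))) =
      gmul ℬ ℬ ((GradedTensorProduct.of ℂ ℬ ℬ).symm (E.comulZero (u i k)))
        (TensorProduct.map E.invIncl E.incl.toLinearMap (R.ad (R.germ (u k j))) +
          1 ⊗ₜ E.invIncl (R.germ (u k j))) := fun k => rfl
  have h2 : (GradedTensorProduct.of ℂ ℬ ℬ).symm (E.squareD (E.comulZero (u i j))) =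
    tensorD E.toStarDGA E.toStarDGA ((GradedTensorProduct.of ℂ ℬ ℬ).symm (E.comulZero (u i j))) :=
    rfl
  rw [h2, map_sum]
  simp only [h1, E.comulZero_entry hu, BicovariantCalculus.ad_germ_entry hu, map_sum, tensorD_tmul,
    gradeInv_of_mem (E.incl_mem _), pow_zero, one_smul, TensorProduct.map_tmul,
    AlgHom.toLinearMap_apply, map_add, LinearMap.sum_apply,
    gmul_tmul_of_mem_zero_left _ (E.incl_mem _), mul_one, Finset.sum_add_distrib]
  congr 1
  · -- `∑ₖ uₚₖ κ(uₖₐ) = δₚₐ` contracts the second legs.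
    have h3 : ∀ p a b : ι, ∑ k, (E.incl (u i p) * E.invIncl (R.germ (u a b))) ⊗ₜ[ℂ]
        (E.incl (u p k) * E.incl (HopfAlgebra.antipode ℂ (u k a) * u b j)) =
        if p = a then (E.incl (u i p) * E.invIncl (R.germ (u a b))) ⊗ₜ[ℂ] E.incl (u b j)
        else 0 := by
      intro p a b
      simp only [← TensorProduct.tmul_sum, ← map_mul, ← mul_assoc, ← map_sum, ← Finset.sum_mul,
        hu.sum_mul_antipode]
      split_ifs <;> simp
    have h4 : ∀ f : ι → ι → ι → ι → W ⊗[ℂ] W,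
        ∑ k, ∑ p, ∑ a, ∑ b, f k p a b = ∑ p, ∑ a, ∑ b, ∑ k, f k p a b := by
      intro f
      rw [Finset.sum_comm]
      refine Finset.sum_congr rfl fun p _ => ?_
      rw [Finset.sum_comm]
      exact Finset.sum_congr rfl fun a _ => Finset.sum_comm
    rw [h4]
    simp only [h3, E.d_incl_entry hu, TensorProduct.sum_tmul]
    rw [Finset.sum_comm]
    refine Finset.sum_congr rfl fun p _ => ?_
    rw [Finset.sum_comm]
    simp
  · rw [Finset.sum_comm]
    simp only [← TensorProduct.tmul_sum, ← E.d_incl_entry hu]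

/-- The map `g ⊗ h ↦ φ(g) dφ(h)` factors through the projection to one-forms, so that the universal
property of the envelope applies to it. -/
theorem mulMap_comulZero (hG : IsCompactMatrixQuantumGroup G) (t : G ⊗[ℂ] G) :
    mulMap E.comulZero.toLinearMap (E.squareD ∘ₗ E.comulZero.toLinearMap) t =
      LinearMap.mul' ℂ _ (TensorProduct.map E.comulZero.toLinearMap E.comulInv (R.oneForm t)) := by
  induction t with
  | zero => simp
  | add x y hx hy => simp only [map_add, hx, hy]
  | tmul g h =>
    have key : LinearMap.mulLeft ℂ (E.comulZero g) ∘ₗ E.squareD ∘ₗ E.comulZero.toLinearMap =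
        LinearMap.mul' ℂ _ ∘ₗ TensorProduct.map E.comulZero.toLinearMap E.comulInv ∘ₗ R.oneForm ∘ₗ
          TensorProduct.mk ℂ G G g := by
      refine hG.linearMap_ext fun ι _ _ u hu i j => ?_
      simp only [LinearMap.comp_apply, AlgHom.toLinearMap_apply, LinearMap.mulLeft_apply,
        E.squareD_comulZero_entry hu, TensorProduct.mk_apply,
        BicovariantCalculus.oneForm, LinearMap.lTensor_tmul, hu.comul, TensorProduct.tmul_sum,
        map_sum, LinearEquiv.coe_coe, TensorProduct.assoc_symm_tmul, TensorProduct.map_tmul,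
        LinearMap.mul'_apply, map_mul, mul_assoc]
    exact LinearMap.congr_fun key h

/-- The coproduct extends to a morphism of differential algebras on the envelope, with
`θ ↦ ad(θ) + 1 ⊗ θ` on left-invariant one-forms. -/
theorem exists_comul (hG : IsCompactMatrixQuantumGroup G) :
    ∃ F : W →ₐ[ℂ] ℬ ᵍ⊗[ℂ] ℬ, (∀ θ, F (E.invIncl θ) = E.comulInv θ) ∧
      ∀ θ, F (E.d (E.invIncl θ)) = E.squareD (E.comulInv θ) := by
  have hsq : ∀ t : G ⊗[ℂ] G, mulMap (E.squareD ∘ₗ E.comulZero.toLinearMap)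
      (E.squareD ∘ₗ E.comulZero.toLinearMap) t =
      E.squareD (mulMap E.comulZero.toLinearMap (E.squareD ∘ₗ E.comulZero.toLinearMap) t) := by
    intro t
    induction t with
    | zero => simp
    | add x y hx hy => simp only [map_add, hx, hy]
    | tmul g h => simp [mulMap, squareD_comulZero_mul, squareD_squareD]
  obtain ⟨F, hF, -⟩ := E.universal (ℬ ᵍ⊗[ℂ] ℬ) E.comulZero (E.squareD ∘ₗ E.comulZero.toLinearMap)
    (fun g h => by simp [squareD_comulZero_mul])
    (fun t ht => by
      have h1 := E.mulMap_comulZero hG t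
      rw [ht, map_zero, map_zero] at h1
      exact ⟨h1, by rw [hsq, h1, map_zero]⟩)
  have h1 : ∀ θ, F (E.invIncl θ) = E.comulInv θ := by
    have h : F.toLinearMap ∘ₗ E.invIncl = E.comulInv := by
      refine R.inv_linearMap_ext hG fun ι _ _ u hu i j => ?_
      simp only [LinearMap.comp_apply, AlgHom.toLinearMap_apply, E.invIncl_germ_entry hu, map_sum,
        map_mul, hF, E.squareD_comulZero_entry hu, Finset.mul_sum, ← mul_assoc]
      simp only [← map_mul]
      rw [Finset.sum_comm]
      simp only [← Finset.sum_mul, ← map_sum, hu.sum_antipode_mul]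
      simp
    exact fun θ => LinearMap.congr_fun h θ
  refine ⟨F, h1, fun θ => ?_⟩
  obtain ⟨g, rfl⟩ := R.germ_surjective θ
  rw [← h1, invIncl_germ, germForm, LinearMap.comp_apply, LinearMap.comp_apply]
  generalize (HopfAlgebra.antipode ℂ).rTensor G (Coalgebra.comul (R := ℂ) g) = t
  induction t with
  | zero => simp
  | add x y hx hy => simp only [map_add, hx, hy]
  | tmul x y =>
    simp [mulMap, hF, squareD_comulZero_mul, squareD_squareD, E.leibniz (E.incl_mem _), E.d_d]

/-! ### Embedded differentials in coordinates -/

namespace EmbeddedDifferential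

variable {E} (Δ : E.EmbeddedDifferential) {κ : Type*} [Fintype κ] (b : Module.Basis κ ℂ R.Inv)

/-- The coefficients of `δ(bᵢ)` in the basis `b_p ⊗ b_q`. -/
def coeff (i p q : κ) : ℂ := (b.tensorProduct b).repr (Δ.δ (b i)) (p, q)

theorem δ_basis (i : κ) : Δ.δ (b i) = ∑ p, ∑ q, Δ.coeff b i p q • (b p ⊗ₜ[ℂ] b q) := by
  rw [← (b.tensorProduct b).sum_repr (Δ.δ (b i)), Fintype.sum_prod_type]
  simp [coeff]

theorem covariant_basis {m : Matrix κ κ G} (hm : ∀ i, R.ad (b i) = ∑ j, b j ⊗ₜ[ℂ] m j i)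
    {A : Type*} [Ring A] [Algebra ℂ A] (σ τ : R.Inv →ₗ[ℂ] A) (i : κ) :
    ∑ c, LinearMap.mul' ℂ A (TensorProduct.map σ τ (Δ.δ (b c))) ⊗ₜ[ℂ] E.incl (m c i) =
      ∑ p, ∑ q, Δ.coeff b i p q • ∑ c, ∑ e,
        (σ (b c) * τ (b e)) ⊗ₜ[ℂ] (E.incl (m c p) * E.incl (m e q)) := by
  have h := congrArg (TensorProduct.map (LinearMap.mul' ℂ A ∘ₗ TensorProduct.map σ τ)
    E.incl.toLinearMap) (LinearMap.congr_fun Δ.covariant (b i))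
  simp only [LinearMap.comp_apply, hm, map_sum, LinearMap.rTensor_tmul, TensorProduct.map_tmul,
    AlgHom.toLinearMap_apply] at h
  rw [h, Δ.δ_basis]
  simp only [map_sum, map_smul, TensorProduct.map_tmul, hm, TensorProduct.sum_tmul,
    TensorProduct.tmul_sum, LinearEquiv.coe_coe, TensorProduct.tensorTensorTensorComm_tmul,
    LinearMap.lTensor_tmul, LinearMap.mul'_apply, LinearMap.comp_apply, AlgHom.toLinearMap_apply,
    map_mul]
  refine Finset.sum_congr rfl fun p _ => Finset.sum_congr rfl fun q _ => ?_
  rw [Finset.sum_comm]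

/-- The component of bidegree `(1, 1)` of the coproduct of `dθ = ∑ θ₁ θ₂`, for `θ = bᵢ`, and its
coefficient at `b_c` in the first factor. -/
theorem sum_coeff_commutator (hG : IsCompactMatrixQuantumGroup G) {m : Matrix κ κ G}
    (hm : ∀ i, R.ad (b i) = ∑ j, b j ⊗ₜ[ℂ] m j i) (c i : κ) :
    ∑ p, ∑ q, Δ.coeff b i p q •
      (E.incl (m c p) * E.invIncl (b q) - E.invIncl (b p) * E.incl (m c q)) =
      -E.d (E.incl (m c i)) := by
  obtain ⟨F, hF1, hF2⟩ := E.exists_comul hG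
  have hc : ∀ i, (GradedTensorProduct.of ℂ ℬ ℬ).symm (E.comulInv (b i)) =
      ∑ c, E.invIncl (b c) ⊗ₜ E.incl (m c i) + 1 ⊗ₜ E.invIncl (b i) := by
    intro i
    change TensorProduct.map E.invIncl E.incl.toLinearMap (R.ad (b i)) + _ = _
    simp [hm]
  have hl : ∀ i, E.d (E.invIncl (b i)) =
      ∑ p, ∑ q, Δ.coeff b i p q • (E.invIncl (b p) * E.invIncl (b q)) := by
    intro i
    rw [Δ.lift_d, Δ.δ_basis]
    simp
  have h1 : (GradedTensorProduct.of ℂ ℬ ℬ).symm (F (E.d (E.invIncl (b i)))) =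
      ∑ c, E.d (E.invIncl (b c)) ⊗ₜ E.incl (m c i) +
        ∑ c, E.invIncl (b c) ⊗ₜ (-E.d (E.incl (m c i))) + 1 ⊗ₜ E.d (E.invIncl (b i)) := by
    rw [hF2]
    change tensorD E.toStarDGA E.toStarDGA
      ((GradedTensorProduct.of ℂ ℬ ℬ).symm (E.comulInv (b i))) = _
    simp [hc, tensorD_tmul, gradeInv_of_mem (E.invIncl_mem _), E.toStarDGA.d_one,
      gradeInv_of_mem (SetLike.GradedOne.one_mem (A := ℬ)), Finset.sum_add_distrib,
      TensorProduct.neg_tmul, TensorProduct.tmul_neg]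
  have h2 : (GradedTensorProduct.of ℂ ℬ ℬ).symm (F (E.d (E.invIncl (b i)))) =
      ∑ p, ∑ q, Δ.coeff b i p q • gmul ℬ ℬ
        ((GradedTensorProduct.of ℂ ℬ ℬ).symm (E.comulInv (b p)))
        ((GradedTensorProduct.of ℂ ℬ ℬ).symm (E.comulInv (b q))) := by
    rw [hl]
    simp only [map_sum, map_smul, map_mul, hF1]
    rfl
  have h3 := Δ.covariant_basis b hm E.invIncl E.invIncl i
  simp only [← Δ.lift_d] at h3
  rw [h1] at h2
  simp only [hc, gmul_sum_add (fun c => E.invIncl_mem (b c)) (fun c => E.incl_mem (m c _))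
    (E.invIncl_mem _), smul_add, Finset.sum_add_distrib] at h2
  rw [h3, hl i] at h2
  simp only [TensorProduct.tmul_sum, TensorProduct.tmul_smul] at h2
  rw [add_left_inj, add_right_inj] at h2
  obtain ⟨L, hL⟩ := E.invIncl.exists_leftInverse_of_injective
    (LinearMap.ker_eq_bot.2 E.invIncl_injective)
  classical
  have h4 : ∀ c' (w : W), TensorProduct.lid ℂ W ((b.coord c ∘ₗ L).rTensor W
      (E.invIncl (b c') ⊗ₜ w)) = if c' = c then w else 0 := by
    intro c' w
    have : L (E.invIncl (b c')) = b c' := LinearMap.congr_fun hL (b c')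
    simp [this, Finsupp.single_apply]
  have h5 := congrArg (fun t => TensorProduct.lid ℂ W ((b.coord c ∘ₗ L).rTensor W t)) h2
  simp only [map_sum, map_smul, h4] at h5
  simpa using h5.symm

end EmbeddedDifferential

end Envelope

end EnvelopeForms

/-! ### Covariant families of forms on the total space -/

section CovariantFamilies

variable {G : Type u} [Ring G] [HopfAlgebra ℂ G] [StarRing G] [StarModule ℂ G]
  {R : BicovariantCalculus G} {W : Type u} [Ring W] [Algebra ℂ W]
  {ℬ : ℕ → Submodule ℂ W} [GradedAlgebra ℬ] {E : Envelope R ℬ}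
  {A : Type*} [Ring A] [Algebra ℂ A] {𝒜 : ℕ → Submodule ℂ A} [GradedAlgebra 𝒜]

namespace QuantumPrincipalBundle

variable (P : QuantumPrincipalBundle E 𝒜) {ι : Type*} [Fintype ι]

theorem psi_mul_eq_gmul (a b : A) : P.psi (a * b) = gmul 𝒜 ℬ (P.psi a) (P.psi b) := P.psi_mul a b

theorem psi_d (a : A) : P.psi (P.d a) = tensorD P.toStarDGA E.toStarDGA (P.psi a) := P.Ψ_d a

/-- A family of forms which transforms by the matrix `m`: `Ψ(aᵢ) = ∑ aⱼ ⊗ mⱼᵢ`. These are the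
families of values of morphisms to the horizontal forms on a basis. -/
def IsCovariant (m : Matrix ι ι G) (a : ι → A) : Prop :=
  ∀ i, P.psi (a i) = ∑ j, a j ⊗ₜ[ℂ] E.incl (m j i)

theorem mem_horMor_iff {V : Type*} [AddCommGroup V] [Module ℂ V] {α : V →ₗ[ℂ] V ⊗[ℂ] G}
    (b : Module.Basis ι ℂ V) {m : Matrix ι ι G} (hb : ∀ i, α (b i) = ∑ j, b j ⊗ₜ[ℂ] m j i)
    (τ : V →ₗ[ℂ] A) : τ ∈ P.horMor α ↔ P.IsCovariant m fun i => τ (b i) := by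
  have h : ∀ i, TensorProduct.map τ E.incl.toLinearMap (α (b i)) =
      ∑ j, τ (b j) ⊗ₜ[ℂ] E.incl (m j i) := fun i => by simp [hb]
  constructor
  · intro hτ i
    rw [← h]
    exact hτ (b i)
  · intro hτ
    have h2 : P.psi ∘ₗ τ = TensorProduct.map τ E.incl.toLinearMap ∘ₗ α := by
      refine b.ext fun i => ?_
      rw [LinearMap.comp_apply, LinearMap.comp_apply, h]
      exact hτ i
    exact fun v => LinearMap.congr_fun h2 v

variable {P} {m : Matrix ι ι G} {a : ι → A}

theorem IsCovariant.st (ha : P.IsCovariant m a) :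
    P.IsCovariant (m.map star) fun i => P.st (a i) := by
  intro i
  rw [psi_st, ha i]
  simp [E.st_incl]

theorem IsCovariant.horCoact (ha : P.IsCovariant m a) (i : ι) :
    P.horCoact (a i) = ∑ j, a j ⊗ₜ[ℂ] m j i := by
  rw [QuantumPrincipalBundle.horCoact, LinearMap.comp_apply, ha i]
  simp [E.toG_incl]

theorem IsCovariant.covK (ha : P.IsCovariant m a) {k : ℕ} (hk : ∀ i, a i ∈ 𝒜 k)
    (lam : R.Inv →ₗ[ℂ] A) (i : ι) :
    P.covK lam (a i) = -(-1 : ℂ) ^ k • ∑ j, a j * lam (R.germ (m j i)) := by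
  rw [QuantumPrincipalBundle.covK, LinearMap.neg_apply, LinearMap.comp_apply, LinearMap.comp_apply,
    ha.horCoact, neg_smul]
  simp [gradeInv_of_mem (hk _), Finset.smul_sum]

theorem IsCovariant.covK_mem (ha : P.IsCovariant m a) {k : ℕ} (hk : ∀ i, a i ∈ 𝒜 k)
    {lam : R.Inv →ₗ[ℂ] A} (hlam : ∀ θ, lam θ ∈ 𝒜 1) (i : ι) : P.covK lam (a i) ∈ 𝒜 (k + 1) := by
  rw [ha.covK hk]
  exact Submodule.smul_mem _ _ (Submodule.sum_mem _ fun j _ =>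
    SetLike.GradedMul.mul_mem (hk j) (hlam _))

theorem IsCovariant.covD_mem (ha : P.IsCovariant m a) {k : ℕ} (hk : ∀ i, a i ∈ 𝒜 k)
    {ω : R.Inv →ₗ[ℂ] A} (hω : ∀ θ, ω θ ∈ 𝒜 1) (i : ι) : P.covD ω (a i) ∈ 𝒜 (k + 1) :=
  Submodule.add_mem _ (P.d_mem (hk i)) (ha.covK_mem hk hω i)

theorem IsConnection.psi_germ_entry [DecidableEq ι] {ω : R.Inv →ₗ[ℂ] A} (hω : P.IsConnection ω)
    (hm : IsMatrixCorep m) (i j : ι) : P.psi (ω (R.germ (m i j))) =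
      ∑ c, ∑ e, ω (R.germ (m c e)) ⊗ₜ[ℂ] E.incl (HopfAlgebra.antipode ℂ (m i c) * m e j) +
        1 ⊗ₜ[ℂ] E.invIncl (R.germ (m i j)) := by
  rw [(hω _).2, BicovariantCalculus.ad_germ_entry hm]
  simp

theorem IsCovariant.psi_sum_mul [DecidableEq ι] (ha : P.IsCovariant m a) (hm : IsMatrixCorep m)
    {ω : R.Inv →ₗ[ℂ] A} (hω : P.IsConnection ω) (i : ι) :
    P.psi (∑ j, a j * ω (R.germ (m j i))) =
      ∑ l, (∑ j, a j * ω (R.germ (m j l))) ⊗ₜ[ℂ] E.incl (m l i) +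
        ∑ l, a l ⊗ₜ[ℂ] E.d (E.incl (m l i)) := by
  simp only [map_sum, psi_mul_eq_gmul, ha _, hω.psi_germ_entry hm, map_add, LinearMap.sum_apply,
    gmul_tmul_of_mem_zero_left _ (E.incl_mem _), mul_one, Finset.sum_add_distrib]
  congr 1
  · have h3 : ∀ p c e : ι, ∑ j, (a p * ω (R.germ (m c e))) ⊗ₜ[ℂ]
        (E.incl (m p j) * E.incl (HopfAlgebra.antipode ℂ (m j c) * m e i)) =
        if p = c then (a p * ω (R.germ (m c e))) ⊗ₜ[ℂ] E.incl (m e i) else 0 := by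
      intro p c e
      simp only [← TensorProduct.tmul_sum, ← map_mul, ← mul_assoc, ← map_sum, ← Finset.sum_mul,
        hm.sum_mul_antipode]
      split_ifs <;> simp
    have h4 : ∀ f : ι → ι → ι → ι → A ⊗[ℂ] W,
        ∑ j, ∑ c, ∑ e, ∑ p, f j c e p = ∑ e, ∑ p, ∑ c, ∑ j, f j c e p := by
      intro f
      calc ∑ j, ∑ c, ∑ e, ∑ p, f j c e p
          = ∑ j, ∑ e, ∑ p, ∑ c, f j c e p := by
            refine Finset.sum_congr rfl fun j _ => ?_
            rw [Finset.sum_comm]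
            exact Finset.sum_congr rfl fun c _ => Finset.sum_comm
        _ = ∑ e, ∑ p, ∑ j, ∑ c, f j c e p := by
            rw [Finset.sum_comm]
            exact Finset.sum_congr rfl fun e _ => Finset.sum_comm
        _ = _ := Finset.sum_congr rfl fun e _ => Finset.sum_congr rfl fun p _ => Finset.sum_comm
    rw [h4]
    simp only [h3, TensorProduct.sum_tmul]
    simp
  · rw [Finset.sum_comm]
    simp only [← TensorProduct.tmul_sum, ← E.d_incl_entry hm]

/-- The covariant derivative of a connection preserves covariance. -/
theorem IsCovariant.covD [DecidableEq ι] (ha : P.IsCovariant m a) (hm : IsMatrixCorep m) {k : ℕ}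
    (hk : ∀ i, a i ∈ 𝒜 k) {ω : R.Inv →ₗ[ℂ] A} (hω : P.IsConnection ω) :
    P.IsCovariant m fun i => P.covD ω (a i) := by
  intro i
  simp only [QuantumPrincipalBundle.covD, LinearMap.add_apply, ha.covK hk, neg_smul]
  rw [map_add, map_neg, map_smul, ha.psi_sum_mul hm hω, psi_d, ha i]
  simp only [map_sum, tensorD_tmul, gradeInv_of_mem (hk _), smul_add, TensorProduct.add_tmul,
    Finset.sum_add_distrib, Finset.smul_sum, TensorProduct.smul_tmul',
    Finset.sum_neg_distrib, TensorProduct.neg_tmul, TensorProduct.sum_tmul]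
  abel

theorem IsCovariant.dualOp_covD [DecidableEq ι]
    (hs : ∀ g : G, Coalgebra.comul (R := ℂ) (star g) = star (Coalgebra.comul (R := ℂ) g))
    (ha : P.IsCovariant m a) (hm : IsMatrixCorep m) {k : ℕ}
    (hk : ∀ i, a i ∈ 𝒜 k) {ω : R.Inv →ₗ[ℂ] A} (hω : P.IsConnection ω) :
    P.IsCovariant m fun i => P.dualOp (P.covD ω) (a i) := by
  have h := (ha.st.covD (hm.map_star hs) (fun i => P.st_mem (hk i)) hω).st
  have h2 : (m.map star).map star = m := by ext; simp
  rwa [h2] at h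

theorem IsCovariant.dualOp_covK
    (ha : P.IsCovariant m a) {k : ℕ} (hk : ∀ i, a i ∈ 𝒜 k) {lam : R.Inv →ₗ[ℂ] A}
    (hlam : ∀ θ, lam θ ∈ 𝒜 1) (i : ι) :
    P.dualOp (P.covK lam) (a i) = -∑ j, P.st (lam (R.germ (star (m j i)))) * a j := by
  have h := ha.st.covK (fun i => P.st_mem (hk i)) lam i
  change P.st (P.covK lam (P.st (a i))) = _
  simp only [h, map_smulₛₗ, map_sum, P.st_mul (P.st_mem (hk _)) (hlam _), P.st_st, Matrix.map_apply,
    mul_one, ← Finset.smul_sum, smul_smul]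
  simp only [map_neg, map_pow, map_one, neg_mul, ← mul_pow, neg_neg, mul_one, mul_neg, one_pow,
    neg_smul, one_smul]

theorem IsCovariant.dualOp_covD_mem (ha : P.IsCovariant m a) {k : ℕ} (hk : ∀ i, a i ∈ 𝒜 k)
    {ω : R.Inv →ₗ[ℂ] A} (hω : ∀ θ, ω θ ∈ 𝒜 1) (i : ι) :
    P.dualOp (P.covD ω) (a i) ∈ 𝒜 (k + 1) :=
  P.st_mem (ha.st.covD_mem (fun i => P.st_mem (hk i)) hω i)

theorem dualOp_covD_apply (ω : R.Inv →ₗ[ℂ] A) (a : A) :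
    P.dualOp (P.covD ω) a = P.d a + P.dualOp (P.covK ω) a := by
  simp [dualOp, QuantumPrincipalBundle.covD, P.st_d, P.st_st]

/-! ### Connections, displacements and curvature -/

theorem isDisplacement_zero : P.IsDisplacement 0 :=
  ⟨fun _ => Submodule.zero_mem _, Submodule.zero_mem _⟩

theorem IsConnection.add {ω lam : R.Inv →ₗ[ℂ] A} (hω : P.IsConnection ω)
    (h : P.IsDisplacement lam) : P.IsConnection (ω + lam) := by
  refine fun θ => ⟨Submodule.add_mem _ (hω θ).1 (h.1 θ), ?_⟩
  rw [LinearMap.add_apply, map_add, (hω θ).2, h.2 θ, TensorProduct.map_add_left,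
    LinearMap.add_apply]
  abel

theorem map_dual (f : R.Inv →ₗ[ℂ] A) (t : R.Inv ⊗[ℂ] G) :
    TensorProduct.map P.st E.st (TensorProduct.map f E.incl.toLinearMap
      (TensorProduct.map R.starInv (starLinearEquiv ℂ (A := G)).toLinearMap t)) =
    TensorProduct.map (P.dual f) E.incl.toLinearMap t := by
  induction t with
  | zero => simp
  | add x y hx hy => simp only [map_add, hx, hy]
  | tmul θ g => simp [E.st_incl, dual]

theorem dual_apply (f : R.Inv →ₗ[ℂ] A) (θ : R.Inv) : P.dual f θ = P.st (f (R.starInv θ)) := rfl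

theorem dual_dual (hG : IsCompactMatrixQuantumGroup G) (f : R.Inv →ₗ[ℂ] A) :
    P.dual (P.dual f) = f :=
  LinearMap.ext fun θ => by
    rw [dual_apply, dual_apply, P.st_st, BicovariantCalculus.starInv_starInv hG]

theorem dual_add (f g : R.Inv →ₗ[ℂ] A) : P.dual (f + g) = P.dual f + P.dual g :=
  LinearMap.ext fun θ => by simp [dual_apply]

theorem dual_smul (z : ℂ) (f : R.Inv →ₗ[ℂ] A) :
    P.dual (z • f) = starRingEnd ℂ z • P.dual f :=
  LinearMap.ext fun θ => by simp [dual_apply]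

theorem dual_mem_horMor (hG : IsCompactMatrixQuantumGroup G) {τ : R.Inv →ₗ[ℂ] A}
    (hτ : τ ∈ P.horMor R.ad) : P.dual τ ∈ P.horMor R.ad := by
  intro θ
  rw [dual_apply, psi_st, hτ, BicovariantCalculus.ad_starInv hG, map_dual]

theorem IsConnection.dual (hG : IsCompactMatrixQuantumGroup G) {ω : R.Inv →ₗ[ℂ] A}
    (hω : P.IsConnection ω) : P.IsConnection (P.dual ω) := by
  refine fun θ => ⟨P.st_mem (hω _).1, ?_⟩
  rw [dual_apply, psi_st, (hω _).2, BicovariantCalculus.ad_starInv hG, map_add, map_dual,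
    TensorProduct.map_tmul, P.toStarDGA.st_one, E.st_invIncl hG,
    BicovariantCalculus.starInv_starInv hG]

variable (Δ : E.EmbeddedDifferential) {κ : Type*} [Fintype κ] (b : Module.Basis κ ℂ R.Inv)

theorem bracket_basis (σ τ : R.Inv →ₗ[ℂ] A) (i : κ) : bracket Δ σ τ (b i) =
    ∑ p, ∑ q, Δ.coeff b i p q • (σ (b p) * τ (b q)) := by
  simp [bracket, Δ.δ_basis]

theorem bracket_mem_horMor {m : Matrix κ κ G} (hm : ∀ i, R.ad (b i) = ∑ j, b j ⊗ₜ[ℂ] m j i)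
    {σ τ : R.Inv →ₗ[ℂ] A} (hσ : σ ∈ P.horMor R.ad) (hτ : τ ∈ P.horMor R.ad) :
    bracket Δ σ τ ∈ P.horMor R.ad := by
  rw [mem_horMor_iff P b hm] at hσ hτ ⊢
  intro i
  have h : ∑ c, bracket Δ σ τ (b c) ⊗ₜ[ℂ] E.incl (m c i) = _ := Δ.covariant_basis b hm σ τ i
  change P.psi (bracket Δ σ τ (b i)) = ∑ c, bracket Δ σ τ (b c) ⊗ₜ[ℂ] E.incl (m c i)
  rw [h, bracket_basis]
  simp only [map_sum, map_smul, psi_mul_eq_gmul, hσ _, hτ _, LinearMap.sum_apply,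
    gmul_tmul_of_mem_zero_left _ (E.incl_mem _)]
  refine Finset.sum_congr rfl fun p _ => Finset.sum_congr rfl fun q _ => ?_
  rw [Finset.sum_comm]

/-- The curvature of a connection is a morphism to the horizontal forms. -/
theorem IsConnection.curvature_mem_horMor (hG : IsCompactMatrixQuantumGroup G)
    {m : Matrix κ κ G} (hm : ∀ i, R.ad (b i) = ∑ j, b j ⊗ₜ[ℂ] m j i)
    {ω : R.Inv →ₗ[ℂ] A} (hω : P.IsConnection ω) : P.curvature Δ ω ∈ P.horMor R.ad := by
  rw [mem_horMor_iff P b hm]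
  intro i
  have h1 : ∀ i, P.psi (ω (b i)) =
      ∑ c, ω (b c) ⊗ₜ[ℂ] E.incl (m c i) + 1 ⊗ₜ[ℂ] E.invIncl (b i) := by
    intro i
    rw [(hω _).2, hm]
    simp
  have hone : (1 : A) ∈ 𝒜 0 := SetLike.GradedOne.one_mem
  have h2 : P.psi (P.d (ω (b i))) = ∑ c, P.d (ω (b c)) ⊗ₜ[ℂ] E.incl (m c i) -
      ∑ c, ω (b c) ⊗ₜ[ℂ] E.d (E.incl (m c i)) + 1 ⊗ₜ[ℂ] E.d (E.invIncl (b i)) := by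
    rw [psi_d, h1]
    simp only [map_add, map_sum, tensorD_tmul, gradeInv_of_mem (hω _).1, gradeInv_of_mem hone,
      P.toStarDGA.d_one, pow_one, pow_zero, one_smul, neg_smul, TensorProduct.neg_tmul,
      TensorProduct.zero_tmul, zero_add, Finset.sum_add_distrib, Finset.sum_neg_distrib,
      sub_eq_add_neg]
  have h3 : P.psi (bracket Δ ω ω (b i)) =
      ∑ c, bracket Δ ω ω (b c) ⊗ₜ[ℂ] E.incl (m c i) -
      ∑ c, ω (b c) ⊗ₜ[ℂ] E.d (E.incl (m c i)) + 1 ⊗ₜ[ℂ] E.d (E.invIncl (b i)) := by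
    have h4 : ∀ c, -E.d (E.incl (m c i)) = _ := fun c => (Δ.sum_coeff_commutator b hG hm c i).symm
    have h5 : E.d (E.invIncl (b i)) =
        ∑ p, ∑ q, Δ.coeff b i p q • (E.invIncl (b p) * E.invIncl (b q)) := by
      rw [Δ.lift_d, Δ.δ_basis]
      simp
    have h6 : ∑ c, bracket Δ ω ω (b c) ⊗ₜ[ℂ] E.incl (m c i) = _ := Δ.covariant_basis b hm ω ω i
    rw [sub_eq_add_neg, ← Finset.sum_neg_distrib]
    simp only [← TensorProduct.tmul_neg, h4, h5, h6]
    rw [bracket_basis]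
    simp only [map_sum, map_smul, psi_mul_eq_gmul, h1, gmul_sum_add (fun c => (hω (b c)).1)
      (fun c => E.incl_mem (m c _)) (E.invIncl_mem _), TensorProduct.tmul_sum,
      TensorProduct.tmul_smul, smul_add, Finset.sum_add_distrib]
    congr 2
    have h7 : ∀ f : κ → κ → κ → A ⊗[ℂ] W, ∑ c, ∑ p, ∑ q, f c p q = ∑ p, ∑ q, ∑ c, f c p q := by
      intro f
      rw [Finset.sum_comm]
      exact Finset.sum_congr rfl fun p _ => Finset.sum_comm
    rw [h7]
    simp only [Finset.smul_sum]
  simp only [curvature, LinearMap.sub_apply, LinearMap.comp_apply, map_sub, h2, h3,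
    TensorProduct.sub_tmul, Finset.sum_sub_distrib]
  abel

/-- The first variation of the curvature along a displacement. -/
theorem IsDisplacement.covD_comp_sub_opS {ω lam : R.Inv →ₗ[ℂ] A} (h : P.IsDisplacement lam) :
    P.covD ω ∘ₗ lam - opS 𝒜 Δ ω lam = P.d ∘ₗ lam - bracket Δ ω lam - bracket Δ lam ω := by
  have h1 : gradeInv 𝒜 ∘ₗ lam = -lam := LinearMap.ext fun θ => by
    simp [gradeInv_of_mem (h.1 θ)]
  have h2 : P.horCoact ∘ₗ lam = TensorProduct.map lam LinearMap.id ∘ₗ R.ad := by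
    refine LinearMap.ext fun θ => ?_
    simp only [LinearMap.comp_apply, horCoact, h.2 θ]
    generalize R.ad θ = t
    induction t with
    | zero => simp
    | add x y hx hy => simp only [map_add, hx, hy]
    | tmul x y => simp [E.toG_incl]
  have h3 : P.covK ω ∘ₗ lam = commBracket lam ω := by
    have h4 : P.covK ω ∘ₗ lam = -(LinearMap.mul' ℂ A ∘ₗ
      TensorProduct.map (gradeInv 𝒜) (ω ∘ₗ R.germ) ∘ₗ (P.horCoact ∘ₗ lam)) := rfl
    rw [h4, h2, ← LinearMap.comp_assoc R.ad, ← TensorProduct.map_comp, h1, LinearMap.comp_id]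
    refine LinearMap.ext fun θ => ?_
    simp only [LinearMap.comp_apply, LinearMap.neg_apply, commBracket,
      BicovariantCalculus.transposedCommutator]
    generalize R.ad θ = t
    induction t with
    | zero => simp
    | add x y hx hy => simp only [map_add, neg_add, hx, hy]
    | tmul x y => simp
  have hneg : ∀ f : R.Inv →ₗ[ℂ] A, TensorProduct.map (-lam) f = -TensorProduct.map lam f :=
    fun f => TensorProduct.ext' fun x y => by simp [TensorProduct.neg_tmul]
  have h5 : ∀ f : R.Inv →ₗ[ℂ] A, bracket Δ (-lam) f = -bracket Δ lam f := fun f => by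
    simp only [bracket, hneg, LinearMap.neg_comp, LinearMap.comp_neg]
  have h6 : commBracket (-lam) ω = -commBracket lam ω := by
    simp only [commBracket, hneg, LinearMap.neg_comp, LinearMap.comp_neg]
  rw [covD, LinearMap.add_comp, h3, opS, h1, h5, h6]
  abel

theorem curvature_add_smul (ω lam : R.Inv →ₗ[ℂ] A) (z : ℂ) :
    P.curvature Δ (ω + z • lam) = P.curvature Δ ω +
      z • (P.d ∘ₗ lam - bracket Δ ω lam - bracket Δ lam ω) - (z * z) • bracket Δ lam lam := by
  simp only [curvature, bracket, TensorProduct.map_add_left, TensorProduct.map_add_right,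
    TensorProduct.map_smul_left, TensorProduct.map_smul_right, LinearMap.comp_add,
    LinearMap.add_comp, LinearMap.comp_smul, LinearMap.smul_comp]
  module

end QuantumPrincipalBundle

end CovariantFamilies

/-! ### Frames and bundle-valued forms -/

section Frames

variable {G : Type u} [Ring G] [HopfAlgebra ℂ G] [StarRing G] [StarModule ℂ G]
  {R : BicovariantCalculus G} {W : Type u} [Ring W] [Algebra ℂ W]
  {ℬ : ℕ → Submodule ℂ W} [GradedAlgebra ℬ] {E : Envelope R ℬ}
  {A : Type*} [Ring A] [Algebra ℂ A] {𝒜 : ℕ → Submodule ℂ A} [GradedAlgebra 𝒜]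

theorem IsCorep.isMatrixCorep {V : Type*} [AddCommGroup V] [Module ℂ V] {α : V →ₗ[ℂ] V ⊗[ℂ] G}
    (hα : IsCorep α) {κ : Type*} [Fintype κ] [DecidableEq κ] (e : Module.Basis κ ℂ V)
    {m : Matrix κ κ G} (hm : ∀ i, α (e i) = ∑ j, e j ⊗ₜ[ℂ] m j i) : IsMatrixCorep m where
  comul i j := by
    have h := congrArg (fun t => TensorProduct.lid ℂ _ ((e.coord i).rTensor _ t))
      (hα.coassoc (e j))
    simp [hm, TensorProduct.sum_tmul, Finsupp.single_apply] at h
    rw [← h]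
  counit i j := by
    have h := congrArg (e.coord i) (hα.counit (e j))
    simp [hm, Finsupp.single_apply] at h
    rw [h]
    simp only [eq_comm]

namespace QuantumPrincipalBundle

variable {P : QuantumPrincipalBundle E 𝒜} {κ : Type*} [Fintype κ] [DecidableEq κ]

theorem IsCovariant.sum_mul_st_mem {m : Matrix κ κ G} (hm : m ∈ unitary (Matrix κ κ G))
    {a c : κ → A} (ha : P.IsCovariant m a) (hc : P.IsCovariant m c) :
    ∑ k, a k * P.st (c k) ∈ P.baseForms := by
  have key : ∀ k, P.psi (a k * P.st (c k)) = ∑ i, ∑ j,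
      (a i * P.st (c j)) ⊗ₜ[ℂ] E.incl (m i k * star (m j k)) := by
    intro k
    rw [psi_mul_eq_gmul, psi_st, ha k, hc k]
    simp only [map_sum, TensorProduct.map_tmul, E.st_incl, LinearMap.sum_apply,
      gmul_tmul_of_mem_zero_left _ (E.incl_mem _), map_mul]
    exact Finset.sum_comm
  rw [mem_baseForms, map_sum]
  simp only [key]
  rw [Finset.sum_comm]
  simp only [TensorProduct.sum_tmul]
  refine Finset.sum_congr rfl fun i _ => ?_
  rw [Finset.sum_comm]
  have h1 : ∀ j, ∑ k, (a i * P.st (c j)) ⊗ₜ[ℂ] E.incl (m i k * star (m j k)) =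
      (a i * P.st (c j)) ⊗ₜ[ℂ] E.incl ((1 : Matrix κ κ G) i j) := by
    intro j
    rw [← TensorProduct.tmul_sum, ← map_sum, ← Unitary.mul_star_self_of_mem hm]
    simp [Matrix.mul_apply, Matrix.star_apply]
  simp only [h1, Matrix.one_apply]
  rw [Finset.sum_eq_single i]
  · simp
  · intro j _ hj
    simp [hj.symm]
  · simp

theorem IsCovariant.sum_st_mul_mem {m : Matrix κ κ G} (hm : m.map star ∈ unitary (Matrix κ κ G))
    {a c : κ → A} (ha : P.IsCovariant m a) (hc : P.IsCovariant m c) :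
    ∑ k, P.st (a k) * c k ∈ P.baseForms := by
  simpa [P.st_st] using ha.st.sum_mul_st_mem hm hc.st

variable {V : Type*} [AddCommGroup V] [Module ℂ V] {α : V →ₗ[ℂ] V ⊗[ℂ] G}

theorem isCovariant_of_mem_horMor (b : UnitaryBasis α κ) {τ : V →ₗ[ℂ] A} (hτ : τ ∈ P.horMor α) :
    P.IsCovariant b.mat fun i => τ (b.e i) :=
  (P.mem_horMor_iff b.e b.coact τ).1 hτ

theorem isCovariant_of_mem_horMor_conj (b : ConjUnitaryBasis α κ) {τ : V →ₗ[ℂ] A}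
    (hτ : τ ∈ P.horMor α) : P.IsCovariant b.mat fun i => τ (b.e i) :=
  (P.mem_horMor_iff b.e b.coact τ).1 hτ

/-- The coefficient `∑ τ(e_k) T(e_k)*` of a horizontal morphism with respect to a section. -/
def coeffL (b : UnitaryBasis α κ) (τ : P.horMor α) (T : P.sections α) : P.baseForms :=
  ⟨∑ k, τ.1 (b.e k) * P.st (T.1 (b.e k)), (isCovariant_of_mem_horMor b τ.2).sum_mul_st_mem b.unitary
    (isCovariant_of_mem_horMor b T.2.1)⟩

/-- The coefficient `∑ T(e_k)* τ(e_k)` of a horizontal morphism with respect to a section. -/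
def coeffR (b : ConjUnitaryBasis α κ) (T : P.sections α) (τ : P.horMor α) : P.baseForms :=
  ⟨∑ k, P.st (T.1 (b.e k)) * τ.1 (b.e k), (isCovariant_of_mem_horMor_conj b T.2.1).sum_st_mul_mem
    b.unitary (isCovariant_of_mem_horMor_conj b τ.2)⟩

theorem coeffL_mem (b : UnitaryBasis α κ) (τ : P.horMor α) (T : P.sections α) {k : ℕ}
    (hk : ∀ v, τ.1 v ∈ 𝒜 k) : (coeffL b τ T : A) ∈ 𝒜 k :=
  Submodule.sum_mem _ fun _ _ => SetLike.GradedMul.mul_mem (hk _) (P.st_mem (T.2.2 _))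

theorem coeffR_mem (b : ConjUnitaryBasis α κ) (T : P.sections α) (τ : P.horMor α) {k : ℕ}
    (hk : ∀ v, τ.1 v ∈ 𝒜 k) : (coeffR b T τ : A) ∈ 𝒜 k :=
  Submodule.sum_mem _ fun _ _ => by
    simpa using SetLike.GradedMul.mul_mem (P.st_mem (T.2.2 _)) (hk _)

variable (P) in
/-- A frame of the left bundle: sections `T_k` with `∑ T_k(eᵢ)* T_k(eⱼ) = δᵢⱼ`. -/
def IsFrameL (b : UnitaryBasis α κ) {N : ℕ} (T : Fin N → P.sections α) : Prop :=
  ∀ i j, ∑ k, P.st ((T k).1 (b.e i)) * (T k).1 (b.e j) = if i = j then 1 else 0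

variable (P) in
/-- A frame of the right bundle: sections `T_k` with `∑ T_k(eᵢ) T_k(eⱼ)* = δᵢⱼ`. -/
def IsFrameR (b : ConjUnitaryBasis α κ) {N : ℕ} (T : Fin N → P.sections α) : Prop :=
  ∀ i j, ∑ k, (T k).1 (b.e i) * P.st ((T k).1 (b.e j)) = if i = j then 1 else 0

theorem IsFrameL.sum_coeff_mul {b : UnitaryBasis α κ} {N : ℕ} {T : Fin N → P.sections α}
    (hT : P.IsFrameL b T) (τ : P.horMor α) (v : V) :
    ∑ k, (coeffL b τ (T k) : A) * (T k).1 v = τ.1 v := by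
  have h : ∑ k, LinearMap.mulLeft ℂ (coeffL b τ (T k) : A) ∘ₗ (T k).1 = τ.1 := by
    refine b.e.ext fun j => ?_
    simp only [LinearMap.sum_apply, LinearMap.comp_apply, LinearMap.mulLeft_apply, coeffL,
      Finset.sum_mul, mul_assoc]
    rw [Finset.sum_comm]
    simp only [← Finset.mul_sum, hT _ j]
    simp
  simpa using LinearMap.congr_fun h v

theorem IsFrameR.sum_mul_coeff {b : ConjUnitaryBasis α κ} {N : ℕ} {T : Fin N → P.sections α}
    (hT : P.IsFrameR b T) (τ : P.horMor α) (v : V) :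
    ∑ k, (T k).1 v * (coeffR b (T k) τ : A) = τ.1 v := by
  have h : ∑ k, LinearMap.mulRight ℂ (coeffR b (T k) τ : A) ∘ₗ (T k).1 = τ.1 := by
    refine b.e.ext fun j => ?_
    simp only [LinearMap.sum_apply, LinearMap.comp_apply, LinearMap.mulRight_apply, coeffR,
      Finset.mul_sum, ← mul_assoc]
    rw [Finset.sum_comm]
    simp only [← Finset.sum_mul, hT j _]
    simp
  simpa using LinearMap.congr_fun h v

/-- The sections `v̄ ↦ T_k(v)*` form a frame of the right bundle of the conjugate
corepresentation. -/
theorem exists_isFrameR_conj {b : UnitaryBasis α κ} (h : P.HasFrame b) :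
    ∃ (N : ℕ) (T : Fin N → P.sections (conjCorep α)), P.IsFrameR b.conj T := by
  obtain ⟨N, T, hT⟩ := h
  refine ⟨N, fun k => ⟨P.st.comp ((T k).1.comp ofConj), ?_, fun v => P.st_mem ((T k).2.2 _)⟩, ?_⟩
  · rw [P.mem_horMor_iff b.conj.e b.conj.coact]
    intro i
    have h1 : ∀ i, ofConj (b.conj.e i) = b.e i := fun i => by
      change ofConj (conjBasis b.e i) = _
      rw [conjBasis_apply]
      rfl
    simp only [LinearMap.comp_apply, h1]
    exact (isCovariant_of_mem_horMor b (T k).2.1).st i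
  · intro i j
    have h1 : ∀ i, ofConj (b.conj.e i) = b.e i := fun i => by
      change ofConj (conjBasis b.e i) = _
      rw [conjBasis_apply]
      rfl
    simpa [h1, P.st_st] using hT i j

/-- The sections `θ ↦ T_k(θ*)*` form a frame of the right adjoint bundle. -/
theorem exists_isFrameR_ad (hG : IsCompactMatrixQuantumGroup G) {b : UnitaryBasis R.ad κ}
    (h : P.HasFrame b) :
    ∃ (b' : ConjUnitaryBasis R.ad κ) (N : ℕ) (T : Fin N → P.sections R.ad), P.IsFrameR b' T := by
  obtain ⟨N, T, hT⟩ := h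
  have hstar := BicovariantCalculus.starInv_starInv (R := R) hG
  let S : Conj R.Inv ≃ₗ[ℂ] R.Inv := LinearEquiv.ofLinearMap (R.starInv.comp ofConj)
    (toConj.comp R.starInv) (LinearMap.ext fun θ => hstar θ) (LinearMap.ext fun θ => hstar θ)
  have he : ∀ i, ((conjBasis b.e).map S) i = R.starInv (b.e i) := fun i => by
    rw [Module.Basis.map_apply, conjBasis_apply]
    rfl
  let b' : ConjUnitaryBasis R.ad κ :=
    { e := (conjBasis b.e).map S
      mat := b.mat.map star
      coact := fun i => by
        simp only [he, BicovariantCalculus.ad_starInv hG, b.coact, map_sum]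
        rfl
      unitary := by
        have : (b.mat.map star).map star = b.mat := by ext; simp
        rw [this]
        exact b.unitary }
  refine ⟨b', N, fun k => ⟨P.dual (T k).1, dual_mem_horMor hG (T k).2.1,
    fun θ => P.st_mem ((T k).2.2 _)⟩, fun i j => ?_⟩
  have h1 : ∀ i, b'.e i = R.starInv (b.e i) := he
  simpa [h1, dual_apply, hstar, P.st_st] using hT i j

end QuantumPrincipalBundle

end Frames

section BundleForms

variable {G : Type u} [Ring G] [HopfAlgebra ℂ G] [StarRing G] [StarModule ℂ G]
  {R : BicovariantCalculus G} {W : Type u} [Ring W] [Algebra ℂ W]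
  {ℬ : ℕ → Submodule ℂ W} [GradedAlgebra ℬ] {E : Envelope R ℬ}
  {A : Type*} [Ring A] [Algebra ℂ A] {𝒜 : ℕ → Submodule ℂ A} [GradedAlgebra 𝒜]
  {B : Type*} [CStarAlgebra B] [PartialOrder B] [StarOrderedRing B]
  {P : QuantumPrincipalBundle E 𝒜} {M : StarSubalgebra ℂ B}
  {V : Type*} [AddCommGroup V] [Module ℂ V] {α : V →ₗ[ℂ] V ⊗[ℂ] G}
  {κ : Type*} [Fintype κ] [DecidableEq κ]

namespace BaseGeometry

open QuantumPrincipalBundle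

variable (Γ : BaseGeometry P M)

/-- The class of `μ ⊗ T`. -/
def mkL (μ : P.baseForms) (T : P.sections α) : Γ.FormsL α := (Γ.relL α).mkQ (μ ⊗ₜ[ℂ] T)

/-- The class of `T ⊗ μ`. -/
def mkR (T : P.sections α) (μ : P.baseForms) : Γ.FormsR α := (Γ.relR α).mkQ (T ⊗ₜ[ℂ] μ)

theorem formsL_induction {p : Γ.FormsL α → Prop} (zero : p 0) (mk : ∀ μ T, p (Γ.mkL μ T))
    (add : ∀ x y, p x → p y → p (x + y)) (x : Γ.FormsL α) : p x := by
  obtain ⟨t, rfl⟩ := (Γ.relL α).mkQ_surjective x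
  induction t with
  | zero => simpa using zero
  | add x y hx hy => rw [map_add]; exact add _ _ hx hy
  | tmul μ T => exact mk μ T

theorem formsR_induction {p : Γ.FormsR α → Prop} (zero : p 0) (mk : ∀ T μ, p (Γ.mkR T μ))
    (add : ∀ x y, p x → p y → p (x + y)) (x : Γ.FormsR α) : p x := by
  obtain ⟨t, rfl⟩ := (Γ.relR α).mkQ_surjective x
  induction t with
  | zero => simpa using zero
  | add x y hx hy => rw [map_add]; exact add _ _ hx hy
  | tmul T μ => exact mk T μ

theorem mkL_add_left (μ ν : P.baseForms) (T : P.sections α) :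
    Γ.mkL (μ + ν) T = Γ.mkL μ T + Γ.mkL ν T := by
  simp [mkL, TensorProduct.add_tmul]

theorem mkL_zero_left (T : P.sections α) : Γ.mkL 0 T = 0 := by
  simp [mkL]

theorem mkL_sum_right {ι : Type*} (s : Finset ι) (μ : P.baseForms) (T : ι → P.sections α) :
    Γ.mkL μ (∑ k ∈ s, T k) = ∑ k ∈ s, Γ.mkL μ (T k) := by
  simp only [mkL, TensorProduct.tmul_sum, map_sum]

theorem mkL_mul_inc (μ : P.baseForms) (p : M) (T : P.sections α) :
    Γ.mkL (μ * Γ.inc p) T = Γ.mkL μ (Γ.smulL p T) := by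
  rw [mkL, mkL, ← sub_eq_zero, ← map_sub, Submodule.mkQ_apply, Submodule.Quotient.mk_eq_zero]
  exact Submodule.subset_span ⟨μ, p, T, rfl⟩

theorem mkR_add_right (T : P.sections α) (μ ν : P.baseForms) :
    Γ.mkR T (μ + ν) = Γ.mkR T μ + Γ.mkR T ν := by
  simp [mkR, TensorProduct.tmul_add]

theorem mkR_zero_right (T : P.sections α) : Γ.mkR T 0 = 0 := by
  simp [mkR]

theorem mkR_sum_left {ι : Type*} (s : Finset ι) (T : ι → P.sections α) (μ : P.baseForms) :
    Γ.mkR (∑ k ∈ s, T k) μ = ∑ k ∈ s, Γ.mkR (T k) μ := by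
  simp only [mkR, TensorProduct.sum_tmul, map_sum]

theorem mkR_inc_mul (T : P.sections α) (p : M) (μ : P.baseForms) :
    Γ.mkR T (Γ.inc p * μ) = Γ.mkR (Γ.smulR T p) μ := by
  rw [mkR, mkR, eq_comm, ← sub_eq_zero, ← map_sub, Submodule.mkQ_apply,
    Submodule.Quotient.mk_eq_zero]
  exact Submodule.subset_span ⟨T, p, μ, rfl⟩

theorem mulFormL_mkL (μ : P.baseForms) (T : P.sections α) (v : V) :
    Γ.mulFormL (Γ.mkL μ T) v = (μ : A) * T.1 v := by
  rfl

theorem mulFormR_mkR (T : P.sections α) (μ : P.baseForms) (v : V) :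
    Γ.mulFormR (Γ.mkR T μ) v = T.1 v * (μ : A) := by
  rfl

theorem mulFormL_mem_horMor (x : Γ.FormsL α) : Γ.mulFormL x ∈ P.horMor α := by
  induction x using Γ.formsL_induction with
  | zero => rw [map_zero]; exact Submodule.zero_mem _
  | add x y hx hy => rw [map_add]; exact Submodule.add_mem _ hx hy
  | mk μ T =>
    have h : Γ.mulFormL (Γ.mkL μ T) = LinearMap.mulLeft ℂ (μ : A) ∘ₗ T.1 :=
      LinearMap.ext fun v => Γ.mulFormL_mkL μ T v
    rw [h]
    exact P.mul_mem_horMor μ.2 T.2.1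

theorem mulFormR_mem_horMor (x : Γ.FormsR α) : Γ.mulFormR x ∈ P.horMor α := by
  induction x using Γ.formsR_induction with
  | zero => rw [map_zero]; exact Submodule.zero_mem _
  | add x y hx hy => rw [map_add]; exact Submodule.add_mem _ hx hy
  | mk T μ =>
    have h : Γ.mulFormR (Γ.mkR T μ) = LinearMap.mulRight ℂ (μ : A) ∘ₗ T.1 :=
      LinearMap.ext fun v => Γ.mulFormR_mkR T μ v
    rw [h]
    exact P.mem_horMor_mul μ.2 T.2.1

theorem inc_toBase {x : P.baseForms} (hx : (x : A) ∈ 𝒜 0) : Γ.inc (Γ.toBase x) = x :=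
  Function.invFun_eq ((Γ.mem_zero_iff x).1 hx)

theorem toBase_inc (p : M) : Γ.toBase (Γ.inc p) = p :=
  Function.leftInverse_invFun Γ.inc_injective p

theorem coeffL_section_mem (b : UnitaryBasis α κ) (S T : P.sections α) :
    (coeffL b ⟨S.1, S.2.1⟩ T : A) ∈ 𝒜 0 := coeffL_mem b _ T S.2.2

theorem coeffR_section_mem (b : ConjUnitaryBasis α κ) (T S : P.sections α) :
    (coeffR b T ⟨S.1, S.2.1⟩ : A) ∈ 𝒜 0 := coeffR_mem b T _ S.2.2

/-- The expansion of a section in a frame. -/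
theorem sum_smulL_frame {b : UnitaryBasis α κ} {N : ℕ} {T : Fin N → P.sections α}
    (hT : P.IsFrameL b T) (S : P.sections α) :
    ∑ k, Γ.smulL (Γ.toBase (P.hermitianL b S (T k))) (T k) = S := by
  ext v
  rw [← hT.sum_coeff_mul ⟨S.1, S.2.1⟩ v]
  simp only [AddSubmonoidClass.coe_finsetSum, LinearMap.sum_apply]
  refine Finset.sum_congr rfl fun k _ => ?_
  change (Γ.inc (Γ.toBase (coeffL b ⟨S.1, S.2.1⟩ (T k))) : A) * (T k).1 v = _
  rw [Γ.inc_toBase (coeffL_section_mem b S (T k))]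

theorem sum_smulR_frame {b : ConjUnitaryBasis α κ} {N : ℕ} {T : Fin N → P.sections α}
    (hT : P.IsFrameR b T) (S : P.sections α) :
    ∑ k, Γ.smulR (T k) (Γ.toBase (P.hermitianR b (T k) S)) = S := by
  ext v
  rw [← hT.sum_mul_coeff ⟨S.1, S.2.1⟩ v]
  simp only [AddSubmonoidClass.coe_finsetSum, LinearMap.sum_apply]
  refine Finset.sum_congr rfl fun k _ => ?_
  change (T k).1 v * (Γ.inc (Γ.toBase (coeffR b (T k) ⟨S.1, S.2.1⟩)) : A) = _
  rw [Γ.inc_toBase (coeffR_section_mem b (T k) S)]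

/-- The expansion of a left bundle-valued form in a frame. -/
theorem sum_mkL_frame {b : UnitaryBasis α κ} {N : ℕ} {T : Fin N → P.sections α}
    (hT : P.IsFrameL b T) (x : Γ.FormsL α) :
    ∑ k, Γ.mkL (coeffL b ⟨Γ.mulFormL x, Γ.mulFormL_mem_horMor x⟩ (T k)) (T k) = x := by
  induction x using Γ.formsL_induction with
  | zero =>
    refine Finset.sum_eq_zero fun k _ => ?_
    have h : coeffL b ⟨Γ.mulFormL 0, Γ.mulFormL_mem_horMor 0⟩ (T k) = 0 := by
      ext
      simp [coeffL]
    rw [h, mkL_zero_left]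
  | add x y hx hy =>
    have h : ∀ k, coeffL b ⟨Γ.mulFormL (x + y), Γ.mulFormL_mem_horMor (x + y)⟩ (T k) =
        coeffL b ⟨Γ.mulFormL x, Γ.mulFormL_mem_horMor x⟩ (T k) +
          coeffL b ⟨Γ.mulFormL y, Γ.mulFormL_mem_horMor y⟩ (T k) := fun k => by
      ext
      simp [coeffL, add_mul, Finset.sum_add_distrib]
    simp only [h, mkL_add_left, Finset.sum_add_distrib, hx, hy]
  | mk μ S =>
    have h : ∀ k, coeffL b ⟨Γ.mulFormL (Γ.mkL μ S), Γ.mulFormL_mem_horMor _⟩ (T k) =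
        μ * Γ.inc (Γ.toBase (P.hermitianL b S (T k))) := fun k => by
      have h1 : Γ.inc (Γ.toBase (P.hermitianL b S (T k))) = coeffL b ⟨S.1, S.2.1⟩ (T k) :=
        Γ.inc_toBase (coeffL_section_mem b S (T k))
      rw [h1]
      ext
      simp [coeffL, mulFormL_mkL, Finset.mul_sum, mul_assoc]
    simp only [h, mkL_mul_inc]
    rw [← mkL_sum_right, Γ.sum_smulL_frame hT]

/-- The expansion of a right bundle-valued form in a frame. -/
theorem sum_mkR_frame {b : ConjUnitaryBasis α κ} {N : ℕ} {T : Fin N → P.sections α}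
    (hT : P.IsFrameR b T) (x : Γ.FormsR α) :
    ∑ k, Γ.mkR (T k) (coeffR b (T k) ⟨Γ.mulFormR x, Γ.mulFormR_mem_horMor x⟩) = x := by
  induction x using Γ.formsR_induction with
  | zero =>
    refine Finset.sum_eq_zero fun k _ => ?_
    have h : coeffR b (T k) ⟨Γ.mulFormR 0, Γ.mulFormR_mem_horMor 0⟩ = 0 := by
      ext
      simp [coeffR]
    rw [h, mkR_zero_right]
  | add x y hx hy =>
    have h : ∀ k, coeffR b (T k) ⟨Γ.mulFormR (x + y), Γ.mulFormR_mem_horMor (x + y)⟩ =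
        coeffR b (T k) ⟨Γ.mulFormR x, Γ.mulFormR_mem_horMor x⟩ +
          coeffR b (T k) ⟨Γ.mulFormR y, Γ.mulFormR_mem_horMor y⟩ := fun k => by
      ext
      simp [coeffR, mul_add, Finset.sum_add_distrib]
    simp only [h, mkR_add_right, Finset.sum_add_distrib, hx, hy]
  | mk S μ =>
    have h : ∀ k, coeffR b (T k) ⟨Γ.mulFormR (Γ.mkR S μ), Γ.mulFormR_mem_horMor _⟩ =
        Γ.inc (Γ.toBase (P.hermitianR b (T k) S)) * μ := fun k => by
      have h1 : Γ.inc (Γ.toBase (P.hermitianR b (T k) S)) = coeffR b (T k) ⟨S.1, S.2.1⟩ :=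
        Γ.inc_toBase (coeffR_section_mem b (T k) S)
      rw [h1]
      ext
      simp [coeffR, mulFormR_mkR, Finset.sum_mul, mul_assoc]
    simp only [h, mkR_inc_mul]
    rw [← mkR_sum_left, Γ.sum_smulR_frame hT]

section Left

variable {b : UnitaryBasis α κ} {N : ℕ} {T : Fin N → P.sections α}

theorem mulFormL_injective (hT : P.IsFrameL b T) : Function.Injective (Γ.mulFormL (α := α)) := by
  intro x y h
  rw [← Γ.sum_mkL_frame hT x, ← Γ.sum_mkL_frame hT y]
  simp only [h]

theorem mulFormL_sum_coeff (hT : P.IsFrameL b T) (τ : P.horMor α) :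
    Γ.mulFormL (∑ k, Γ.mkL (coeffL b τ (T k)) (T k)) = τ.1 := by
  ext v
  rw [← hT.sum_coeff_mul τ v]
  simp [mulFormL_mkL]

theorem upsilonL_eq_sum (hT : P.IsFrameL b T) (τ : P.horMor α) :
    Γ.upsilonL τ.1 = ∑ k, Γ.mkL (coeffL b τ (T k)) (T k) := by
  rw [← Γ.mulFormL_sum_coeff hT τ]
  exact Function.leftInverse_invFun (Γ.mulFormL_injective hT) _

theorem mulFormL_upsilonL (hT : P.IsFrameL b T) {τ : V →ₗ[ℂ] A} (hτ : τ ∈ P.horMor α) :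
    Γ.mulFormL (Γ.upsilonL τ : Γ.FormsL α) = τ := by
  rw [Γ.upsilonL_eq_sum hT ⟨τ, hτ⟩, Γ.mulFormL_sum_coeff hT]

theorem upsilonL_add (hT : P.IsFrameL b T) {σ τ : V →ₗ[ℂ] A} (hσ : σ ∈ P.horMor α)
    (hτ : τ ∈ P.horMor α) :
    (Γ.upsilonL (σ + τ) : Γ.FormsL α) = Γ.upsilonL σ + Γ.upsilonL τ := by
  apply Γ.mulFormL_injective hT
  rw [map_add, Γ.mulFormL_upsilonL hT hσ, Γ.mulFormL_upsilonL hT hτ,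
    Γ.mulFormL_upsilonL hT (Submodule.add_mem _ hσ hτ)]

theorem upsilonL_smul (hT : P.IsFrameL b T) (c : ℂ) {τ : V →ₗ[ℂ] A} (hτ : τ ∈ P.horMor α) :
    (Γ.upsilonL (c • τ) : Γ.FormsL α) = c • Γ.upsilonL τ := by
  apply Γ.mulFormL_injective hT
  rw [map_smul, Γ.mulFormL_upsilonL hT hτ, Γ.mulFormL_upsilonL hT (Submodule.smul_mem _ c hτ)]

end Left

section Right

variable {b : ConjUnitaryBasis α κ} {N : ℕ} {T : Fin N → P.sections α}

theorem mulFormR_injective (hT : P.IsFrameR b T) : Function.Injective (Γ.mulFormR (α := α)) := by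
  intro x y h
  rw [← Γ.sum_mkR_frame hT x, ← Γ.sum_mkR_frame hT y]
  simp only [h]

theorem mulFormR_sum_coeff (hT : P.IsFrameR b T) (τ : P.horMor α) :
    Γ.mulFormR (∑ k, Γ.mkR (T k) (coeffR b (T k) τ)) = τ.1 := by
  ext v
  rw [← hT.sum_mul_coeff τ v]
  simp [mulFormR_mkR]

theorem upsilonR_eq_sum (hT : P.IsFrameR b T) (τ : P.horMor α) :
    Γ.upsilonR τ.1 = ∑ k, Γ.mkR (T k) (coeffR b (T k) τ) := by
  rw [← Γ.mulFormR_sum_coeff hT τ]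
  exact Function.leftInverse_invFun (Γ.mulFormR_injective hT) _

theorem mulFormR_upsilonR (hT : P.IsFrameR b T) {τ : V →ₗ[ℂ] A} (hτ : τ ∈ P.horMor α) :
    Γ.mulFormR (Γ.upsilonR τ : Γ.FormsR α) = τ := by
  rw [Γ.upsilonR_eq_sum hT ⟨τ, hτ⟩, Γ.mulFormR_sum_coeff hT]

theorem upsilonR_add (hT : P.IsFrameR b T) {σ τ : V →ₗ[ℂ] A} (hσ : σ ∈ P.horMor α)
    (hτ : τ ∈ P.horMor α) :
    (Γ.upsilonR (σ + τ) : Γ.FormsR α) = Γ.upsilonR σ + Γ.upsilonR τ := by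
  apply Γ.mulFormR_injective hT
  rw [map_add, Γ.mulFormR_upsilonR hT hσ, Γ.mulFormR_upsilonR hT hτ,
    Γ.mulFormR_upsilonR hT (Submodule.add_mem _ hσ hτ)]

theorem upsilonR_smul (hT : P.IsFrameR b T) (c : ℂ) {τ : V →ₗ[ℂ] A} (hτ : τ ∈ P.horMor α) :
    (Γ.upsilonR (c • τ) : Γ.FormsR α) = c • Γ.upsilonR τ := by
  apply Γ.mulFormR_injective hT
  rw [map_smul, Γ.mulFormR_upsilonR hT hτ, Γ.mulFormR_upsilonR hT (Submodule.smul_mem _ c hτ)]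

end Right

end BaseGeometry

end BundleForms

/-! ### Adjoints of the covariant derivatives -/

section Adjointness

variable {G : Type u} [Ring G] [HopfAlgebra ℂ G] [StarRing G] [StarModule ℂ G]
  {R : BicovariantCalculus G} {W : Type u} [Ring W] [Algebra ℂ W]
  {ℬ : ℕ → Submodule ℂ W} [GradedAlgebra ℬ] {E : Envelope R ℬ}
  {A : Type*} [Ring A] [Algebra ℂ A] {𝒜 : ℕ → Submodule ℂ A} [GradedAlgebra 𝒜]
  {P : QuantumPrincipalBundle E 𝒜} {κ : Type*} [Fintype κ] [DecidableEq κ]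

namespace QuantumPrincipalBundle

variable {m : Matrix κ κ G} {a c : κ → A} {k l : ℕ} {ω : R.Inv →ₗ[ℂ] A}

theorem dual_germ_of_unitary (hm : IsMatrixCorep m) (hu : m ∈ unitary (Matrix κ κ G))
    (ω : R.Inv →ₗ[ℂ] A) (i j : κ) : P.dual ω (R.germ (m j i)) = -P.st (ω (R.germ (m i j))) := by
  rw [dual_apply, R.starInv_germ, hm.antipode_of_unitary hu, star_star, map_neg, map_neg]

theorem IsCovariant.st_covK_dual (hm : IsMatrixCorep m) (hu : m ∈ unitary (Matrix κ κ G))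
    (hc : P.IsCovariant m c) (hl : ∀ i, c i ∈ 𝒜 l) (hω : ∀ θ, ω θ ∈ 𝒜 1) (i : κ) :
    P.st (P.covK (P.dual ω) (c i)) = ∑ j, ω (R.germ (m i j)) * P.st (c j) := by
  rw [hc.covK hl]
  simp only [dual_germ_of_unitary hm hu, mul_neg, Finset.sum_neg_distrib, neg_smul, smul_neg,
    neg_neg, map_smulₛₗ, map_sum, P.st_mul (hl _) (P.st_mem (hω _)), P.st_st, mul_one,
    ← Finset.smul_sum, smul_smul]
  simp [← mul_pow]

theorem IsCovariant.dualOp_covK_dual (hm : IsMatrixCorep (m.map star))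
    (hu : m.map star ∈ unitary (Matrix κ κ G))
    (hc : P.IsCovariant m c) (hl : ∀ i, c i ∈ 𝒜 l) (hω : ∀ θ, ω θ ∈ 𝒜 1) (i : κ) :
    P.dualOp (P.covK (P.dual ω)) (c i) = ∑ j, ω (R.germ (star (m i j))) * c j := by
  rw [hc.dualOp_covK hl fun θ => P.st_mem (hω _)]
  have h : ∀ j, P.dual ω (R.germ (star (m j i))) = -P.st (ω (R.germ (star (m i j)))) :=
    fun j => dual_germ_of_unitary hm hu ω i j
  simp only [h, map_neg, P.st_st, neg_mul, Finset.sum_neg_distrib, neg_neg]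

/-- The Leibniz rule for a connection and its dual. The connection terms cancel because the matrix
of a unitary corepresentation is inverted by the antipode. -/
theorem IsCovariant.d_sum_mul_st (hm : IsMatrixCorep m) (hu : m ∈ unitary (Matrix κ κ G))
    (ha : P.IsCovariant m a) (hk : ∀ i, a i ∈ 𝒜 k) (hc : P.IsCovariant m c)
    (hl : ∀ i, c i ∈ 𝒜 l) (hω : ∀ θ, ω θ ∈ 𝒜 1) :
    P.d (∑ i, a i * P.st (c i)) = ∑ i, P.covD ω (a i) * P.st (c i) +
      (-1 : ℂ) ^ k • ∑ i, a i * P.st (P.covD (P.dual ω) (c i)) := by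
  simp only [QuantumPrincipalBundle.covD, LinearMap.add_apply, map_add,
    hc.st_covK_dual hm hu hl hω, ha.covK hk, map_sum,
    P.leibniz (hk _), P.st_d, add_mul, mul_add, Finset.sum_add_distrib, smul_add, neg_smul,
    neg_mul, Finset.sum_neg_distrib, smul_mul_assoc, ← Finset.smul_sum, Finset.sum_mul,
    Finset.mul_sum, ← mul_assoc]
  rw [Finset.sum_comm (f := fun i j => a j * ω (R.germ (m j i)) * P.st (c i))]
  abel

theorem IsCovariant.d_sum_st_mul (hm : IsMatrixCorep (m.map star))
    (hu : m.map star ∈ unitary (Matrix κ κ G))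
    (ha : P.IsCovariant m a) (hk : ∀ i, a i ∈ 𝒜 k) (hc : P.IsCovariant m c)
    (hl : ∀ i, c i ∈ 𝒜 l) (hω : ∀ θ, ω θ ∈ 𝒜 1) :
    P.d (∑ i, P.st (a i) * c i) = ∑ i, P.st (P.dualOp (P.covD ω) (a i)) * c i +
      (-1 : ℂ) ^ k • ∑ i, P.st (a i) * P.dualOp (P.covD (P.dual ω)) (c i) := by
  have h1 : ∀ i j, P.st (P.st (ω (R.germ (star (m j i)))) * a j) =
      (-1 : ℂ) ^ k • (P.st (a j) * ω (R.germ (star (m j i)))) := fun i j => by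
    rw [P.st_mul (P.st_mem (hω _)) (hk j), one_mul, P.st_st]
  simp only [dualOp_covD_apply, map_add, hc.dualOp_covK_dual hm hu hl hω, ha.dualOp_covK hk hω,
    map_sum, map_neg, h1,
    P.leibniz (P.st_mem (hk _)), P.st_d, add_mul, mul_add, Finset.sum_add_distrib, smul_add,
    neg_mul, Finset.sum_neg_distrib, smul_mul_assoc, ← Finset.smul_sum, Finset.sum_mul,
    Finset.mul_sum, ← mul_assoc]
  rw [Finset.sum_comm (f := fun i j => P.st (a j) * ω (R.germ (star (m j i))) * c i)]
  abel

end QuantumPrincipalBundle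

variable {B : Type*} [CStarAlgebra B] [PartialOrder B] [StarOrderedRing B]
  {M : StarSubalgebra ℂ B} {V : Type*} [AddCommGroup V] [Module ℂ V] {α : V →ₗ[ℂ] V ⊗[ℂ] G}

namespace BaseGeometry

open QuantumPrincipalBundle

variable (Γ : BaseGeometry P M)

theorem hermitianFormL_mkL (b : UnitaryBasis α κ) (μ ν : P.baseForms) (S T : P.sections α) :
    Γ.hermitianFormL b (Γ.mkL μ S) (Γ.mkL ν T) = Γ.metric (μ * P.hermitianL b S T) ν :=
  Γ.preHermitianFormL_tmul b μ ν S T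

theorem hermitianFormR_mkR (b : ConjUnitaryBasis α κ) (μ ν : P.baseForms) (S T : P.sections α) :
    Γ.hermitianFormR b (Γ.mkR S μ) (Γ.mkR T ν) = Γ.metricR μ (P.hermitianR b S T * ν) :=
  Γ.preHermitianFormR_tmul b μ ν S T

theorem starHodgeL_mkL (μ : P.baseForms) (T : P.sections α) :
    Γ.starHodgeL (Γ.mkL μ T) = Γ.mkL (P.stBase (Γ.hodge μ)) T := rfl

theorem starHodgeR_mkR (T : P.sections α) (μ : P.baseForms) :
    Γ.starHodgeR (Γ.mkR T μ) = Γ.mkR T (Γ.hodge (P.stBase μ)) := rfl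

theorem hodgeInvStarL_mkL (μ : P.baseForms) (T : P.sections α) :
    Γ.hodgeInvStarL (Γ.mkL μ T) = Γ.mkL (Γ.hodge.symm (P.stBase μ)) T := rfl

theorem hodgeInvStarR_mkR (T : P.sections α) (μ : P.baseForms) :
    Γ.hodgeInvStarR (Γ.mkR T μ) = Γ.mkR T (P.stBase (Γ.hodge.symm μ)) := rfl

theorem stBase_stBase (μ : P.baseForms) : P.stBase (P.stBase μ) = μ := Subtype.ext (P.st_st μ)

theorem starHodgeL_hodgeInvStarL (x : Γ.FormsL α) : Γ.starHodgeL (Γ.hodgeInvStarL x) = x := by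
  induction x using Γ.formsL_induction with
  | zero => simp
  | add x y hx hy => rw [map_add, map_add, hx, hy]
  | mk μ T =>
    rw [hodgeInvStarL_mkL, starHodgeL_mkL, LinearEquiv.apply_symm_apply, stBase_stBase]

theorem starHodgeR_hodgeInvStarR (x : Γ.FormsR α) : Γ.starHodgeR (Γ.hodgeInvStarR x) = x := by
  induction x using Γ.formsR_induction with
  | zero => simp
  | add x y hx hy => rw [map_add, map_add, hx, hy]
  | mk μ T =>
    rw [hodgeInvStarR_mkR, starHodgeR_mkR, stBase_stBase, LinearEquiv.apply_symm_apply]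

theorem hermitianL_mem_zero (b : UnitaryBasis α κ) (S T : P.sections α) :
    (P.hermitianL b S T : A) ∈ 𝒜 0 := coeffL_section_mem b S T

theorem hermitianR_mem_zero (b : ConjUnitaryBasis α κ) (S T : P.sections α) :
    (P.hermitianR b S T : A) ∈ 𝒜 0 := coeffR_section_mem b S T

theorem coe_hermitianL (b : UnitaryBasis α κ) (S T : P.sections α) :
    (P.hermitianL b S T : A) = ∑ k, S.1 (b.e k) * P.st (T.1 (b.e k)) := rfl

theorem coe_hermitianR (b : ConjUnitaryBasis α κ) (S T : P.sections α) :
    (P.hermitianR b S T : A) = ∑ k, P.st (S.1 (b.e k)) * T.1 (b.e k) := rfl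

/-- The hermitian structure on left bundle-valued forms in terms of the Hodge operator:
`⟨x, y⟩ dvol` is the top degree part of `∑ x(e_k) ((∗ ∘ ⋆) y)(e_k)*`. -/
theorem inc_hermitianFormL_mul_dvol (b : UnitaryBasis α κ) (x y : Γ.FormsL α) :
    ((Γ.inc (Γ.hermitianFormL b x y) * Γ.dvol : P.baseForms) : A) = GradedAlgebra.proj 𝒜 Γ.n
      (∑ k, Γ.mulFormL x (b.e k) * P.st (Γ.mulFormL (Γ.starHodgeL y) (b.e k))) := by
  induction x using Γ.formsL_induction with
  | zero => simp
  | add x x' hx hx' =>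
    simp only [map_add, LinearMap.add_apply, add_mul, Finset.sum_add_distrib, ← hx, ← hx',
      Subalgebra.coe_add]
  | mk μ S =>
    induction y using Γ.formsL_induction with
    | zero => simp
    | add y y' hy hy' =>
      simp only [map_add, LinearMap.add_apply, add_mul, mul_add, Finset.sum_add_distrib, ← hy,
        ← hy', Subalgebra.coe_add]
    | mk ν T =>
      rw [hermitianFormL_mkL, ← Γ.hodge_spec]
      simp only [starHodgeL_mkL, mulFormL_mkL, P.st_mul_zero_right _ (T.2.2 _)]
      congr 1
      have h : P.st (P.stBase (Γ.hodge ν) : A) = Γ.hodge ν := P.st_st _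
      simp only [h, Subalgebra.coe_mul, coe_hermitianL, Finset.mul_sum, Finset.sum_mul, mul_assoc]

theorem inc_hermitianFormR_mul_dvol (b : ConjUnitaryBasis α κ) (x y : Γ.FormsR α) :
    ((Γ.inc (Γ.hermitianFormR b x y) * Γ.dvol : P.baseForms) : A) = GradedAlgebra.proj 𝒜 Γ.n
      (∑ k, P.st (Γ.mulFormR x (b.e k)) * Γ.mulFormR (Γ.starHodgeR y) (b.e k)) := by
  induction x using Γ.formsR_induction with
  | zero => simp
  | add x x' hx hx' =>
    simp only [map_add, LinearMap.add_apply, add_mul, Finset.sum_add_distrib, ← hx, ← hx',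
      Subalgebra.coe_add]
  | mk S μ =>
    induction y using Γ.formsR_induction with
    | zero => simp
    | add y y' hy hy' =>
      simp only [map_add, LinearMap.add_apply, add_mul, mul_add, Finset.sum_add_distrib, ← hy,
        ← hy', Subalgebra.coe_add]
    | mk T ν =>
      have h1 : Γ.metricR μ (P.hermitianR b S T * ν) =
          Γ.metric (P.stBase μ * P.hermitianR b S T) (P.stBase ν) := by
        have h2 := Γ.inc_toBase (hermitianR_mem_zero b S T)
        rw [← h2, metric_mul_right, ← st_inc_mul]
        rfl
      rw [hermitianFormR_mkR, h1, ← Γ.hodge_spec]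
      simp only [starHodgeR_mkR, mulFormR_mkR, P.st_mul_zero_left _ (S.2.2 _)]
      congr 1
      have h : (P.stBase μ : A) = P.st μ := rfl
      simp only [h, Subalgebra.coe_mul, coe_hermitianR, Finset.mul_sum, Finset.sum_mul, mul_assoc]

theorem proj_of_mem {k : ℕ} {x : A} (hx : x ∈ 𝒜 k) : GradedAlgebra.proj 𝒜 k x = x :=
  DirectSum.decompose_of_mem_same 𝒜 hx

section Left

variable {b : UnitaryBasis α κ} {N : ℕ} {T : Fin N → P.sections α}

theorem eq_zero_of_mulFormL_mem_of_lt (hT : P.IsFrameL b T) {k : ℕ} {y : Γ.FormsL α}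
    (hy : ∀ v, Γ.mulFormL y v ∈ 𝒜 k) (hk : Γ.n < k) : y = 0 := by
  rw [← Γ.sum_mkL_frame hT y]
  refine Finset.sum_eq_zero fun j _ => ?_
  rw [Γ.eq_zero_of_lt k _ hk (coeffL_mem b _ (T j) hy), mkL_zero_left]

theorem mulFormL_starHodgeL_mem (hT : P.IsFrameL b T) {k : ℕ} {y : Γ.FormsL α}
    (hy : ∀ v, Γ.mulFormL y v ∈ 𝒜 k) (hk : k ≤ Γ.n) (v : V) :
    Γ.mulFormL (Γ.starHodgeL y) v ∈ 𝒜 (Γ.n - k) := by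
  rw [← Γ.sum_mkL_frame hT y]
  simp only [map_sum, LinearMap.sum_apply, starHodgeL_mkL, mulFormL_mkL]
  exact Submodule.sum_mem _ fun j _ => SetLike.GradedMul.mul_mem
    (P.st_mem (Γ.hodge_mem k _ hk (coeffL_mem b _ (T j) hy))) ((T j).2.2 v)

theorem upsilonL_zero (hT : P.IsFrameL b T) : (Γ.upsilonL 0 : Γ.FormsL α) = 0 := by
  apply Γ.mulFormL_injective hT
  rw [Γ.mulFormL_upsilonL hT (Submodule.zero_mem _), map_zero]

theorem codiffL_zero (hT : P.IsFrameL b T) (m : ℕ) (ω : R.Inv →ₗ[ℂ] A) :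
    Γ.codiffL m ω (0 : Γ.FormsL α) = 0 := by
  simp [codiffL, dNablaL, Γ.upsilonL_zero hT]

theorem covD_comp_mulFormL_mem (hb : IsMatrixCorep b.mat) {k : ℕ} {x : Γ.FormsL α}
    (hx : ∀ v, Γ.mulFormL x v ∈ 𝒜 k) {ω : R.Inv →ₗ[ℂ] A} (hω : P.IsConnection ω) :
    P.covD ω ∘ₗ Γ.mulFormL x ∈ P.horMor α :=
  (P.mem_horMor_iff b.e b.coact _).2
    ((isCovariant_of_mem_horMor b (Γ.mulFormL_mem_horMor x)).covD hb (fun _ => hx _) hω)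

/-- The codifferential is adjoint to the exterior covariant derivative: by Stokes' theorem for the
form `∑ x(e_k) ((∗ ∘ ⋆) y)(e_k)*`. -/
theorem innerL_dNablaL (hb : IsMatrixCorep b.mat) (hT : P.IsFrameL b T) {ω : R.Inv →ₗ[ℂ] A}
    (hω : P.IsConnection ω) (hω' : P.IsConnection (P.dual ω)) {k : ℕ} {x y : Γ.FormsL α}
    (hx : ∀ v, Γ.mulFormL x v ∈ 𝒜 k) (hy : ∀ v, Γ.mulFormL y v ∈ 𝒜 (k + 1)) :
    Γ.innerL b (Γ.dNablaL ω x) y = Γ.innerL b x (Γ.codiffL (k + 1) ω y) := by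
  -- Above the top degree `y` vanishes, while the Hodge formula would involve a truncated degree.
  rcases lt_or_ge Γ.n (k + 1) with hn | hn
  · rw [Γ.eq_zero_of_mulFormL_mem_of_lt hT hy hn, Γ.codiffL_zero hT]
    simp [innerL]
  · have hs := Γ.mulFormL_starHodgeL_mem hT hy hn
    have ha := isCovariant_of_mem_horMor b (Γ.mulFormL_mem_horMor x)
    have hc := isCovariant_of_mem_horMor b (Γ.mulFormL_mem_horMor (Γ.starHodgeL y))
    let μ : P.baseForms := ⟨_, ha.sum_mul_st_mem b.unitary hc⟩
    have h1 : ((Γ.inc (Γ.hermitianFormL b (Γ.dNablaL ω x) y) * Γ.dvol : P.baseForms) : A) =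
        ∑ i, P.covD ω (Γ.mulFormL x (b.e i)) * P.st (Γ.mulFormL (Γ.starHodgeL y) (b.e i)) := by
      rw [inc_hermitianFormL_mul_dvol, dNablaL,
        Γ.mulFormL_upsilonL hT (Γ.covD_comp_mulFormL_mem hb hx hω)]
      refine proj_of_mem (Submodule.sum_mem _ fun i _ => ?_)
      have := SetLike.GradedMul.mul_mem (ha.covD_mem (fun _ => hx _) (fun θ => (hω θ).1) i)
        (P.st_mem (hs (b.e i)))
      rwa [Nat.add_sub_cancel' hn] at this
    have h2 : ((Γ.inc (Γ.hermitianFormL b x (Γ.codiffL (k + 1) ω y)) * Γ.dvol : P.baseForms) : A) =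
        (-1 : ℂ) ^ (k + 1) • ∑ i, Γ.mulFormL x (b.e i) *
          P.st (P.covD (P.dual ω) (Γ.mulFormL (Γ.starHodgeL y) (b.e i))) := by
      rw [inc_hermitianFormL_mul_dvol, codiffL, map_smul, starHodgeL_hodgeInvStarL, dNablaL,
        map_smul, Γ.mulFormL_upsilonL hT (Γ.covD_comp_mulFormL_mem hb hs hω')]
      simp only [LinearMap.smul_apply, map_smulₛₗ, mul_smul_comm, ← Finset.smul_sum, map_pow,
        map_neg, map_one]
      congr 1
      refine proj_of_mem (Submodule.sum_mem _ fun i _ => ?_)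
      have := SetLike.GradedMul.mul_mem (hx (b.e i))
        (P.st_mem (hc.covD_mem (fun _ => hs _) (fun θ => (hω' θ).1) i))
      have hn2 : k + (Γ.n - (k + 1) + 1) = Γ.n := by omega
      rwa [hn2] at this
    have h3 := ha.d_sum_mul_st (ω := ω) hb b.unitary (fun _ => hx _) hc (fun _ => hs _)
      (fun θ => (hω θ).1)
    have h4 := Γ.stokes μ (Γ.hermitianFormL b (Γ.dNablaL ω x) y -
      Γ.hermitianFormL b x (Γ.codiffL (k + 1) ω y)) (by
        rw [map_sub, sub_mul, Subalgebra.coe_sub, h1, h2]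
        refine h3.trans ?_
        rw [pow_succ, mul_neg_one, neg_smul, sub_neg_eq_add])
    rw [map_sub, sub_eq_zero] at h4
    exact h4

end Left

section Right

variable {b : ConjUnitaryBasis α κ} {N : ℕ} {T : Fin N → P.sections α}

theorem eq_zero_of_mulFormR_mem_of_lt (hT : P.IsFrameR b T) {k : ℕ} {y : Γ.FormsR α}
    (hy : ∀ v, Γ.mulFormR y v ∈ 𝒜 k) (hk : Γ.n < k) : y = 0 := by
  rw [← Γ.sum_mkR_frame hT y]
  refine Finset.sum_eq_zero fun j _ => ?_
  rw [Γ.eq_zero_of_lt k _ hk (coeffR_mem b (T j) _ hy), mkR_zero_right]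

theorem mulFormR_starHodgeR_mem (hT : P.IsFrameR b T) {k : ℕ} {y : Γ.FormsR α}
    (hy : ∀ v, Γ.mulFormR y v ∈ 𝒜 k) (hk : k ≤ Γ.n) (v : V) :
    Γ.mulFormR (Γ.starHodgeR y) v ∈ 𝒜 (Γ.n - k) := by
  rw [← Γ.sum_mkR_frame hT y]
  simp only [map_sum, LinearMap.sum_apply, starHodgeR_mkR, mulFormR_mkR]
  refine Submodule.sum_mem _ fun j _ => ?_
  simpa using SetLike.GradedMul.mul_mem ((T j).2.2 v) (Γ.hodge_mem k
    (P.stBase (coeffR b (T j) ⟨Γ.mulFormR y, Γ.mulFormR_mem_horMor y⟩)) hk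
    (P.st_mem (coeffR_mem b (T j) _ hy)))

theorem upsilonR_zero (hT : P.IsFrameR b T) : (Γ.upsilonR 0 : Γ.FormsR α) = 0 := by
  apply Γ.mulFormR_injective hT
  rw [Γ.mulFormR_upsilonR hT (Submodule.zero_mem _), map_zero]

theorem codiffR_zero (hT : P.IsFrameR b T) (m : ℕ) (ω : R.Inv →ₗ[ℂ] A) :
    Γ.codiffR m ω (0 : Γ.FormsR α) = 0 := by
  simp [codiffR, dNablaR, Γ.upsilonR_zero hT]

theorem dualOp_covD_comp_mulFormR_mem
    (hs : ∀ g : G, Coalgebra.comul (R := ℂ) (star g) = star (Coalgebra.comul (R := ℂ) g))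
    (hb : IsMatrixCorep b.mat) {k : ℕ} {x : Γ.FormsR α}
    (hx : ∀ v, Γ.mulFormR x v ∈ 𝒜 k) {ω : R.Inv →ₗ[ℂ] A} (hω : P.IsConnection ω) :
    P.dualOp (P.covD ω) ∘ₗ Γ.mulFormR x ∈ P.horMor α :=
  (P.mem_horMor_iff b.e b.coact _).2
    ((isCovariant_of_mem_horMor_conj b (Γ.mulFormR_mem_horMor x)).dualOp_covD hs hb
      (fun _ => hx _) hω)

/-- The right analogue of `innerL_dNablaL`. The basis `b'` on which the hermitian structure depends
is not the one of the frame. -/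
theorem innerR_dNablaR
    (hs : ∀ g : G, Coalgebra.comul (R := ℂ) (star g) = star (Coalgebra.comul (R := ℂ) g))
    {κ' : Type*} [Fintype κ'] [DecidableEq κ'] {b' : ConjUnitaryBasis α κ'}
    (hb : IsMatrixCorep b'.mat) (hT : P.IsFrameR b T) {ω : R.Inv →ₗ[ℂ] A}
    (hω : P.IsConnection ω) (hω' : P.IsConnection (P.dual ω)) {k : ℕ} {x y : Γ.FormsR α}
    (hx : ∀ v, Γ.mulFormR x v ∈ 𝒜 k) (hy : ∀ v, Γ.mulFormR y v ∈ 𝒜 (k + 1)) :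
    Γ.innerR b' (Γ.dNablaR ω x) y = Γ.innerR b' x (Γ.codiffR (k + 1) ω y) := by
  rcases lt_or_ge Γ.n (k + 1) with hn | hn
  · rw [Γ.eq_zero_of_mulFormR_mem_of_lt hT hy hn, Γ.codiffR_zero hT]
    simp [innerR]
  · have hl := Γ.mulFormR_starHodgeR_mem hT hy hn
    have ha := isCovariant_of_mem_horMor_conj b' (Γ.mulFormR_mem_horMor x)
    have hc := isCovariant_of_mem_horMor_conj b' (Γ.mulFormR_mem_horMor (Γ.starHodgeR y))
    let μ : P.baseForms := ⟨_, ha.sum_st_mul_mem b'.unitary hc⟩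
    have h1 : ((Γ.inc (Γ.hermitianFormR b' (Γ.dNablaR ω x) y) * Γ.dvol : P.baseForms) : A) =
        ∑ i, P.st (P.dualOp (P.covD ω) (Γ.mulFormR x (b'.e i))) *
          Γ.mulFormR (Γ.starHodgeR y) (b'.e i) := by
      rw [inc_hermitianFormR_mul_dvol, dNablaR,
        Γ.mulFormR_upsilonR hT (Γ.dualOp_covD_comp_mulFormR_mem hs hb hx hω)]
      refine proj_of_mem (Submodule.sum_mem _ fun i _ => ?_)
      have := SetLike.GradedMul.mul_mem
        (P.st_mem (ha.dualOp_covD_mem (fun _ => hx _) (fun θ => (hω θ).1) i)) (hl (b'.e i))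
      rwa [Nat.add_sub_cancel' hn] at this
    have h2 : ((Γ.inc (Γ.hermitianFormR b' x (Γ.codiffR (k + 1) ω y)) * Γ.dvol : P.baseForms) : A) =
        (-1 : ℂ) ^ (k + 1) • ∑ i, P.st (Γ.mulFormR x (b'.e i)) *
          P.dualOp (P.covD (P.dual ω)) (Γ.mulFormR (Γ.starHodgeR y) (b'.e i)) := by
      rw [inc_hermitianFormR_mul_dvol, codiffR, map_smul, starHodgeR_hodgeInvStarR, dNablaR,
        map_smul, Γ.mulFormR_upsilonR hT (Γ.dualOp_covD_comp_mulFormR_mem hs hb hl hω')]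
      simp only [LinearMap.smul_apply, map_smul, mul_smul_comm, ← Finset.smul_sum]
      congr 1
      refine proj_of_mem (Submodule.sum_mem _ fun i _ => ?_)
      have := SetLike.GradedMul.mul_mem (P.st_mem (hx (b'.e i)))
        (hc.dualOp_covD_mem (fun _ => hl _) (fun θ => (hω' θ).1) i)
      have hn2 : k + (Γ.n - (k + 1) + 1) = Γ.n := by omega
      rwa [hn2] at this
    have h3 := ha.d_sum_st_mul (ω := ω) (hb.map_star hs) b'.unitary (fun _ => hx _) hc
      (fun _ => hl _) (fun θ => (hω θ).1)
    have h4 := Γ.stokes μ (Γ.hermitianFormR b' (Γ.dNablaR ω x) y -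
      Γ.hermitianFormR b' x (Γ.codiffR (k + 1) ω y)) (by
        rw [map_sub, sub_mul, Subalgebra.coe_sub, h1, h2]
        refine h3.trans ?_
        rw [pow_succ, mul_neg_one, neg_smul, sub_neg_eq_add])
    rw [map_sub, sub_eq_zero] at h4
    exact h4

end Right

end BaseGeometry

end Adjointness

/-! ### Sections as forms of degree zero -/

section SectionForms

variable {G : Type u} [Ring G] [HopfAlgebra ℂ G] [StarRing G] [StarModule ℂ G]
  {R : BicovariantCalculus G} {W : Type u} [Ring W] [Algebra ℂ W]
  {ℬ : ℕ → Submodule ℂ W} [GradedAlgebra ℬ] {E : Envelope R ℬ}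
  {A : Type*} [Ring A] [Algebra ℂ A] {𝒜 : ℕ → Submodule ℂ A} [GradedAlgebra 𝒜]
  {P : QuantumPrincipalBundle E 𝒜} {κ : Type*} [Fintype κ] [DecidableEq κ]
  {B : Type*} [CStarAlgebra B] [PartialOrder B] [StarOrderedRing B]
  {M : StarSubalgebra ℂ B} {V : Type*} [AddCommGroup V] [Module ℂ V] {α : V →ₗ[ℂ] V ⊗[ℂ] G}

namespace BaseGeometry

open QuantumPrincipalBundle

variable (Γ : BaseGeometry P M)

/-- Positivity implies that the state is hermitian. -/
theorem state_star (p : M) : Γ.state (star p) = star (Γ.state p) := by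
  have h : ∀ c : ℂ, (Γ.state (p * star p) + star c * Γ.state p + c * Γ.state (star p) +
      c * star c).im = 0 := fun c => by
    have h1 := (Complex.le_def.1 (Γ.state_nonneg (p + c • 1))).2
    have h2 : (p + c • 1) * star (p + c • 1) = p * star p + star c • p + c • star p +
        (c * star c) • (1 : M) := by
      simp only [star_add, star_smul, star_one, add_mul, mul_add, mul_smul_comm, smul_mul_assoc,
        mul_one, one_mul, smul_add, smul_smul, mul_comm (star c) c]
      abel
    rw [h2] at h1
    simpa [Γ.state_one] using h1.symm
  have h0 := (Complex.le_def.1 (Γ.state_nonneg p)).2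
  have h1 := h 1
  have h2 := h Complex.I
  simp [← h0] at h1 h2
  apply Complex.ext
  · simp
    linarith
  · simp
    linarith

theorem ofSectionL_eq (S : P.sections α) : Γ.ofSectionL S = Γ.mkL 1 S := rfl

theorem ofSectionR_eq (S : P.sections α) : Γ.ofSectionR S = Γ.mkR S 1 := rfl

theorem mulFormL_ofSectionL (S : P.sections α) : Γ.mulFormL (Γ.ofSectionL S) = S.1 :=
  LinearMap.ext fun v => (Γ.mulFormL_mkL 1 S v).trans (one_mul _)

theorem mulFormR_ofSectionR (S : P.sections α) : Γ.mulFormR (Γ.ofSectionR S) = S.1 :=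
  LinearMap.ext fun v => (Γ.mulFormR_mkR S 1 v).trans (mul_one _)

theorem hermitianFormL_ofSectionL (b : UnitaryBasis α κ) (S T : P.sections α) :
    Γ.hermitianFormL b (Γ.ofSectionL S) (Γ.ofSectionL T) = Γ.toBase (P.hermitianL b S T) := by
  rw [ofSectionL_eq, ofSectionL_eq, hermitianFormL_mkL, one_mul,
    ← Γ.inc_toBase (hermitianL_mem_zero b S T), ← map_one Γ.inc, Γ.metric_zero, star_one, mul_one,
    toBase_inc]

theorem hermitianFormR_ofSectionR (b : ConjUnitaryBasis α κ) (S T : P.sections α) :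
    Γ.hermitianFormR b (Γ.ofSectionR S) (Γ.ofSectionR T) = Γ.toBase (P.hermitianR b S T) := by
  have h : ∀ μ ν, Γ.metricR μ ν = Γ.metric (P.stBase μ) (P.stBase ν) := fun _ _ => rfl
  rw [ofSectionR_eq, ofSectionR_eq, hermitianFormR_mkR, mul_one,
    ← Γ.inc_toBase (hermitianR_mem_zero b S T), ← map_one Γ.inc, h, Γ.st_inc, Γ.st_inc,
    Γ.metric_zero, star_star, star_one, one_mul, toBase_inc]

theorem toBase_hermitianL_smulL_left (b : UnitaryBasis α κ) (p : M) (S T : P.sections α) :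
    Γ.toBase (P.hermitianL b (Γ.smulL p S) T) = p * Γ.toBase (P.hermitianL b S T) := by
  rw [hermitianL_smul_left, ← Γ.inc_toBase (hermitianL_mem_zero b S T), ← map_mul, toBase_inc,
    toBase_inc]

theorem toBase_hermitianR_smulR_left (b : ConjUnitaryBasis α κ) (p : M) (S T : P.sections α) :
    Γ.toBase (P.hermitianR b (Γ.smulR S p) T) = star p * Γ.toBase (P.hermitianR b S T) := by
  rw [hermitianR_smul_left, ← Γ.inc_toBase (hermitianR_mem_zero b S T), ← map_mul, toBase_inc,
    toBase_inc]

theorem toBase_hermitianR_smulR_right (b : ConjUnitaryBasis α κ) (p : M) (S T : P.sections α) :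
    Γ.toBase (P.hermitianR b S (Γ.smulR T p)) = Γ.toBase (P.hermitianR b S T) * p := by
  rw [hermitianR_smul_right, ← Γ.inc_toBase (hermitianR_mem_zero b S T), ← map_mul, toBase_inc,
    toBase_inc]

theorem stBase_hermitianL (b : UnitaryBasis α κ) (S T : P.sections α) :
    P.stBase (P.hermitianL b S T) = P.hermitianL b T S := by
  ext
  change P.st (P.hermitianL b S T : A) = _
  simp only [coe_hermitianL, map_sum, P.st_mul_zero_left _ (S.2.2 _), P.st_st]

theorem stBase_hermitianR (b : ConjUnitaryBasis α κ) (S T : P.sections α) :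
    P.stBase (P.hermitianR b S T) = P.hermitianR b T S := by
  ext
  change P.st (P.hermitianR b S T : A) = _
  simp only [coe_hermitianR, map_sum, P.st_mul_zero_right _ (T.2.2 _), P.st_st]

theorem star_toBase {x : P.baseForms} (hx : (x : A) ∈ 𝒜 0) :
    star (Γ.toBase x) = Γ.toBase (P.stBase x) := by
  rw [← Γ.inc_toBase hx, Γ.st_inc, toBase_inc, toBase_inc]

theorem star_toBase_hermitianL (b : UnitaryBasis α κ) (S T : P.sections α) :
    star (Γ.toBase (P.hermitianL b S T)) = Γ.toBase (P.hermitianL b T S) := by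
  rw [Γ.star_toBase (hermitianL_mem_zero b S T), stBase_hermitianL]

theorem star_toBase_hermitianR (b : ConjUnitaryBasis α κ) (S T : P.sections α) :
    star (Γ.toBase (P.hermitianR b S T)) = Γ.toBase (P.hermitianR b T S) := by
  rw [Γ.star_toBase (hermitianR_mem_zero b S T), stBase_hermitianR]

theorem star_hermitianFormR (b : ConjUnitaryBasis α κ) (x y : Γ.FormsR α) :
    star (Γ.hermitianFormR b x y) = Γ.hermitianFormR b y x := by
  induction x using Γ.formsR_induction with
  | zero => simp
  | add x x' hx hx' => simp only [map_add, LinearMap.add_apply, star_add, hx, hx']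
  | mk S μ =>
    induction y using Γ.formsR_induction with
    | zero => simp
    | add y y' hy hy' => simp only [map_add, LinearMap.add_apply, star_add, hy, hy']
    | mk T ν =>
      have h : ∀ μ ν, Γ.metricR μ ν = Γ.metric (P.stBase μ) (P.stBase ν) := fun _ _ => rfl
      rw [hermitianFormR_mkR, hermitianFormR_mkR, h, Γ.metric_symm, ← stBase_hermitianR b S T,
        ← Γ.inc_toBase (hermitianR_mem_zero b S T), Γ.st_inc, metricR_inc_mul, h]

theorem innerR_symm (b : ConjUnitaryBasis α κ) (x y : Γ.FormsR α) :
    star (Γ.innerR b x y) = Γ.innerR b y x := by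
  rw [innerR, ← state_star, star_hermitianFormR, innerR]

theorem eq_zero_of_state_mul_star {p : M} (h : Γ.state (p * star p) = 0) : p = 0 := by
  by_contra hp
  have h1 := Γ.inner_pos (Γ.inc p) fun h2 => hp (Γ.inc_injective (h2.trans (map_zero _).symm))
  rw [Γ.metric_zero, h] at h1
  exact lt_irrefl _ h1

/-- The pairing of sections is nondegenerate, as testing with the terms of the expansion in a frame
shows. -/
theorem eq_zero_of_innerL_ofSectionL {b : UnitaryBasis α κ} {N : ℕ} {T : Fin N → P.sections α}
    (hT : P.IsFrameL b T) {S : P.sections α}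
    (h : ∀ U, Γ.innerL b (Γ.ofSectionL U) (Γ.ofSectionL S) = 0) : S = 0 := by
  have h1 : ∀ k, Γ.toBase (P.hermitianL b S (T k)) = 0 := fun k => by
    have h2 := h (Γ.smulL (Γ.toBase (P.hermitianL b S (T k))) (T k))
    rw [innerL, hermitianFormL_ofSectionL, toBase_hermitianL_smulL_left,
      ← Γ.star_toBase_hermitianL b S (T k)] at h2
    exact Γ.eq_zero_of_state_mul_star h2
  rw [← Γ.sum_smulL_frame hT S]
  refine Finset.sum_eq_zero fun k _ => ?_
  rw [h1]
  ext
  simp [smulL]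

theorem eq_zero_of_innerR_ofSectionR {b : ConjUnitaryBasis α κ} {N : ℕ} {T : Fin N → P.sections α}
    (hT : P.IsFrameR b T) {S : P.sections α}
    (h : ∀ U, Γ.innerR b (Γ.ofSectionR S) (Γ.ofSectionR U) = 0) : S = 0 := by
  have h1 : ∀ k, Γ.toBase (P.hermitianR b (T k) S) = 0 := fun k => by
    have h2 := h (Γ.smulR (T k) (Γ.toBase (P.hermitianR b (T k) S)))
    rw [innerR, hermitianFormR_ofSectionR, toBase_hermitianR_smulR_right,
      ← star_toBase_hermitianR] at h2
    have h3 := Γ.eq_zero_of_state_mul_star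
      (p := star (Γ.toBase (P.hermitianR b (T k) S))) (by rwa [star_star])
    rwa [star_eq_zero] at h3
  rw [← Γ.sum_smulR_frame hT S]
  refine Finset.sum_eq_zero fun k _ => ?_
  rw [h1]
  ext
  simp [smulR]

/-! ### The codifferential of one-forms -/

/-- `⋆ q = q* dvol`, from the defining property of the Hodge operator for `⟨1, q⟩ = q*`. -/
theorem hodge_inc (q : M) : Γ.hodge (Γ.inc q) = Γ.inc (star q) * Γ.dvol := by
  have h := Γ.hodge_spec (Γ.inc 1) (Γ.inc q)
  have h1 := Γ.hodge_mem 0 (Γ.inc q) (Nat.zero_le _) (Γ.inc_mem q)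
  rw [Nat.sub_zero] at h1
  rw [Γ.metric_zero, one_mul, map_one, one_mul, proj_of_mem h1] at h
  exact Subtype.ext h

theorem hodge_symm_inc_mul_dvol (p : M) : Γ.hodge.symm (Γ.inc p * Γ.dvol) = Γ.inc (star p) := by
  apply Γ.hodge.injective
  rw [hodge_inc, star_star, LinearEquiv.apply_symm_apply]

theorem mkL_inc (p : M) (T : P.sections α) : Γ.mkL (Γ.inc p) T = Γ.ofSectionL (Γ.smulL p T) := by
  rw [ofSectionL_eq, ← mkL_mul_inc, one_mul]

theorem mkR_inc (p : M) (T : P.sections α) : Γ.mkR T (Γ.inc p) = Γ.ofSectionR (Γ.smulR T p) := by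
  rw [ofSectionR_eq, ← mkR_inc_mul, mul_one]

/-- The codifferential of a one-form is a section: in the Hodge formula, the operator `⋆⁻¹ ∘ ∗` acts
on forms of top degree, which are multiples of the volume form. -/
theorem exists_codiffL_eq_ofSectionL {b : UnitaryBasis α κ} {N : ℕ} {T : Fin N → P.sections α}
    (hb : IsMatrixCorep b.mat) (hT : P.IsFrameL b T) {ω : R.Inv →ₗ[ℂ] A}
    (hω' : P.IsConnection (P.dual ω)) {y : Γ.FormsL α} (hy : ∀ v, Γ.mulFormL y v ∈ 𝒜 1) :
    ∃ S, Γ.codiffL 1 ω y = Γ.ofSectionL S := by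
  rcases lt_or_ge Γ.n 1 with hn | hn
  · refine ⟨0, ?_⟩
    rw [Γ.eq_zero_of_mulFormL_mem_of_lt hT hy hn, Γ.codiffL_zero hT]
    simp [ofSectionL]
  · have hs := Γ.mulFormL_starHodgeL_mem hT hy hn
    let τ : P.horMor α := ⟨_, Γ.covD_comp_mulFormL_mem hb hs hω'⟩
    have hτ : ∀ v, τ.1 v ∈ 𝒜 Γ.n := by
      have hc := isCovariant_of_mem_horMor b (Γ.mulFormL_mem_horMor (Γ.starHodgeL y))
      have h1 : ∀ i, τ.1 (b.e i) ∈ 𝒜 Γ.n := fun i => by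
        have := hc.covD_mem (fun _ => hs _) (fun θ => (hω' θ).1) i
        rwa [Nat.sub_add_cancel hn] at this
      intro v
      rw [← b.e.sum_repr v, map_sum]
      exact Submodule.sum_mem _ fun i _ => by
        rw [map_smul]
        exact Submodule.smul_mem _ _ (h1 i)
    have h2 : ∀ k, ∃ p, P.stBase (coeffL b τ (T k)) = Γ.inc p * Γ.dvol := fun k =>
      Γ.top_form _ (P.st_mem (coeffL_mem b τ (T k) hτ))
    choose p hp using h2
    refine ⟨(-1 : ℂ) ^ 1 • ∑ k, Γ.smulL (star (p k)) (T k), ?_⟩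
    have h3 : Γ.dNablaL (P.dual ω) (Γ.starHodgeL y) = ∑ k, Γ.mkL (coeffL b τ (T k)) (T k) :=
      Γ.upsilonL_eq_sum hT τ
    have h4 : ∀ (c : ℂ) (S : P.sections α), Γ.ofSectionL (c • S) = c • Γ.ofSectionL S :=
      fun c S => by simp [ofSectionL]
    rw [codiffL, h3, map_sum, h4, ofSectionL_eq, mkL_sum_right]
    simp only [hodgeInvStarL_mkL, hp, hodge_symm_inc_mul_dvol, mkL_inc, ofSectionL_eq]

theorem exists_codiffR_eq_ofSectionR
    (hs : ∀ g : G, Coalgebra.comul (R := ℂ) (star g) = star (Coalgebra.comul (R := ℂ) g))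
    {b : ConjUnitaryBasis α κ} {N : ℕ} {T : Fin N → P.sections α}
    (hb : IsMatrixCorep b.mat) (hT : P.IsFrameR b T) {ω : R.Inv →ₗ[ℂ] A}
    (hω' : P.IsConnection (P.dual ω)) {y : Γ.FormsR α} (hy : ∀ v, Γ.mulFormR y v ∈ 𝒜 1) :
    ∃ S, Γ.codiffR 1 ω y = Γ.ofSectionR S := by
  rcases lt_or_ge Γ.n 1 with hn | hn
  · refine ⟨0, ?_⟩
    rw [Γ.eq_zero_of_mulFormR_mem_of_lt hT hy hn, Γ.codiffR_zero hT]
    simp [ofSectionR]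
  · have hl := Γ.mulFormR_starHodgeR_mem hT hy hn
    let τ : P.horMor α := ⟨_, Γ.dualOp_covD_comp_mulFormR_mem hs hb hl hω'⟩
    have hτ : ∀ v, τ.1 v ∈ 𝒜 Γ.n := by
      have hc := isCovariant_of_mem_horMor_conj b (Γ.mulFormR_mem_horMor (Γ.starHodgeR y))
      have h1 : ∀ i, τ.1 (b.e i) ∈ 𝒜 Γ.n := fun i => by
        have := hc.dualOp_covD_mem (fun _ => hl _) (fun θ => (hω' θ).1) i
        rwa [Nat.sub_add_cancel hn] at this
      intro v
      rw [← b.e.sum_repr v, map_sum]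
      exact Submodule.sum_mem _ fun i _ => by
        rw [map_smul]
        exact Submodule.smul_mem _ _ (h1 i)
    have h2 : ∀ k, ∃ p, coeffR b (T k) τ = Γ.inc p * Γ.dvol := fun k =>
      Γ.top_form _ (coeffR_mem b (T k) τ hτ)
    choose p hp using h2
    refine ⟨(-1 : ℂ) ^ 1 • ∑ k, Γ.smulR (T k) (p k), ?_⟩
    have h3 : Γ.dNablaR (P.dual ω) (Γ.starHodgeR y) = ∑ k, Γ.mkR (T k) (coeffR b (T k) τ) :=
      Γ.upsilonR_eq_sum hT τ
    have h4 : ∀ (c : ℂ) (S : P.sections α), Γ.ofSectionR (c • S) = c • Γ.ofSectionR S :=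
      fun c S => (Γ.relR α).mkQ.map_smul c (S ⊗ₜ[ℂ] 1)
    rw [codiffR, h3, map_sum, h4, ofSectionR_eq, mkR_sum_left]
    simp only [hodgeInvStarR_mkR, hp, hodge_symm_inc_mul_dvol, Γ.st_inc, star_star, mkR_inc,
      ofSectionR_eq]

end BaseGeometry

end SectionForms

/-! ### Wirtinger derivatives -/

section Wirtinger

variable {F : Type*} [NormedAddCommGroup F] [NormedSpace ℂ F]

/-- The real linear map `v ↦ v a + v̄ b`. -/
def wirtingerCLM (a b : F) : ℂ →L[ℝ] F :=
  (ContinuousLinearMap.id ℝ ℂ).smulRight a + (Complex.conjCLE : ℂ →L[ℝ] ℂ).smulRight b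

theorem wirtingerCLM_apply (a b : F) (v : ℂ) :
    wirtingerCLM a b v = v • a + starRingEnd ℂ v • b := rfl

theorem wirtingerDeriv_of_hasFDerivAt {f : ℂ → F} {L : ℂ →L[ℝ] F} {z : ℂ}
    (h : HasFDerivAt f L z) :
    wirtingerDeriv f z = (1 / 2 : ℂ) • (L 1 - Complex.I • L Complex.I) := by
  rw [wirtingerDeriv, h.fderiv]

theorem hasWirtingerDerivAt_of_hasFDerivAt {f : ℂ → F} {a b : F} {z : ℂ}
    (h : HasFDerivAt f (wirtingerCLM a b) z) : HasWirtingerDerivAt f a z := by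
  refine ⟨h.differentiableAt, ?_⟩
  rw [wirtingerDeriv_of_hasFDerivAt h, wirtingerCLM_apply, wirtingerCLM_apply, map_one,
    Complex.conj_I, smul_add, smul_smul, smul_smul, mul_neg, Complex.I_mul_I]
  module

theorem HasWirtingerDerivAt.add {f g : ℂ → F} {a b : F} {z : ℂ} (hf : HasWirtingerDerivAt f a z)
    (hg : HasWirtingerDerivAt g b z) : HasWirtingerDerivAt (fun w => f w + g w) (a + b) z := by
  refine ⟨hf.1.add hg.1, ?_⟩
  rw [← hf.2, ← hg.2, wirtingerDeriv, fderiv_fun_add hf.1 hg.1]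
  simp only [wirtingerDeriv, add_apply]
  module

theorem HasWirtingerDerivAt.const_smul {f : ℂ → F} {a : F} {z : ℂ} (c : ℂ)
    (hf : HasWirtingerDerivAt f a z) : HasWirtingerDerivAt (fun w => c • f w) (c • a) z := by
  refine ⟨hf.1.const_smul c, ?_⟩
  rw [← hf.2, wirtingerDeriv, fderiv_fun_const_smul hf.1]
  simp only [wirtingerDeriv, smul_apply]
  module

theorem HasWirtingerDerivAt.sub {f g : ℂ → F} {a b : F} {z : ℂ} (hf : HasWirtingerDerivAt f a z)
    (hg : HasWirtingerDerivAt g b z) : HasWirtingerDerivAt (fun w => f w - g w) (a - b) z := by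
  have h := hf.add (hg.const_smul (-1))
  simpa only [neg_one_smul, ← sub_eq_add_neg] using h

theorem hasWirtingerDerivAt_const (c : F) (z : ℂ) : HasWirtingerDerivAt (fun _ => c) 0 z :=
  ⟨differentiableAt_const c, by simp [wirtingerDeriv]⟩

theorem HasWirtingerDerivAt.eq {f : ℂ → F} {a b : F} {z : ℂ} (ha : HasWirtingerDerivAt f a z)
    (hb : HasWirtingerDerivAt f b z) : a = b :=
  ha.2.symm.trans hb.2

/-- The derivative of a sesquilinear form along a quadratic curve. -/
theorem hasFDerivAt_sesquilinear {X N : Type*} [AddCommGroup X] [Module ℂ X] [AddCommGroup N]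
    [Module ℂ N] (s : X →ₗ[ℂ] X →ₛₗ[starRingEnd ℂ] N) (φ : N →ₗ[ℂ] F) (x y w : X) :
    HasFDerivAt (fun z : ℂ => φ (s (x + z • y + (z * z) • w) (x + z • y + (z * z) • w)))
      (wirtingerCLM (φ (s y x)) (φ (s x y))) 0 := by
  have hz : HasFDerivAt (fun z : ℂ => z) (ContinuousLinearMap.id ℝ ℂ) 0 := hasFDerivAt_id 0
  have hc : HasFDerivAt (fun z : ℂ => starRingEnd ℂ z) (Complex.conjCLE : ℂ →L[ℝ] ℂ) 0 :=
    Complex.conjCLE.hasFDerivAt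
  have h : ∀ z : ℂ, φ (s (x + z • y + (z * z) • w) (x + z • y + (z * z) • w)) =
      φ (s x x) + (z • φ (s y x) + starRingEnd ℂ z • φ (s x y)) +
        (z • (z • φ (s w x) + starRingEnd ℂ z • (φ (s y y) + z • φ (s w y) +
            starRingEnd ℂ z • φ (s y w) + z • starRingEnd ℂ z • φ (s w w))) +
          starRingEnd ℂ z • (starRingEnd ℂ z • φ (s x w))) := fun z => by
    simp only [map_add, map_smul, map_smulₛₗ, LinearMap.add_apply, LinearMap.smul_apply, map_mul]
    module
  simp only [h]
  have hg : DifferentiableAt ℝ (fun z : ℂ => z • φ (s w x) + starRingEnd ℂ z • (φ (s y y) +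
      z • φ (s w y) + starRingEnd ℂ z • φ (s y w) + z • starRingEnd ℂ z • φ (s w w))) 0 := by
    have := hz.differentiableAt
    have := hc.differentiableAt
    fun_prop
  have hk : DifferentiableAt ℝ (fun z : ℂ => starRingEnd ℂ z • φ (s x w)) 0 := by
    have := hc.differentiableAt
    fun_prop
  have h1 := ((hasFDerivAt_const (φ (s x x)) (0 : ℂ)).add
    ((hz.smul_const (φ (s y x))).add (hc.smul_const (φ (s x y))))).add
    ((hz.smul hg.hasFDerivAt).add (hc.smul hk.hasFDerivAt))
  refine h1.congr_fderiv ?_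
  ext v
  simp [wirtingerCLM]

theorem hasWirtingerDerivAt_sesquilinear {X N : Type*} [AddCommGroup X] [Module ℂ X]
    [AddCommGroup N] [Module ℂ N] (s : X →ₗ[ℂ] X →ₛₗ[starRingEnd ℂ] N) (φ : N →ₗ[ℂ] F)
    (x y w : X) : HasWirtingerDerivAt
      (fun z : ℂ => φ (s (x + z • y + (z * z) • w) (x + z • y + (z * z) • w))) (φ (s y x)) 0 :=
  hasWirtingerDerivAt_of_hasFDerivAt (hasFDerivAt_sesquilinear s φ x y w)

/-- Along a curve which is quadratic in the conjugate variable, the two terms of the derivative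
change places. -/
theorem hasWirtingerDerivAt_sesquilinear_conj {X N : Type*} [AddCommGroup X] [Module ℂ X]
    [AddCommGroup N] [Module ℂ N] (s : X →ₗ[ℂ] X →ₛₗ[starRingEnd ℂ] N) (φ : N →ₗ[ℂ] F)
    (x y w : X) : HasWirtingerDerivAt
      (fun z : ℂ => φ (s (x + starRingEnd ℂ z • y + (starRingEnd ℂ z * starRingEnd ℂ z) • w)
        (x + starRingEnd ℂ z • y + (starRingEnd ℂ z * starRingEnd ℂ z) • w))) (φ (s x y)) 0 := by
  have hc : HasFDerivAt (fun z : ℂ => starRingEnd ℂ z) (Complex.conjCLE : ℂ →L[ℝ] ℂ) 0 :=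
    Complex.conjCLE.hasFDerivAt
  have h := hasFDerivAt_sesquilinear s φ x y w
  rw [← map_zero (starRingEnd ℂ)] at h
  have h1 := h.comp (0 : ℂ) hc
  refine hasWirtingerDerivAt_of_hasFDerivAt (b := φ (s y x)) (h1.congr_fderiv ?_)
  ext v
  simp [wirtingerCLM, add_comm]

end Wirtinger

/-! ### Variations of the connection and of the sections -/

section Variations

variable {G : Type u} [Ring G] [HopfAlgebra ℂ G] [StarRing G] [StarModule ℂ G]
  {R : BicovariantCalculus G} {W : Type u} [Ring W] [Algebra ℂ W]
  {ℬ : ℕ → Submodule ℂ W} [GradedAlgebra ℬ] {E : Envelope R ℬ}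
  {A : Type*} [Ring A] [Algebra ℂ A] {𝒜 : ℕ → Submodule ℂ A} [GradedAlgebra 𝒜]
  {P : QuantumPrincipalBundle E 𝒜} {κ : Type*} [Fintype κ] [DecidableEq κ]
  {B : Type*} [CStarAlgebra B] [PartialOrder B] [StarOrderedRing B]
  {M : StarSubalgebra ℂ B} {V : Type*} [AddCommGroup V] [Module ℂ V] {α : V →ₗ[ℂ] V ⊗[ℂ] G}

namespace QuantumPrincipalBundle

theorem covD_add_smul (ω lam : R.Inv →ₗ[ℂ] A) (z : ℂ) :
    P.covD (ω + z • lam) = P.covD ω + z • P.covK lam := by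
  simp only [covD, covK, LinearMap.add_comp, LinearMap.smul_comp, TensorProduct.map_add_right,
    TensorProduct.map_smul_right, LinearMap.comp_add, LinearMap.comp_smul, neg_add, smul_neg,
    add_assoc]

theorem dualOp_add_smul (X Y : A →ₗ[ℂ] A) (z : ℂ) :
    P.dualOp (X + z • Y) = P.dualOp X + starRingEnd ℂ z • P.dualOp Y := by
  ext a
  simp [dualOp]

theorem dual_comp (X : A →ₗ[ℂ] A) (f : R.Inv →ₗ[ℂ] A) :
    P.dual (X ∘ₗ f) = P.dualOp X ∘ₗ P.dual f := by
  ext θ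
  simp [dual, dualOp, P.st_st]

theorem bracket_mem (Δ : E.EmbeddedDifferential) {k l : ℕ} {σ τ : R.Inv →ₗ[ℂ] A}
    (hσ : ∀ θ, σ θ ∈ 𝒜 k) (hτ : ∀ θ, τ θ ∈ 𝒜 l) (θ : R.Inv) : bracket Δ σ τ θ ∈ 𝒜 (k + l) := by
  have h : ∀ t, LinearMap.mul' ℂ A (TensorProduct.map σ τ t) ∈ 𝒜 (k + l) := fun t => by
    induction t with
    | zero => simp
    | add x y hx hy => simpa using Submodule.add_mem _ hx hy
    | tmul x y => exact SetLike.mul_mem_graded (hσ x) (hτ y)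
  exact h (Δ.δ θ)

theorem IsConnection.curvature_mem (Δ : E.EmbeddedDifferential) {ω : R.Inv →ₗ[ℂ] A}
    (hω : P.IsConnection ω) (θ : R.Inv) : P.curvature Δ ω θ ∈ 𝒜 2 :=
  Submodule.sub_mem _ (P.d_mem (hω θ).1)
    (bracket_mem Δ (fun θ => (hω θ).1) (fun θ => (hω θ).1) θ)

theorem mem_of_basis_mem (e : Module.Basis κ ℂ V) {τ : V →ₗ[ℂ] A} {k : ℕ}
    (h : ∀ i, τ (e i) ∈ 𝒜 k) (v : V) : τ v ∈ 𝒜 k := by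
  rw [← e.sum_repr v, map_sum]
  exact Submodule.sum_mem _ fun i _ => by
    rw [map_smul]
    exact Submodule.smul_mem _ _ (h i)

section Section

variable {e : Module.Basis κ ℂ V} {m : Matrix κ κ G}

theorem covD_comp_mem_horMor (he : ∀ i, α (e i) = ∑ j, e j ⊗ₜ[ℂ] m j i) (hm : IsMatrixCorep m)
    {ω : R.Inv →ₗ[ℂ] A} (hω : P.IsConnection ω) {τ : V →ₗ[ℂ] A} (hτ : τ ∈ P.horMor α) {k : ℕ}
    (hk : ∀ v, τ v ∈ 𝒜 k) : P.covD ω ∘ₗ τ ∈ P.horMor α :=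
  (P.mem_horMor_iff e he _).2 (((P.mem_horMor_iff e he _).1 hτ).covD hm (fun _ => hk _) hω)

theorem covD_comp_mem (he : ∀ i, α (e i) = ∑ j, e j ⊗ₜ[ℂ] m j i)
    {ω : R.Inv →ₗ[ℂ] A} (hω : P.IsConnection ω) {τ : V →ₗ[ℂ] A} (hτ : τ ∈ P.horMor α) {k : ℕ}
    (hk : ∀ v, τ v ∈ 𝒜 k) (v : V) : (P.covD ω ∘ₗ τ) v ∈ 𝒜 (k + 1) :=
  mem_of_basis_mem e (((P.mem_horMor_iff e he _).1 hτ).covD_mem (fun _ => hk _)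
    fun θ => (hω θ).1) v

theorem covK_comp_mem_horMor (he : ∀ i, α (e i) = ∑ j, e j ⊗ₜ[ℂ] m j i) (hm : IsMatrixCorep m)
    {ω lam : R.Inv →ₗ[ℂ] A} (hω : P.IsConnection ω) (h : P.IsDisplacement lam) {τ : V →ₗ[ℂ] A}
    (hτ : τ ∈ P.horMor α) {k : ℕ} (hk : ∀ v, τ v ∈ 𝒜 k) : P.covK lam ∘ₗ τ ∈ P.horMor α := by
  have h1 := covD_add_smul (P := P) ω lam 1
  rw [one_smul, one_smul] at h1
  have h2 := Submodule.sub_mem _ (covD_comp_mem_horMor he hm (hω.add h) hτ hk)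
    (covD_comp_mem_horMor he hm hω hτ hk)
  rwa [h1, LinearMap.add_comp, add_sub_cancel_left] at h2

theorem dualOp_covD_comp_mem_horMor
    (hs : ∀ g : G, Coalgebra.comul (R := ℂ) (star g) = star (Coalgebra.comul (R := ℂ) g))
    (he : ∀ i, α (e i) = ∑ j, e j ⊗ₜ[ℂ] m j i) (hm : IsMatrixCorep m)
    {ω : R.Inv →ₗ[ℂ] A} (hω : P.IsConnection ω) {τ : V →ₗ[ℂ] A} (hτ : τ ∈ P.horMor α) {k : ℕ}
    (hk : ∀ v, τ v ∈ 𝒜 k) : P.dualOp (P.covD ω) ∘ₗ τ ∈ P.horMor α :=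
  (P.mem_horMor_iff e he _).2
    (((P.mem_horMor_iff e he _).1 hτ).dualOp_covD hs hm (fun _ => hk _) hω)

theorem dualOp_covD_comp_mem (he : ∀ i, α (e i) = ∑ j, e j ⊗ₜ[ℂ] m j i)
    {ω : R.Inv →ₗ[ℂ] A} (hω : P.IsConnection ω) {τ : V →ₗ[ℂ] A} (hτ : τ ∈ P.horMor α) {k : ℕ}
    (hk : ∀ v, τ v ∈ 𝒜 k) (v : V) : (P.dualOp (P.covD ω) ∘ₗ τ) v ∈ 𝒜 (k + 1) :=
  mem_of_basis_mem e (((P.mem_horMor_iff e he _).1 hτ).dualOp_covD_mem (fun _ => hk _)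
    fun θ => (hω θ).1) v

theorem dualOp_covK_comp_mem_horMor
    (hs : ∀ g : G, Coalgebra.comul (R := ℂ) (star g) = star (Coalgebra.comul (R := ℂ) g))
    (he : ∀ i, α (e i) = ∑ j, e j ⊗ₜ[ℂ] m j i) (hm : IsMatrixCorep m)
    {ω lam : R.Inv →ₗ[ℂ] A} (hω : P.IsConnection ω) (h : P.IsDisplacement lam) {τ : V →ₗ[ℂ] A}
    (hτ : τ ∈ P.horMor α) {k : ℕ} (hk : ∀ v, τ v ∈ 𝒜 k) :
    P.dualOp (P.covK lam) ∘ₗ τ ∈ P.horMor α := by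
  have h1 := congrArg P.dualOp (covD_add_smul (P := P) ω lam 1)
  rw [dualOp_add_smul, map_one, one_smul, one_smul] at h1
  have h2 := Submodule.sub_mem _ (dualOp_covD_comp_mem_horMor hs he hm (hω.add h) hτ hk)
    (dualOp_covD_comp_mem_horMor hs he hm hω hτ hk)
  rwa [h1, LinearMap.add_comp, add_sub_cancel_left] at h2

end Section

end QuantumPrincipalBundle

namespace BaseGeometry

open QuantumPrincipalBundle

variable (Γ : BaseGeometry P M)

theorem dNablaL_ofSectionL (ω : R.Inv →ₗ[ℂ] A) (S : P.sections α) :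
    Γ.dNablaL ω (Γ.ofSectionL S) = Γ.nablaL ω S := by
  rw [dNablaL, mulFormL_ofSectionL, nablaL]

theorem dNablaR_ofSectionR (ω : R.Inv →ₗ[ℂ] A) (S : P.sections α) :
    Γ.dNablaR ω (Γ.ofSectionR S) = Γ.nablaR ω S := by
  rw [dNablaR, mulFormR_ofSectionR, nablaR]

theorem ofSectionL_add_smul (S U : P.sections α) (z : ℂ) :
    Γ.ofSectionL (S + z • U) = Γ.ofSectionL S + z • Γ.ofSectionL U := by
  have h : ∀ T : P.sections α,
      Γ.ofSectionL T = (Γ.relL α).mkQ (TensorProduct.mk ℂ P.baseForms (P.sections α) 1 T) :=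
    fun _ => rfl
  rw [h, h, h, map_add, map_smul, map_add, map_smul]

theorem ofSectionR_add_smul (S U : P.sections α) (z : ℂ) :
    Γ.ofSectionR (S + z • U) = Γ.ofSectionR S + z • Γ.ofSectionR U := by
  have h : ∀ T : P.sections α,
      Γ.ofSectionR T = (Γ.relR α).mkQ ((TensorProduct.mk ℂ (P.sections α) P.baseForms).flip 1 T) :=
    fun _ => rfl
  rw [h, h, h, map_add, map_smul, map_add, map_smul]

theorem ofSectionL_sub (S U : P.sections α) :
    Γ.ofSectionL (S - U) = Γ.ofSectionL S - Γ.ofSectionL U := by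
  rw [sub_eq_add_neg S U, ← neg_one_smul ℂ U, ofSectionL_add_smul, neg_one_smul,
    ← sub_eq_add_neg]

theorem ofSectionR_sub (S U : P.sections α) :
    Γ.ofSectionR (S - U) = Γ.ofSectionR S - Γ.ofSectionR U := by
  rw [sub_eq_add_neg S U, ← neg_one_smul ℂ U, ofSectionR_add_smul, neg_one_smul,
    ← sub_eq_add_neg]

theorem ofSectionL_zero : Γ.ofSectionL (0 : P.sections α) = 0 := by
  rw [← sub_self (0 : P.sections α), ofSectionL_sub, sub_self]

theorem ofSectionR_zero : Γ.ofSectionR (0 : P.sections α) = 0 := by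
  rw [← sub_self (0 : P.sections α), ofSectionR_sub, sub_self]

theorem innerL_sub_right (b : UnitaryBasis α κ) (x y z : Γ.FormsL α) :
    Γ.innerL b x (y - z) = Γ.innerL b x y - Γ.innerL b x z := by
  simp only [innerL, map_sub]

theorem innerL_sub_left (b : UnitaryBasis α κ) (x y z : Γ.FormsL α) :
    Γ.innerL b (x - y) z = Γ.innerL b x z - Γ.innerL b y z := by
  simp only [innerL, map_sub, LinearMap.sub_apply]

theorem innerR_sub_right (b : ConjUnitaryBasis α κ) (x y z : Γ.FormsR α) :
    Γ.innerR b x (y - z) = Γ.innerR b x y - Γ.innerR b x z := by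
  simp only [innerR, map_sub]

theorem innerR_sub_left (b : ConjUnitaryBasis α κ) (x y z : Γ.FormsR α) :
    Γ.innerR b (x - y) z = Γ.innerR b x z - Γ.innerR b y z := by
  simp only [innerR, map_sub, LinearMap.sub_apply]

theorem innerL_zero_left (b : UnitaryBasis α κ) (x : Γ.FormsL α) : Γ.innerL b 0 x = 0 := by
  simp [innerL]

theorem innerR_zero_right (b : ConjUnitaryBasis α κ) (x : Γ.FormsR α) : Γ.innerR b x 0 = 0 := by
  simp [innerR]

section Left

variable {b : UnitaryBasis α κ} {N : ℕ} {T : Fin N → P.sections α} {ω : R.Inv →ₗ[ℂ] A}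

theorem mulFormL_nablaL_mem (hb : IsMatrixCorep b.mat) (hT : P.IsFrameL b T)
    (hω : P.IsConnection ω) (S : P.sections α) (v : V) : Γ.mulFormL (Γ.nablaL ω S) v ∈ 𝒜 1 := by
  have hS := S.2.1
  rw [nablaL, Γ.mulFormL_upsilonL hT (covD_comp_mem_horMor b.coact hb hω hS S.2.2)]
  exact covD_comp_mem b.coact hω hS S.2.2 v

theorem nablaL_add_smul_section (hb : IsMatrixCorep b.mat) (hT : P.IsFrameL b T)
    (hω : P.IsConnection ω) (S U : P.sections α) (z : ℂ) :
    Γ.nablaL ω (S + z • U) = Γ.nablaL ω S + z • Γ.nablaL ω U := by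
  have h : ∀ S : P.sections α, P.covD ω ∘ₗ S.1 ∈ P.horMor α := fun S =>
    covD_comp_mem_horMor b.coact hb hω S.2.1 S.2.2
  have h1 : (S + z • U).1 = S.1 + z • U.1 := rfl
  rw [nablaL, h1, LinearMap.comp_add, LinearMap.comp_smul,
    Γ.upsilonL_add hT (h S) (Submodule.smul_mem _ z (h U)), Γ.upsilonL_smul hT z (h U), nablaL,
    nablaL]

theorem nablaL_add_smul_connection (hb : IsMatrixCorep b.mat) (hT : P.IsFrameL b T)
    (hω : P.IsConnection ω) {lam : R.Inv →ₗ[ℂ] A} (h : P.IsDisplacement lam) (S : P.sections α)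
    (z : ℂ) : Γ.nablaL (ω + z • lam) S = Γ.nablaL ω S + z • Γ.upsilonL (P.covK lam ∘ₗ S.1) := by
  have hS := S.2.1
  have h1 := covD_comp_mem_horMor b.coact hb hω hS S.2.2
  have h2 := covK_comp_mem_horMor b.coact hb hω h hS S.2.2
  rw [nablaL, covD_add_smul, LinearMap.add_comp, LinearMap.smul_comp,
    Γ.upsilonL_add hT h1 (Submodule.smul_mem _ z h2), Γ.upsilonL_smul hT z h2, nablaL]

theorem hasWirtingerDerivAt_nablaL_connection (hb : IsMatrixCorep b.mat) (hT : P.IsFrameL b T)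
    (hω : P.IsConnection ω) {lam : R.Inv →ₗ[ℂ] A} (h : P.IsDisplacement lam) (S : P.sections α) :
    HasWirtingerDerivAt
      (fun z : ℂ => Γ.innerL b (Γ.nablaL (ω + z • lam) S) (Γ.nablaL (ω + z • lam) S))
      (Γ.innerL b (Γ.upsilonL (P.covK lam ∘ₗ S.1)) (Γ.nablaL ω S)) 0 := by
  have h1 := hasWirtingerDerivAt_sesquilinear (Γ.hermitianFormL b) Γ.state (Γ.nablaL ω S)
    (Γ.upsilonL (P.covK lam ∘ₗ S.1)) 0
  simp only [smul_zero, add_zero] at h1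
  simp only [Γ.nablaL_add_smul_connection hb hT hω h]
  exact h1

theorem hasWirtingerDerivAt_nablaL_section (hb : IsMatrixCorep b.mat) (hT : P.IsFrameL b T)
    (hω : P.IsConnection ω) (hω' : P.IsConnection (P.dual ω)) (S U : P.sections α) :
    HasWirtingerDerivAt
      (fun z : ℂ => Γ.innerL b (Γ.nablaL ω (S + z • U)) (Γ.nablaL ω (S + z • U)))
      (Γ.innerL b (Γ.ofSectionL U) (Γ.codiffL 1 ω (Γ.nablaL ω S))) 0 := by
  have h1 := hasWirtingerDerivAt_sesquilinear (Γ.hermitianFormL b) Γ.state (Γ.nablaL ω S)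
    (Γ.nablaL ω U) 0
  have h2 : Γ.innerL b (Γ.dNablaL ω (Γ.ofSectionL U)) (Γ.nablaL ω S) =
      Γ.innerL b (Γ.ofSectionL U) (Γ.codiffL 1 ω (Γ.nablaL ω S)) :=
    Γ.innerL_dNablaL hb hT hω hω' (k := 0) (by rw [mulFormL_ofSectionL]; exact U.2.2)
      (Γ.mulFormL_nablaL_mem hb hT hω S)
  rw [dNablaL_ofSectionL] at h2
  simp only [smul_zero, add_zero] at h1
  simp only [Γ.nablaL_add_smul_section hb hT hω]
  rw [← h2]
  exact h1

end Left

section Right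

variable {κ' : Type*} [Fintype κ'] [DecidableEq κ'] {b' : ConjUnitaryBasis α κ'}
  {b : ConjUnitaryBasis α κ} {N : ℕ} {T : Fin N → P.sections α} {ω : R.Inv →ₗ[ℂ] A}

theorem mulFormR_nablaR_mem
    (hs : ∀ g : G, Coalgebra.comul (R := ℂ) (star g) = star (Coalgebra.comul (R := ℂ) g))
    (hb : IsMatrixCorep b.mat) (hT : P.IsFrameR b T)
    (hω : P.IsConnection ω) (S : P.sections α) (v : V) : Γ.mulFormR (Γ.nablaR ω S) v ∈ 𝒜 1 := by
  have hS := S.2.1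
  rw [nablaR, Γ.mulFormR_upsilonR hT (dualOp_covD_comp_mem_horMor hs b.coact hb hω hS S.2.2)]
  exact dualOp_covD_comp_mem b.coact hω hS S.2.2 v

theorem nablaR_add_smul_section
    (hs : ∀ g : G, Coalgebra.comul (R := ℂ) (star g) = star (Coalgebra.comul (R := ℂ) g))
    (hb : IsMatrixCorep b.mat) (hT : P.IsFrameR b T)
    (hω : P.IsConnection ω) (S U : P.sections α) (z : ℂ) :
    Γ.nablaR ω (S + z • U) = Γ.nablaR ω S + z • Γ.nablaR ω U := by
  have h : ∀ S : P.sections α, P.dualOp (P.covD ω) ∘ₗ S.1 ∈ P.horMor α := fun S =>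
    dualOp_covD_comp_mem_horMor hs b.coact hb hω S.2.1 S.2.2
  have h1 : (S + z • U).1 = S.1 + z • U.1 := rfl
  rw [nablaR, h1, LinearMap.comp_add, LinearMap.comp_smul,
    Γ.upsilonR_add hT (h S) (Submodule.smul_mem _ z (h U)), Γ.upsilonR_smul hT z (h U), nablaR,
    nablaR]

theorem nablaR_add_smul_connection
    (hs : ∀ g : G, Coalgebra.comul (R := ℂ) (star g) = star (Coalgebra.comul (R := ℂ) g))
    (hb : IsMatrixCorep b.mat) (hT : P.IsFrameR b T)
    (hω : P.IsConnection ω) {lam : R.Inv →ₗ[ℂ] A} (h : P.IsDisplacement lam) (S : P.sections α)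
    (z : ℂ) : Γ.nablaR (ω + z • lam) S =
      Γ.nablaR ω S + starRingEnd ℂ z • Γ.upsilonR (P.dualOp (P.covK lam) ∘ₗ S.1) := by
  have hS := S.2.1
  have h1 := dualOp_covD_comp_mem_horMor hs b.coact hb hω hS S.2.2
  have h2 := dualOp_covK_comp_mem_horMor hs b.coact hb hω h hS S.2.2
  rw [nablaR, covD_add_smul, dualOp_add_smul, LinearMap.add_comp, LinearMap.smul_comp,
    Γ.upsilonR_add hT h1 (Submodule.smul_mem _ _ h2), Γ.upsilonR_smul hT _ h2, nablaR]

theorem hasWirtingerDerivAt_nablaR_connection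
    (hs : ∀ g : G, Coalgebra.comul (R := ℂ) (star g) = star (Coalgebra.comul (R := ℂ) g))
    (hb : IsMatrixCorep b.mat) (hT : P.IsFrameR b T)
    (hω : P.IsConnection ω) {lam : R.Inv →ₗ[ℂ] A} (h : P.IsDisplacement lam) (S : P.sections α) :
    HasWirtingerDerivAt
      (fun z : ℂ => Γ.innerR b (Γ.nablaR (ω + z • lam) S) (Γ.nablaR (ω + z • lam) S))
      (Γ.innerR b (Γ.upsilonR (P.dualOp (P.covK lam) ∘ₗ S.1)) (Γ.nablaR ω S)) 0 := by
  have h1 := hasWirtingerDerivAt_sesquilinear_conj (Γ.hermitianFormR b).flip Γ.state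
    (Γ.nablaR ω S) (Γ.upsilonR (P.dualOp (P.covK lam) ∘ₗ S.1)) 0
  simp only [smul_zero, add_zero] at h1
  simp only [Γ.nablaR_add_smul_connection hs hb hT hω h]
  exact h1

theorem hasWirtingerDerivAt_nablaR_section
    (hs : ∀ g : G, Coalgebra.comul (R := ℂ) (star g) = star (Coalgebra.comul (R := ℂ) g))
    (hb : IsMatrixCorep b.mat) (hT : P.IsFrameR b T)
    (hω : P.IsConnection ω) (hω' : P.IsConnection (P.dual ω)) (S U : P.sections α) :
    HasWirtingerDerivAt
      (fun z : ℂ => Γ.innerR b (Γ.nablaR ω (S + z • U)) (Γ.nablaR ω (S + z • U)))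
      (Γ.innerR b (Γ.codiffR 1 ω (Γ.nablaR ω S)) (Γ.ofSectionR U)) 0 := by
  have h1 := hasWirtingerDerivAt_sesquilinear (Γ.hermitianFormR b).flip Γ.state (Γ.nablaR ω S)
    (Γ.nablaR ω U) 0
  have h2 : Γ.innerR b (Γ.dNablaR ω (Γ.ofSectionR U)) (Γ.nablaR ω S) =
      Γ.innerR b (Γ.ofSectionR U) (Γ.codiffR 1 ω (Γ.nablaR ω S)) :=
    Γ.innerR_dNablaR hs hb hT hω hω' (k := 0) (by rw [mulFormR_ofSectionR]; exact U.2.2)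
      (Γ.mulFormR_nablaR_mem hs hb hT hω S)
  rw [dNablaR_ofSectionR] at h2
  simp only [smul_zero, add_zero] at h1
  simp only [Γ.nablaR_add_smul_section hs hb hT hω]
  rw [← innerR_symm, ← h2, innerR_symm]
  exact h1

end Right

end BaseGeometry

end Variations

/-! ### The variation of the Yang-Mills action -/

section ModelVariations

variable {G : Type u} [Ring G] [HopfAlgebra ℂ G] [StarRing G] [StarModule ℂ G]
  {R : BicovariantCalculus G} {W : Type u} [Ring W] [Algebra ℂ W]
  {ℬ : ℕ → Submodule ℂ W} [GradedAlgebra ℬ] {E : Envelope R ℬ}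
  {A : Type*} [Ring A] [Algebra ℂ A] {𝒜 : ℕ → Submodule ℂ A} [GradedAlgebra 𝒜]
  {B : Type*} [CStarAlgebra B] [PartialOrder B] [StarOrderedRing B]
  {P : QuantumPrincipalBundle E 𝒜} {M : StarSubalgebra ℂ B}
  {V : Type*} [AddCommGroup V] [Module ℂ V] {Γ : BaseGeometry P M} {α : V →ₗ[ℂ] V ⊗[ℂ] G}
  {κ κ₁ κ₂ : Type*} [Fintype κ] [DecidableEq κ] [Fintype κ₁] [DecidableEq κ₁]
  [Fintype κ₂] [DecidableEq κ₂]

namespace YMSMModel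

open QuantumPrincipalBundle

variable (𝔐 : YMSMModel Γ α κ κ₁ κ₂)

theorem isMatrixCorep_basis : IsMatrixCorep 𝔐.basis.mat :=
  𝔐.corep.isMatrixCorep 𝔐.basis.e 𝔐.basis.coact

theorem isMatrixCorep_basis_conj (hG : IsCompactMatrixQuantumGroup G) :
    IsMatrixCorep 𝔐.basis.conj.mat :=
  𝔐.isMatrixCorep_basis.map_star hG.comul_star

theorem isMatrixCorep_adBasisL (hG : IsCompactMatrixQuantumGroup G) :
    IsMatrixCorep 𝔐.adBasisL.mat :=
  (BicovariantCalculus.isCorep_ad hG).isMatrixCorep 𝔐.adBasisL.e 𝔐.adBasisL.coact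

theorem isMatrixCorep_adBasisR (hG : IsCompactMatrixQuantumGroup G) :
    IsMatrixCorep 𝔐.adBasisR.mat :=
  (BicovariantCalculus.isCorep_ad hG).isMatrixCorep 𝔐.adBasisR.e 𝔐.adBasisR.coact

section Curvature

variable {ω lam : R.Inv →ₗ[ℂ] A}

theorem bracket_mem_horMor (h : P.IsDisplacement lam) : bracket 𝔐.Δ lam lam ∈ P.horMor R.ad :=
  QuantumPrincipalBundle.bracket_mem_horMor 𝔐.Δ 𝔐.adBasisL.e 𝔐.adBasisL.coact h.2 h.2

theorem curvature_mem_horMor (hG : IsCompactMatrixQuantumGroup G) (hω : P.IsConnection ω) :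
    P.curvature 𝔐.Δ ω ∈ P.horMor R.ad :=
  hω.curvature_mem_horMor 𝔐.Δ 𝔐.adBasisL.e hG 𝔐.adBasisL.coact

/-- The linear part of the variation of the curvature is a difference of two curvatures, up to
a bracket of displacements, and hence horizontal and covariant. -/
theorem covD_sub_opS_mem_horMor (hG : IsCompactMatrixQuantumGroup G) (hω : P.IsConnection ω)
    (h : P.IsDisplacement lam) : P.covD ω ∘ₗ lam - opS 𝒜 𝔐.Δ ω lam ∈ P.horMor R.ad := by
  have h1 := Submodule.add_mem _ (Submodule.sub_mem _ (𝔐.curvature_mem_horMor hG (hω.add h))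
    (𝔐.curvature_mem_horMor hG hω)) (𝔐.bracket_mem_horMor h)
  have h2 := curvature_add_smul (P := P) 𝔐.Δ ω lam 1
  rw [one_smul, one_smul, mul_one, one_smul, ← h.covD_comp_sub_opS] at h2
  rw [h2] at h1
  convert h1 using 1
  abel

theorem opS_mem_horMor (hG : IsCompactMatrixQuantumGroup G) (hω : P.IsConnection ω)
    (h : P.IsDisplacement lam) : opS 𝒜 𝔐.Δ ω lam ∈ P.horMor R.ad := by
  have h1 := Submodule.sub_mem _ (covD_comp_mem_horMor 𝔐.adBasisL.coact
    (𝔐.isMatrixCorep_adBasisL hG) hω h.2 h.1) (𝔐.covD_sub_opS_mem_horMor hG hω h)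
  rwa [sub_sub_cancel] at h1

theorem curvature_add_smul (h : P.IsDisplacement lam) (z : ℂ) : P.curvature 𝔐.Δ (ω + z • lam) =
    P.curvature 𝔐.Δ ω + z • (P.covD ω ∘ₗ lam - opS 𝒜 𝔐.Δ ω lam) +
      (z * z) • -bracket 𝔐.Δ lam lam := by
  rw [QuantumPrincipalBundle.curvature_add_smul, h.covD_comp_sub_opS, smul_neg, sub_eq_add_neg]

/-- The variation of the Yang-Mills term of the left bundle: moving the exterior covariant
derivative and `S^ω` to the other side of the inner product gives the current. -/
theorem hasWirtingerDerivAt_curvL (hG : IsCompactMatrixQuantumGroup G) (hω : P.IsConnection ω)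
    (h : P.IsDisplacement lam) :
    HasWirtingerDerivAt
      (fun z : ℂ => Γ.innerL 𝔐.adBasisL (𝔐.curvL (ω + z • lam)) (𝔐.curvL (ω + z • lam)))
      (Γ.innerL 𝔐.adBasisL (Γ.upsilonL lam) (𝔐.ymCurrentL ω)) 0 := by
  obtain ⟨N, T, hT⟩ : ∃ (N : ℕ) (T : Fin N → P.sections R.ad), P.IsFrameL 𝔐.adBasisL T :=
    𝔐.adFrame
  have hc := 𝔐.curvature_mem_horMor hG hω
  have hX := 𝔐.covD_sub_opS_mem_horMor hG hω h
  have hb := neg_mem (𝔐.bracket_mem_horMor h)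
  have hS := 𝔐.opS_mem_horMor hG hω h
  have h1 : ∀ z : ℂ, 𝔐.curvL (ω + z • lam) = 𝔐.curvL ω +
      z • Γ.upsilonL (P.covD ω ∘ₗ lam - opS 𝒜 𝔐.Δ ω lam) +
        (z * z) • Γ.upsilonL (-bracket 𝔐.Δ lam lam) := fun z => by
    rw [curvL, 𝔐.curvature_add_smul h,
      Γ.upsilonL_add hT (add_mem hc (Submodule.smul_mem _ _ hX)) (Submodule.smul_mem _ _ hb),
      Γ.upsilonL_add hT hc (Submodule.smul_mem _ _ hX), Γ.upsilonL_smul hT _ hX,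
      Γ.upsilonL_smul hT _ hb, curvL]
  have h2 := hasWirtingerDerivAt_sesquilinear (Γ.hermitianFormL 𝔐.adBasisL) Γ.state (𝔐.curvL ω)
    (Γ.upsilonL (P.covD ω ∘ₗ lam - opS 𝒜 𝔐.Δ ω lam)) (Γ.upsilonL (-bracket 𝔐.Δ lam lam))
  have h3 : Γ.upsilonL (P.covD ω ∘ₗ lam - opS 𝒜 𝔐.Δ ω lam) =
      Γ.dNablaL ω (Γ.upsilonL lam) - Γ.dSL 𝔐.Δ ω (Γ.upsilonL lam) := by
    rw [BaseGeometry.dNablaL, BaseGeometry.dSL, Γ.mulFormL_upsilonL hT h.2, eq_sub_iff_add_eq,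
      ← Γ.upsilonL_add hT hX hS, sub_add_cancel]
  have h4 : Γ.IsAdjointL 𝔐.adBasisL (Γ.dSL 𝔐.Δ ω) (Γ.adjointL 𝔐.adBasisL (Γ.dSL 𝔐.Δ ω)) :=
    Classical.epsilon_spec (𝔐.adjointable_L ω hω)
  have h5 := Γ.innerL_dNablaL (𝔐.isMatrixCorep_adBasisL hG) hT hω (hω.dual hG) (k := 1)
    (x := Γ.upsilonL lam) (y := 𝔐.curvL ω) (by rw [Γ.mulFormL_upsilonL hT h.2]; exact h.1)
    (by rw [curvL, Γ.mulFormL_upsilonL hT hc]; exact hω.curvature_mem 𝔐.Δ)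
  have h6 : Γ.innerL 𝔐.adBasisL (Γ.upsilonL (P.covD ω ∘ₗ lam - opS 𝒜 𝔐.Δ ω lam)) (𝔐.curvL ω) =
      Γ.innerL 𝔐.adBasisL (Γ.upsilonL lam) (𝔐.ymCurrentL ω) := by
    rw [h3, Γ.innerL_sub_left, h5, h4, ← Γ.innerL_sub_right, ymCurrentL]
  simp only [h1]
  rw [← h6]
  exact h2

theorem hasWirtingerDerivAt_curvR (hG : IsCompactMatrixQuantumGroup G) (hω : P.IsConnection ω)
    (h : P.IsDisplacement lam) :
    HasWirtingerDerivAt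
      (fun z : ℂ => Γ.innerR 𝔐.adBasisR (𝔐.curvR (ω + z • lam)) (𝔐.curvR (ω + z • lam)))
      (Γ.innerR 𝔐.adBasisR (Γ.upsilonR (P.dual lam)) (𝔐.ymCurrentR ω)) 0 := by
  obtain ⟨b, N, T, hT⟩ := exists_isFrameR_ad hG 𝔐.adFrame
  have hc := dual_mem_horMor hG (𝔐.curvature_mem_horMor hG hω)
  have hX := dual_mem_horMor hG (𝔐.covD_sub_opS_mem_horMor hG hω h)
  have hb := dual_mem_horMor hG (neg_mem (𝔐.bracket_mem_horMor h))
  have hl := dual_mem_horMor hG h.2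
  have hS := dual_mem_horMor hG (𝔐.opS_mem_horMor hG hω h)
  have h1 : ∀ z : ℂ, 𝔐.curvR (ω + z • lam) = 𝔐.curvR ω +
      starRingEnd ℂ z • Γ.upsilonR (P.dual (P.covD ω ∘ₗ lam - opS 𝒜 𝔐.Δ ω lam)) +
        (starRingEnd ℂ z * starRingEnd ℂ z) •
          Γ.upsilonR (P.dual (-bracket 𝔐.Δ lam lam)) := fun z => by
    rw [curvR, 𝔐.curvature_add_smul h, dual_add, dual_add, dual_smul, dual_smul, map_mul,
      Γ.upsilonR_add hT (add_mem hc (Submodule.smul_mem _ _ hX)) (Submodule.smul_mem _ _ hb),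
      Γ.upsilonR_add hT hc (Submodule.smul_mem _ _ hX), Γ.upsilonR_smul hT _ hX,
      Γ.upsilonR_smul hT _ hb, curvR]
  have h2 := hasWirtingerDerivAt_sesquilinear_conj (Γ.hermitianFormR 𝔐.adBasisR).flip Γ.state
    (𝔐.curvR ω) (Γ.upsilonR (P.dual (P.covD ω ∘ₗ lam - opS 𝒜 𝔐.Δ ω lam)))
    (Γ.upsilonR (P.dual (-bracket 𝔐.Δ lam lam)))
  have h3 : Γ.upsilonR (P.dual (P.covD ω ∘ₗ lam - opS 𝒜 𝔐.Δ ω lam)) =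
      Γ.dNablaR ω (Γ.upsilonR (P.dual lam)) - Γ.dSR 𝔐.Δ ω (Γ.upsilonR (P.dual lam)) := by
    rw [BaseGeometry.dNablaR, BaseGeometry.dSR, Γ.mulFormR_upsilonR hT hl, dual_dual hG,
      ← dual_comp, eq_sub_iff_add_eq, ← Γ.upsilonR_add hT hX hS, ← dual_add, sub_add_cancel]
  have h4 : Γ.IsAdjointR 𝔐.adBasisR (Γ.dSR 𝔐.Δ ω) (Γ.adjointR 𝔐.adBasisR (Γ.dSR 𝔐.Δ ω)) :=
    Classical.epsilon_spec (𝔐.adjointable_R ω hω)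
  have h5 := Γ.innerR_dNablaR hG.comul_star (𝔐.isMatrixCorep_adBasisR hG) hT hω (hω.dual hG)
    (k := 1) (x := Γ.upsilonR (P.dual lam)) (y := 𝔐.curvR ω)
    (by rw [Γ.mulFormR_upsilonR hT hl]; exact fun θ => P.st_mem (h.1 _))
    (by rw [curvR, Γ.mulFormR_upsilonR hT hc]; exact fun θ => P.st_mem (hω.curvature_mem 𝔐.Δ _))
  have h6 : Γ.innerR 𝔐.adBasisR (Γ.upsilonR (P.dual (P.covD ω ∘ₗ lam - opS 𝒜 𝔐.Δ ω lam)))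
      (𝔐.curvR ω) = Γ.innerR 𝔐.adBasisR (Γ.upsilonR (P.dual lam)) (𝔐.ymCurrentR ω) := by
    rw [h3, Γ.innerR_sub_left, h5, h4, ← Γ.innerR_sub_right, ymCurrentR]
  simp only [h1]
  rw [← h6]
  exact h2

end Curvature

/-! ### The potential -/

/-- The chain rule for the potential. The defining property of its derivative applies to
self-adjoint directions, and the derivative of a self-adjoint curve with `∂N/∂z = a` has
the self-adjoint values `a + a*` and `i (a - a*)` on the real basis `1`, `i`. -/
theorem state_wirtingerDeriv_pot {F : ℂ → M} {a : M} (hF : IsSelfAdjoint (F 0))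
    (h : HasFDerivAt F (wirtingerCLM a (star a)) 0) :
    Γ.state (wirtingerDeriv (fun z => 𝔐.pot (F z)) 0) = Γ.state (𝔐.potDeriv (F 0) * a) := by
  have h1 : HasFDerivAt (fun z => 𝔐.pot (F z))
      ((fderiv ℝ 𝔐.pot (F 0)).comp (wirtingerCLM a (star a))) 0 :=
    (𝔐.pot_differentiable (F 0)).hasFDerivAt.comp (0 : ℂ) h
  have h2 := 𝔐.potDeriv_spec (F 0) (a + star a) hF (IsSelfAdjoint.add_star_self a)
  have h3 := 𝔐.potDeriv_spec (F 0) (Complex.I • a + (-Complex.I) • star a) hF (by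
    rw [IsSelfAdjoint, star_add, star_smul, star_smul, star_star, star_neg]
    simp [add_comm])
  rw [wirtingerDeriv_of_hasFDerivAt h1, ContinuousLinearMap.comp_apply,
    ContinuousLinearMap.comp_apply, wirtingerCLM_apply, wirtingerCLM_apply, map_one,
    Complex.conj_I, one_smul, one_smul, map_smul, map_sub, map_smul, h2, h3]
  simp only [mul_add, mul_smul_comm, map_add, map_smul, smul_eq_mul]
  linear_combination (-1 / 2 * Γ.state (𝔐.potDeriv (F 0) * a) +
    1 / 2 * Γ.state (𝔐.potDeriv (F 0) * star a)) * Complex.I_mul_I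

theorem hasWirtingerDerivAt_potL {T₁ : P.sections α} {T₂ : P.sections (conjCorep α)}
    (h_int : 𝔐.Interchange T₁ T₂) (h_sym : 𝔐.Symmetric T₁ T₂) (U : P.sections α) :
    HasWirtingerDerivAt (fun z : ℂ => Γ.state (𝔐.potL (T₁ + z • U)))
      (Γ.innerL 𝔐.basis (Γ.ofSectionL U)
        (Γ.ofSectionL (Γ.smulL (star (𝔐.potDerivL T₁)) T₁))) 0 := by
  have h1 := hasFDerivAt_sesquilinear (Γ.hermitianFormL 𝔐.basis) LinearMap.id
    (Γ.ofSectionL T₁) (Γ.ofSectionL U) 0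
  simp only [smul_zero, add_zero, ← Γ.ofSectionL_add_smul, LinearMap.id_apply,
    Γ.hermitianFormL_ofSectionL] at h1
  rw [← Γ.star_toBase_hermitianL 𝔐.basis U T₁] at h1
  have h0 : 𝔐.normL (T₁ + (0 : ℂ) • U) = 𝔐.normL T₁ := by rw [zero_smul, add_zero]
  have h2 := 𝔐.state_wirtingerDeriv_pot (F := fun z : ℂ => 𝔐.normL (T₁ + z • U))
    (Γ.star_toBase_hermitianL 𝔐.basis _ _) h1
  rw [h0] at h2
  have h3 := h_int.1 U
  rw [← h_sym.1, BaseGeometry.innerL, Γ.hermitianFormL_ofSectionL, Γ.toBase_hermitianL_smulL_left]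
  exact ⟨h3.1, h3.2.trans h2⟩

theorem hasWirtingerDerivAt_potR {T₁ : P.sections α} {T₂ : P.sections (conjCorep α)}
    (h_int : 𝔐.Interchange T₁ T₂) (U : P.sections (conjCorep α)) :
    HasWirtingerDerivAt (fun z : ℂ => Γ.state (𝔐.potR (T₂ + z • U)))
      (Γ.innerR 𝔐.basis.conj (Γ.ofSectionR (Γ.smulR T₂ (star (𝔐.potDerivR T₂))))
        (Γ.ofSectionR U)) 0 := by
  have h1 := hasFDerivAt_sesquilinear (Γ.hermitianFormR 𝔐.basis.conj).flip LinearMap.id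
    (Γ.ofSectionR T₂) (Γ.ofSectionR U) 0
  simp only [smul_zero, add_zero, ← Γ.ofSectionR_add_smul, LinearMap.id_apply,
    LinearMap.flip_apply, Γ.hermitianFormR_ofSectionR] at h1
  rw [← Γ.star_toBase_hermitianR 𝔐.basis.conj T₂ U] at h1
  have h0 : 𝔐.normR (T₂ + (0 : ℂ) • U) = 𝔐.normR T₂ := by rw [zero_smul, add_zero]
  have h2 := 𝔐.state_wirtingerDeriv_pot (F := fun z : ℂ => 𝔐.normR (T₂ + z • U))
    (Γ.star_toBase_hermitianR 𝔐.basis.conj _ _) h1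
  rw [h0] at h2
  have h3 := h_int.2 U
  rw [BaseGeometry.innerR, Γ.hermitianFormR_ofSectionR, Γ.toBase_hermitianR_smulR_left, star_star]
  exact ⟨h3.1, h3.2.trans h2⟩

/-! ### The variation of the action -/

theorem action_eq (ω : R.Inv →ₗ[ℂ] A) (T₁ : P.sections α) (T₂ : P.sections (conjCorep α)) :
    𝔐.action ω T₁ T₂ =
      (-1 / 4 : ℂ) • (Γ.innerL 𝔐.adBasisL (𝔐.curvL ω) (𝔐.curvL ω) +
        Γ.innerR 𝔐.adBasisR (𝔐.curvR ω) (𝔐.curvR ω)) +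
      (1 / 4 : ℂ) • (Γ.innerL 𝔐.basis (Γ.nablaL ω T₁) (Γ.nablaL ω T₁) - Γ.state (𝔐.potL T₁) -
        Γ.innerR 𝔐.basis.conj (Γ.nablaR ω T₂) (Γ.nablaR ω T₂) + Γ.state (𝔐.potR T₂)) := by
  simp only [action, lagrangianYM, lagrangianGSM, map_add, map_sub, map_smul,
    BaseGeometry.innerL, BaseGeometry.innerR]

theorem hasWirtingerDerivAt_action_connection (hG : IsCompactMatrixQuantumGroup G)
    {ω lam : R.Inv →ₗ[ℂ] A} (hω : P.IsConnection ω) (h : P.IsDisplacement lam)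
    (T₁ : P.sections α) (T₂ : P.sections (conjCorep α)) :
    HasWirtingerDerivAt (fun z : ℂ => 𝔐.action (ω + z • lam) T₁ T₂)
      ((1 / 4 : ℂ) * (Γ.innerL 𝔐.basis (Γ.upsilonL (P.covK lam ∘ₗ T₁.1)) (Γ.nablaL ω T₁) -
          Γ.innerR 𝔐.basis.conj (Γ.upsilonR (P.dualOp (P.covK lam) ∘ₗ T₂.1)) (Γ.nablaR ω T₂) -
        (Γ.innerL 𝔐.adBasisL (Γ.upsilonL lam) (𝔐.ymCurrentL ω) +
          Γ.innerR 𝔐.adBasisR (Γ.upsilonR (P.dual lam)) (𝔐.ymCurrentR ω)))) 0 := by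
  obtain ⟨N, T, hT⟩ : ∃ (N : ℕ) (T : Fin N → P.sections α), P.IsFrameL 𝔐.basis T := 𝔐.frame
  obtain ⟨N', T', hT'⟩ := exists_isFrameR_conj 𝔐.frame
  have h1 := ((𝔐.hasWirtingerDerivAt_curvL hG hω h).add
    (𝔐.hasWirtingerDerivAt_curvR hG hω h)).const_smul (-1 / 4)
  have h2 := Γ.hasWirtingerDerivAt_nablaL_connection 𝔐.isMatrixCorep_basis hT hω h T₁
  have h3 := Γ.hasWirtingerDerivAt_nablaR_connection hG.comul_star (𝔐.isMatrixCorep_basis_conj hG)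
    hT' hω h T₂
  have h4 := h1.add ((((h2.sub (hasWirtingerDerivAt_const (Γ.state (𝔐.potL T₁)) 0)).sub h3).add
    (hasWirtingerDerivAt_const (Γ.state (𝔐.potR T₂)) 0)).const_smul (1 / 4))
  simp only [action_eq]
  convert h4 using 1
  simp only [smul_eq_mul]
  ring

theorem hasWirtingerDerivAt_action_sections (hG : IsCompactMatrixQuantumGroup G)
    {ω : R.Inv →ₗ[ℂ] A} (hω : P.IsConnection ω) {T₁ : P.sections α}
    {T₂ : P.sections (conjCorep α)} (h_int : 𝔐.Interchange T₁ T₂) (h_sym : 𝔐.Symmetric T₁ T₂)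
    (U₁ : P.sections α) (U₂ : P.sections (conjCorep α)) :
    HasWirtingerDerivAt (fun z : ℂ => 𝔐.action ω (T₁ + z • U₁) (T₂ + z • U₂))
      ((1 / 4 : ℂ) * (Γ.innerL 𝔐.basis (Γ.ofSectionL U₁) (Γ.codiffL 1 ω (Γ.nablaL ω T₁) -
          Γ.ofSectionL (Γ.smulL (star (𝔐.potDerivL T₁)) T₁)) -
        Γ.innerR 𝔐.basis.conj (Γ.codiffR 1 ω (Γ.nablaR ω T₂) -
          Γ.ofSectionR (Γ.smulR T₂ (star (𝔐.potDerivR T₂)))) (Γ.ofSectionR U₂))) 0 := by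
  obtain ⟨N, T, hT⟩ : ∃ (N : ℕ) (T : Fin N → P.sections α), P.IsFrameL 𝔐.basis T := 𝔐.frame
  obtain ⟨N', T', hT'⟩ := exists_isFrameR_conj 𝔐.frame
  have h2 := Γ.hasWirtingerDerivAt_nablaL_section 𝔐.isMatrixCorep_basis hT hω (hω.dual hG) T₁ U₁
  have h3 := Γ.hasWirtingerDerivAt_nablaR_section hG.comul_star (𝔐.isMatrixCorep_basis_conj hG)
    hT' hω (hω.dual hG) T₂ U₂
  have h4 := (hasWirtingerDerivAt_const ((-1 / 4 : ℂ) • (Γ.innerL 𝔐.adBasisL (𝔐.curvL ω)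
    (𝔐.curvL ω) + Γ.innerR 𝔐.adBasisR (𝔐.curvR ω) (𝔐.curvR ω))) 0).add
    ((((h2.sub (𝔐.hasWirtingerDerivAt_potL h_int h_sym U₁)).sub h3).add
      (𝔐.hasWirtingerDerivAt_potR h_int U₂)).const_smul (1 / 4))
  simp only [action_eq]
  convert h4 using 1
  rw [Γ.innerL_sub_right, Γ.innerR_sub_left, smul_eq_mul]
  ring

end YMSMModel

end ModelVariations

end

end QYM

/-- The field equations of Yang-Mills-Scalar-Matter fields. -/
theorem theorem6p1p15
    {G : Type u} [Ring G] [HopfAlgebra ℂ G] [StarRing G] [StarModule ℂ G]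
    (hG : QYM.IsCompactMatrixQuantumGroup G) {R : QYM.BicovariantCalculus G}
    {W : Type u} [Ring W] [Algebra ℂ W] {ℬ : ℕ → Submodule ℂ W} [GradedAlgebra ℬ]
    {E : QYM.Envelope R ℬ}
    {A : Type*} [Ring A] [Algebra ℂ A] {𝒜 : ℕ → Submodule ℂ A} [GradedAlgebra 𝒜]
    {P : QYM.QuantumPrincipalBundle E 𝒜}
    {B : Type*} [CStarAlgebra B] [PartialOrder B] [StarOrderedRing B] {M : StarSubalgebra ℂ B}
    {Γ : QYM.BaseGeometry P M}
    {V : Type*} [AddCommGroup V] [Module ℂ V] {α : V →ₗ[ℂ] V ⊗[ℂ] G}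
    {κ κ₁ κ₂ : Type*} [Fintype κ] [DecidableEq κ] [Fintype κ₁] [DecidableEq κ₁]
    [Fintype κ₂] [DecidableEq κ₂]
    (𝔐 : QYM.YMSMModel Γ α κ κ₁ κ₂)
    (ω : R.Inv →ₗ[ℂ] A) (hω : P.IsConnection ω)
    (T₁ : P.sections α) (T₂ : P.sections (QYM.conjCorep α))
    (h_int : 𝔐.Interchange T₁ T₂) (h_sym : 𝔐.Symmetric T₁ T₂) :
    𝔐.IsStationary ω T₁ T₂ ↔
      (∀ lam : R.Inv →ₗ[ℂ] A, P.IsDisplacement lam →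
        Γ.innerL 𝔐.basis (Γ.upsilonL (P.covK lam ∘ₗ T₁.1)) (Γ.nablaL ω T₁) -
          Γ.innerR 𝔐.basis.conj (Γ.upsilonR (P.dualOp (P.covK lam) ∘ₗ T₂.1)) (Γ.nablaR ω T₂) =
        Γ.innerL 𝔐.adBasisL (Γ.upsilonL lam) (𝔐.ymCurrentL ω) +
          Γ.innerR 𝔐.adBasisR (Γ.upsilonR (P.dual lam)) (𝔐.ymCurrentR ω)) ∧
      Γ.codiffL 1 ω (Γ.nablaL ω T₁) -
        Γ.ofSectionL (Γ.smulL (star (𝔐.potDerivL T₁)) T₁) = 0 ∧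
      Γ.codiffR 1 ω (Γ.nablaR ω T₂) -
        Γ.ofSectionR (Γ.smulR T₂ (star (𝔐.potDerivR T₂))) = 0 := by
  obtain ⟨N, T, hT⟩ : ∃ (N : ℕ) (T : Fin N → P.sections α), P.IsFrameL 𝔐.basis T := 𝔐.frame
  obtain ⟨N', T', hT'⟩ := QYM.QuantumPrincipalBundle.exists_isFrameR_conj 𝔐.frame
  have hb := 𝔐.isMatrixCorep_basis
  have hb' := 𝔐.isMatrixCorep_basis_conj hG
  have hconn := fun lam h => 𝔐.hasWirtingerDerivAt_action_connection (lam := lam) hG hω h T₁ T₂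
  have hsect := 𝔐.hasWirtingerDerivAt_action_sections hG hω h_int h_sym
  constructor
  · intro hst
    have h1 := fun U₁ U₂ => (hst 0 U₁ U₂ QYM.QuantumPrincipalBundle.isDisplacement_zero).2.eq
      (hsect U₁ U₂)
    refine ⟨fun lam h => ?_, ?_, ?_⟩
    · have h2 := (hst lam 0 0 h).1.eq (hconn lam h)
      exact sub_eq_zero.1 ((mul_eq_zero.1 h2.symm).resolve_left (by norm_num))
    · obtain ⟨S, hS⟩ := Γ.exists_codiffL_eq_ofSectionL hb hT (hω.dual hG)
        (Γ.mulFormL_nablaL_mem hb hT hω T₁)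
      simp only [hS, ← Γ.ofSectionL_sub] at h1 ⊢
      refine (congrArg Γ.ofSectionL (Γ.eq_zero_of_innerL_ofSectionL hT fun U => ?_)).trans
        Γ.ofSectionL_zero
      have h2 := h1 U 0
      rw [Γ.ofSectionR_zero, Γ.innerR_zero_right, sub_zero] at h2
      exact (mul_eq_zero.1 h2.symm).resolve_left (by norm_num)
    · obtain ⟨S, hS⟩ := Γ.exists_codiffR_eq_ofSectionR hG.comul_star hb' hT' (hω.dual hG)
        (Γ.mulFormR_nablaR_mem hG.comul_star hb' hT' hω T₂)
      simp only [hS, ← Γ.ofSectionR_sub] at h1 ⊢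
      refine (congrArg Γ.ofSectionR (Γ.eq_zero_of_innerR_ofSectionR hT' fun U => ?_)).trans
        Γ.ofSectionR_zero
      have h2 := h1 0 U
      rw [Γ.ofSectionL_zero, Γ.innerL_zero_left, zero_sub] at h2
      exact neg_eq_zero.1 ((mul_eq_zero.1 h2.symm).resolve_left (by norm_num))
  · rintro ⟨h1, h2, h3⟩ lam U₁ U₂ h
    have h4 := hconn lam h
    have h5 := hsect U₁ U₂
    rw [h1 lam h, sub_self, mul_zero] at h4
    rw [h2, h3] at h5
    refine ⟨h4, ?_⟩
    simpa [QYM.BaseGeometry.innerL, QYM.BaseGeometry.innerR] using h5
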